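/- For an odd integer $k$ let $E_k: y^2 = x(x^2-k^2)$, and for $b_1 \in \mathbb{Q}^\times$ consider the torsors $$\mathcal{T}^{(\psi)}(b_1): N^2 = b_1M^4+b_2e^4,\ b_1b_2=-k^2, \qquad \mathcal{T}^{(\phi)}(b_1): N^2=b_1M^4+b_2e^4,\ b_1b_2=4k^2 .$$ A rational point on such a torsor means a solution $(N,M,e)\in\mathbb{Q}^3$ with $(N,M,e)\neq(0,0,0)$. For a prime $q\equiv 1 \pmod 4$ and an integer $a$ with Legendre symbol $(a/q)=1$ let $(a/q)_4=+1$ if $a$ is a fourth power modulo $q$, and $(a/q)_4=-1$ otherwise. Let $[\alpha/\varpi]$ denote the quadratic residue symbol modulo a prime element $\varpi$ in $\mathbb{Z}[i]$ or in $\mathbb{Z}[\sqrt2]$, respectively. Let $p$ and $l$ be distinct primes with $p\equiv l\equiv 3,5,7 \pmod 8$, and let $k=pl$. 1. If $p\equiv l\equiv 5\pmod 8$, $(p/l)=+1$, and at least one of $\mathcal{T}^{(\phi)}(p)$, $\mathcal{T}^{(\phi)}(l)$, $\mathcal{T}^{(\phi)}(pl)$ has a rational point, then $(p/l)_4=(l/p)_4$.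 2. If $p\equiv l\equiv 5\pmod 8$, $(p/l)=-1$, and at least one of $\mathcal{T}^{(\phi)}(2p)$, $\mathcal{T}^{(\phi)}(2l)$, $\mathcal{T}^{(\phi)}(pl)$ has a rational point, then $[(1+i)\pi/\lambda]=+1$ in $\mathbb{Z}[i]$ for all $\pi,\lambda\in\mathbb{Z}[i]$ with norms $p$ and $l$, respectively, where $\pi$ is normalized by $\pi\equiv 3+2i \pmod{4+4i}$ (of the two conjugate primes of norm $p$ that are $\equiv 1 \pmod{2+2i}$, exactly one satisfies this). 3. If $p\equiv l\equiv 7\pmod 8$, $(p/l)=+1$, and at least one of $\mathcal{T}^{(\phi)}(2)$, $\mathcal{T}^{(\psi)}(p)$, $\mathcal{T}^{(\psi)}(l)$ has a rational point, then $[\Lambda/\Pi]=+1$ in $\mathbb{Z}[\sqrt2]$ for every primary $\Lambda\in\mathbb{Z}[\sqrt2]$ of norm $-l$ (primary means congruent to a square modulo $4$) and every $\Pi\in\mathbb{Z}[\sqrt2]$ of norm $\pm p$. -/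

import Mathlib

/-- The quartic `N² = b₁ M⁴ + b₂ e⁴` has a rational point other than `(N, M, e) = (0, 0, 0)`. -/
def HasNontrivialPoint (b₁ b₂ : ℚ) : Prop :=
  ∃ N M e : ℚ, ¬ (N = 0 ∧ M = 0 ∧ e = 0) ∧ N ^ 2 = b₁ * M ^ 4 + b₂ * e ^ 4

/-- The torsor `𝒯^(ψ)(b₁) : N² = b₁ M⁴ + b₂ e⁴`, `b₁ b₂ = -k²`, attached to
`E_k : y² = x (x² - k²)`, has a (nontrivial) rational point. -/
def PsiTorsorHasPoint (k : ℤ) (b₁ : ℚ) : Prop :=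
  ∃ b₂ : ℚ, b₁ * b₂ = -(k : ℚ) ^ 2 ∧ HasNontrivialPoint b₁ b₂

/-- The torsor `𝒯^(φ)(b₁) : N² = b₁ M⁴ + b₂ e⁴`, where `b₁ b₂ = 4 k²` for odd `k` and
`b₁ b₂ = k² / 4` for even `k`, attached to `E_k : y² = x (x² - k²)`, has a (nontrivial)
rational point. -/
def PhiTorsorHasPoint (k : ℤ) (b₁ : ℚ) : Prop :=
  ∃ b₂ : ℚ, b₁ * b₂ = (if Odd k then 4 * (k : ℚ) ^ 2 else (k : ℚ) ^ 2 / 4) ∧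
    HasNontrivialPoint b₁ b₂

open Classical in
/-- The rational biquadratic residue symbol `(a / q)₄`, meant for primes `q ≡ 1 (mod 4)` and
integers `a` with `(a / q) = 1`: it is `1` or `-1` according as `a` is a fourth power modulo `q`
or not (and `0` if `q` divides `a`). -/
noncomputable def quarticSymbol (a : ℤ) (q : ℕ) : ℤ :=
  if (a : ZMod q) = 0 then 0 else if ∃ x : ZMod q, x ^ 4 = (a : ZMod q) then 1 else -1

open Classical in
/-- The quadratic residue symbol `[α / ϖ]` in a commutative ring, meant for prime elements `ϖ`
(of odd norm): it is `0` if `ϖ` divides `α`, and otherwise `1` or `-1` according as `α` is a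
square modulo `ϖ` or not. -/
noncomputable def quadraticSymbol {R : Type*} [CommRing R] (α ϖ : R) : ℤ :=
  if ϖ ∣ α then 0 else if ∃ x : R, ϖ ∣ x ^ 2 - α then 1 else -1

/-- An element is primary if it is congruent to a square modulo `4`. (An element `r + s√2` with
`r` odd and `s` even is primary in this sense if and only if `r + s ≡ 1 (mod 4)`.) -/
def IsPrimaryElement {R : Type*} [CommRing R] (α : R) : Prop :=
  ∃ x : R, (4 : R) ∣ α - x ^ 2

/-- The Gaussian integer `π` is normalized by `π ≡ 3 + 2i (mod 4 + 4i)`, or equivalently by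
`(1 + i) π ≡ 1 + 5i (mod 8)`. If `p ≡ 5 (mod 8)` is a prime, then among the two primes of norm `p`
that are `≡ 1 (mod 2 + 2i)`, which are conjugate to each other, exactly one has this property. -/
def IsNormalizedGaussian (π : GaussianInt) : Prop :=
  (⟨4, 4⟩ : GaussianInt) ∣ π - ⟨3, 2⟩

-- After clearing denominators, a point on a torsor is a solution of `b n² = M⁴ + c e⁴` with coprime
-- integers `M`, `e`. Factoring this equation produces elements of `ℤ[i]` or `ℤ[√2]` whose norm is a
-- prime, or minus a prime, times a square or the like. An element of norm `p n²` with coprime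
-- coordinates is a prime of norm `p` times a square, so the symbol of that prime can be computed
-- from the coordinates, where it is a Jacobi symbol. Such symbols are evaluated by one device: if
-- `m` divides `N y² - x²` and is prime to `x`, then `N` is a square modulo `m`, and reciprocity
-- gives `(m/N)`.
--
-- Part 1. Burde's law `quarticSymbol_mul_quarticSymbol` equates `(p/l)₄ (l/p)₄` with the symbol of
-- `a + bi` modulo a prime above `l`, where `a² + b² = p`. Both sides equal `-χ₄(X)` for a primitive
-- solution of `X² = pY² + lZ²`, which exists by a pigeonhole argument. On `𝒯^(φ)(p)` the element
-- `M² + 2le²i` of norm `pn²` is visibly a square modulo `l`. On `𝒯^(φ)(pl)` one uses `M⁴ + 4e⁴ =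
-- ((M+e)² + e²)((M-e)² + e²)` and distributes `p` and `l` over the two coprime factors.
--
-- Part 2. Now `π` and its conjugate have opposite symbols modulo a prime above `l`, so it matters
-- which of them occurs. Multiplying by a square preserves `re - im` modulo `8` up to sign, and the
-- normalization says `re - im ≡ 1 (mod 8)`; this tells the conjugates apart. The torsor of `2l` is
-- the torsor of `2p` with the primes exchanged, and `quadraticChar_normalized_recip` carries the
-- result back.
--
-- Part 3. The `ψ` torsors lead to one of two systems, `x² - 2y² = lz²`, `x² - y² = pv²` or `y² -
-- 2x² = -pz²`, `x² - y² = lv²`, treated in `quadraticChar_of_pair_one` and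
-- `quadraticChar_of_pair_two`. For `𝒯^(φ)(2)`, a parametrization of `2n² = U² + V²` writes `U` and
-- `V` as norms from `ℤ[√2]`. Primarity fixes signs: `quadraticChar_one_sub_mul_sign` relates the
-- symbol of the unit `1 - √2` to the sign of the second coordinate.

local notation "χ[" q "]" => quadraticChar (ZMod q)

/-! ### Jacobi symbols of divisors of values of binary quadratic forms -/

theorem exists_eq_two_pow_mul_odd {m : ℤ} (hm : m ≠ 0) :
    ∃ (k : ℕ) (n : ℤ), m = 2 ^ k * n ∧ ¬ 2 ∣ n :=
  ⟨_, (Int.finiteMultiplicity_iff.2 ⟨by decide, hm⟩ :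
    FiniteMultiplicity 2 m).exists_eq_pow_mul_and_not_dvd⟩

/-- The congruence `a y² ≡ x²` together with `gcd(m, x) = 1` makes both `x` and `y` units modulo
`m`. Nearly every symbol below is computed by exhibiting such a congruence and then applying
reciprocity. -/
theorem jacobiSym_natAbs_eq_one {a m x y : ℤ} (h : m ∣ a * y ^ 2 - x ^ 2)
    (hc : IsCoprime m x) : jacobiSym a m.natAbs = 1 := by
  have hx : jacobiSym (x ^ 2) m.natAbs = 1 :=
    jacobiSym.sq_one' (by simpa only [Int.gcd, Int.natAbs_natCast] using Int.isCoprime_iff_gcd_eq_one.1 hc.symm)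
  have hay : IsCoprime m (a * y ^ 2) := by
    obtain ⟨k, hk⟩ := h
    have : a * y ^ 2 = x ^ 2 + m * k := by linarith
    rw [this]
    exact (hc.pow_right (n := 2)).add_mul_left_right k
  have hy : IsCoprime m y := (hay.of_mul_right_right).of_isCoprime_of_dvd_right (dvd_pow_self y two_ne_zero)
  have hy' : jacobiSym (y ^ 2) m.natAbs = 1 :=
    jacobiSym.sq_one' (by simpa only [Int.gcd, Int.natAbs_natCast] using Int.isCoprime_iff_gcd_eq_one.1 hy.symm)
  have key : jacobiSym (a * y ^ 2) m.natAbs = jacobiSym (x ^ 2) m.natAbs := by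
    apply jacobiSym.mod_left'
    apply Int.ModEq.symm
    rw [Int.modEq_iff_dvd]
    exact Int.natAbs_dvd.2 h
  rw [jacobiSym.mul_left, hx, hy', mul_one] at key
  exact key

theorem jacobiSym_neg_of_mod_four {N : ℕ} (hN : N % 4 = 1) (m : ℤ) :
    jacobiSym (-m) N = jacobiSym m N := by
  rw [jacobiSym.neg m (Nat.odd_iff.2 (by omega)), ZMod.χ₄_nat_one_mod_four hN, one_mul]

theorem jacobiSym_neg_of_mod_four' {N : ℕ} (hN : N % 4 = 3) (m : ℤ) :
    jacobiSym (-m) N = -jacobiSym m N := by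
  rw [jacobiSym.neg m (Nat.odd_iff.2 (by omega)), ZMod.χ₄_nat_three_mod_four hN, neg_one_mul]

theorem jacobiSym_natAbs_of_mod_four {N : ℕ} (hN : N % 4 = 1) (m : ℤ) :
    jacobiSym (m.natAbs : ℤ) N = jacobiSym m N := by
  rcases Int.natAbs_eq m with h | h
  · rw [← h]
  · conv_rhs => rw [h, jacobiSym_neg_of_mod_four hN]

/-- Reciprocity with an odd bottom entry `m` of arbitrary sign. -/
theorem jacobiSym_recip_mod_four {N : ℕ} (hN : N % 4 = 1) {m : ℤ} (hm : Odd m) :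
    jacobiSym m N = jacobiSym N m.natAbs := by
  rw [← jacobiSym_natAbs_of_mod_four hN]
  exact (jacobiSym.quadratic_reciprocity_one_mod_four hN (Int.natAbs_odd.2 hm)).symm

theorem jacobiSym_eq_one_of_dvd {N : ℕ} (hN : N % 4 = 1) {m x y : ℤ} (hm : Odd m)
    (h : m ∣ N * y ^ 2 - x ^ 2) (hc : IsCoprime m x) : jacobiSym m N = 1 := by
  rw [jacobiSym_recip_mod_four hN hm, jacobiSym_natAbs_eq_one h hc]

theorem jacobiSym_two_mod_eight {N : ℕ} (hN : N % 8 = 1 ∨ N % 8 = 7) : jacobiSym 2 N = 1 := by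
  rw [jacobiSym.at_two (Nat.odd_iff.2 (by omega)), ZMod.χ₈_nat_eq_if_mod_eight]
  rcases hN with h | h <;> simp [h] <;> omega

theorem jacobiSym_two_mod_eight' {N : ℕ} (hN : N % 8 = 3 ∨ N % 8 = 5) : jacobiSym 2 N = -1 := by
  rw [jacobiSym.at_two (Nat.odd_iff.2 (by omega)), ZMod.χ₈_nat_eq_if_mod_eight]
  rcases hN with h | h <;> simp [h] <;> omega

/-- Powers of `2` in `m` are harmless here because `2` is a residue when `N ≡ 1 (mod 8)`. -/
theorem jacobiSym_eq_one_of_dvd' {N : ℕ} (hN : N % 8 = 1) {m x y : ℤ} (hm : m ≠ 0)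
    (h : m ∣ N * y ^ 2 - x ^ 2) (hc : IsCoprime m x) : jacobiSym m N = 1 := by
  obtain ⟨k, n, rfl, hn⟩ := exists_eq_two_pow_mul_odd hm
  rw [jacobiSym.mul_left, jacobiSym.pow_left, jacobiSym_two_mod_eight (Or.inl hN), one_pow, one_mul]
  refine jacobiSym_eq_one_of_dvd (by omega) (Int.not_even_iff_odd.1 fun h2 => hn h2.two_dvd)
    ((Dvd.intro_left _ rfl).trans h) (hc.of_mul_left_right)

/-- The sign of `m` does not matter: if `m < 0` then `|m| ≡ 3 (mod 4)`, and the minus sign of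
reciprocity cancels the one from `(-1/N) = -1`. -/
theorem jacobiSym_eq_one_of_dvd_of_mod {N : ℕ} (hN : N % 4 = 3) {m x y : ℤ} (hm : m % 4 = 1)
    (h : m ∣ N * y ^ 2 - x ^ 2) (hc : IsCoprime m x) : jacobiSym m N = 1 := by
  have h1 := jacobiSym_natAbs_eq_one h hc
  rcases Int.natAbs_eq m with e | e
  · rw [e, ← jacobiSym.quadratic_reciprocity_one_mod_four' (Nat.odd_iff.2 (by omega)) (by omega)]
    exact h1
  · rw [e, jacobiSym_neg_of_mod_four' hN,
      jacobiSym.quadratic_reciprocity_three_mod_four (by omega) hN, h1, neg_neg]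

/-- For the odd part `n` of `m`, `(-N/n) = 1`. Since `N ≡ 3 (mod 4)`, reciprocity turns exactly this
into `(n/N) = 1`, and `(2/N) = 1` handles the power of `2`. -/
theorem jacobiSym_eq_sign_of_dvd {N : ℕ} (hN : N % 8 = 7) {m x y : ℤ} (hm : 0 < m)
    (h : m ∣ N * y ^ 2 + x ^ 2) (hc : IsCoprime m x) : jacobiSym m N = 1 := by
  obtain ⟨k, n, rfl, hn⟩ := exists_eq_two_pow_mul_odd hm.ne'
  have hn0 : 0 < n := by
    have : (0 : ℤ) < 2 ^ k := by positivity
    exact (pos_iff_pos_of_mul_pos hm).1 this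
  rw [jacobiSym.mul_left, jacobiSym.pow_left, jacobiSym_two_mod_eight (Or.inr hN), one_pow, one_mul]
  have hodd : n % 2 = 1 := by omega
  have h1 : jacobiSym (-N) n.natAbs = 1 := by
    refine jacobiSym_natAbs_eq_one (x := x) (y := y) ?_ (hc.of_mul_left_right)
    have := ((Dvd.intro_left _ rfl).trans h : n ∣ _)
    rw [show -(N : ℤ) * y ^ 2 - x ^ 2 = -(N * y ^ 2 + x ^ 2) by ring]
    exact (dvd_neg).2 this
  have hoddn : Odd n.natAbs := Nat.odd_iff.2 (by omega)
  rw [jacobiSym.neg _ hoddn] at h1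
  have e : (n : ℤ) = (n.natAbs : ℤ) := by omega
  rcases (show n.natAbs % 4 = 1 ∨ n.natAbs % 4 = 3 by omega) with h4 | h4
  · rw [ZMod.χ₄_nat_one_mod_four h4, one_mul] at h1
    rw [e, ← jacobiSym.quadratic_reciprocity_one_mod_four' (Nat.odd_iff.2 (by omega)) h4, h1]
  · rw [ZMod.χ₄_nat_three_mod_four h4] at h1
    rw [e, jacobiSym.quadratic_reciprocity_three_mod_four h4 (by omega)]
    linarith

/-! ### Quadratic characters modulo a prime -/

section Char

variable {q : ℕ} [Fact q.Prime]

theorem quadraticChar_intCast (m : ℤ) : χ[q] (m : ZMod q) = jacobiSym m q := by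
  rw [← jacobiSym.legendreSym.to_jacobiSym]; rfl

theorem quadraticChar_eq_of_sq_mul {a b c : ZMod q} (hb : b ≠ 0) (h : a = c * b ^ 2) :
    χ[q] a = χ[q] c := by
  rw [h, map_mul, quadraticChar_sq_one' hb, mul_one]

theorem quadraticChar_sq_eq {a : ZMod q} (ha : a ≠ 0) : χ[q] a * χ[q] a = 1 := by
  rw [← sq, quadraticChar_sq_one ha]

theorem quadraticChar_two_mod_eight (hq : q % 8 = 1 ∨ q % 8 = 7) : χ[q] 2 = 1 := by
  have := quadraticChar_intCast (q := q) 2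
  rw [jacobiSym_two_mod_eight hq] at this
  exact_mod_cast this

theorem quadraticChar_two_mod_eight' (hq : q % 8 = 3 ∨ q % 8 = 5) : χ[q] 2 = -1 := by
  have := quadraticChar_intCast (q := q) 2
  rw [jacobiSym_two_mod_eight' hq] at this
  exact_mod_cast this

theorem quadraticChar_neg_mod_four (hq : q % 4 = 1) (a : ZMod q) : χ[q] (-a) = χ[q] a := by
  have := quadraticChar_intCast (q := q) (-1)
  rw [jacobiSym_neg_of_mod_four hq, jacobiSym.one_left] at this
  rw [neg_eq_neg_one_mul, map_mul]
  push_cast at this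
  rw [this, one_mul]

theorem quadraticChar_neg_mod_four' (hq : q % 4 = 3) (a : ZMod q) : χ[q] (-a) = -χ[q] a := by
  have := quadraticChar_intCast (q := q) (-1)
  rw [jacobiSym_neg_of_mod_four' hq, jacobiSym.one_left] at this
  rw [neg_eq_neg_one_mul, map_mul]
  push_cast at this
  rw [this, neg_one_mul]

theorem two_ne_zero_of_mod (hq : q % 2 = 1) : (2 : ZMod q) ≠ 0 := by
  intro h
  have : ((2 : ℕ) : ZMod q) = 0 := by exact_mod_cast h
  rw [ZMod.natCast_eq_zero_iff] at this
  have := Nat.le_of_dvd (by norm_num) this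
  have := (Fact.out : q.Prime).two_le
  omega

/-- A square root of `-1` modulo a prime `q ≡ 5 (mod 8)` is not a square. -/
theorem quadraticChar_sqrt_neg_one (hq : q % 8 = 5) {j : ZMod q} (hj : j ^ 2 = -1) :
    χ[q] j = -1 := by
  have h2 := two_ne_zero_of_mod (q := q) (by omega)
  -- Hence `j` has the same character as `2`, which is a nonresidue for `q ≡ 5 (mod 8)`.
  have e : (1 + j) ^ 2 = 2 * j := by linear_combination hj
  have hj0 : j ≠ 0 := by rintro rfl; simp at hj
  have h1 : (1 + j) ≠ 0 := by
    intro h; rw [h] at e; exact (mul_ne_zero h2 hj0) (by rw [← e]; ring)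
  have := quadraticChar_sq_one' h1
  rw [e, map_mul, quadraticChar_two_mod_eight' (Or.inr hq)] at this
  linarith

theorem intCast_ne_zero_iff {m : ℤ} : ((m : ZMod q) ≠ 0) ↔ ¬ (q : ℤ) ∣ m := by
  rw [Ne, ZMod.intCast_zmod_eq_zero_iff_dvd]

theorem Nat.Prime.int_coprime_iff {m : ℤ} : IsCoprime (q : ℤ) m ↔ ¬ (q : ℤ) ∣ m :=
  (Nat.prime_iff_prime_int.1 (Fact.out : q.Prime)).coprime_iff_not_dvd

end Char

/-! ### Residue symbols in quadratic orders -/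

section Symbol

variable {q : ℕ} [Fact q.Prime] {d : ℤ}

/-- The ring homomorphism `ℤ[√d] → ZMod q` sending `√d` to `w`. -/
noncomputable def Zsqrtd.toZMod (w : ZMod q) (hw : w ^ 2 = d) : ℤ√d →+* ZMod q :=
  Zsqrtd.lift ⟨w, by rw [← sq, hw]⟩

theorem Zsqrtd.toZMod_apply (w : ZMod q) (hw : w ^ 2 = d) (α : ℤ√d) :
    Zsqrtd.toZMod w hw α = α.re + α.im * w := by
  simp [Zsqrtd.toZMod, Zsqrtd.lift]

/-- Otherwise `q` would divide both coordinates, and `q²` would divide the norm `±q`. -/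
theorem Zsqrtd.not_dvd_im_of_norm {P : ℤ√d} (hP : P.norm.natAbs = q) : ¬ (q : ℤ) ∣ P.im := by
  intro h
  have hp : Prime (q : ℤ) := Nat.prime_iff_prime_int.1 (Fact.out : q.Prime)
  have hn : (q : ℤ) ∣ P.norm := by rw [← hP]; exact Int.natAbs_dvd.2 dvd_rfl
  have hre : (q : ℤ) ∣ P.re := by
    rw [Zsqrtd.norm_def] at hn
    have : (q : ℤ) ∣ P.re * P.re := (dvd_sub_left (h.mul_left _)).1 hn
    rcases hp.dvd_or_dvd this with h | h <;> exact h
  obtain ⟨a, ha⟩ := hre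
  obtain ⟨b, hb⟩ := h
  have h2 : (q : ℤ) * q ∣ P.norm := ⟨a * a - d * b * b, by rw [Zsqrtd.norm_def, ha, hb]; ring⟩
  have h3 : (q * q : ℕ) ∣ q := by
    have := Int.natAbs_dvd_natAbs.2 h2
    rwa [hP, Int.natAbs_mul, Int.natAbs_natCast] at this
  have := Nat.le_of_dvd (Fact.out : q.Prime).pos h3
  have := (Fact.out : q.Prime).two_le
  nlinarith

theorem Zsqrtd.exists_root {P : ℤ√d} (hP : P.norm.natAbs = q) :
    ∃ w : ZMod q, w ^ 2 = d ∧ (P.re : ZMod q) + P.im * w = 0 := by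
  have hb : (P.im : ZMod q) ≠ 0 := intCast_ne_zero_iff.2 (Zsqrtd.not_dvd_im_of_norm hP)
  have hn : ((P.norm : ℤ) : ZMod q) = 0 := by
    rw [ZMod.intCast_zmod_eq_zero_iff_dvd, ← hP]; exact Int.natAbs_dvd.2 dvd_rfl
  rw [Zsqrtd.norm_def] at hn
  push_cast at hn
  refine ⟨-P.re / P.im, ?_, by field_simp; ring⟩
  field_simp
  linear_combination hn

/-- The kernel of reduction at the root `w` attached to `P` is the ideal `(P)`. If `α` reduces to
`0`, both coordinates of `α · star P` vanish modulo `q`, so `P · star P` divides `α · star P` and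
the conjugate cancels. Symbols modulo `P` thereby become quadratic characters of `ZMod q`. -/
theorem Zsqrtd.dvd_iff_toZMod {P : ℤ√d} (hP : P.norm.natAbs = q) {w : ZMod q} (hw : w ^ 2 = d)
    (h0 : (P.re : ZMod q) + P.im * w = 0) (α : ℤ√d) : P ∣ α ↔ Zsqrtd.toZMod w hw α = 0 := by
  constructor
  · rintro ⟨β, rfl⟩
    rw [map_mul, Zsqrtd.toZMod_apply w hw P, h0, zero_mul]
  · intro h
    rw [Zsqrtd.toZMod_apply] at h
    have hb : (P.im : ZMod q) ≠ 0 := intCast_ne_zero_iff.2 (Zsqrtd.not_dvd_im_of_norm hP)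
    have h1 : (q : ℤ) ∣ α.im * P.re - α.re * P.im := by
      rw [← ZMod.intCast_zmod_eq_zero_iff_dvd]; push_cast
      linear_combination (α.im : ZMod q) * h0 - (P.im : ZMod q) * h
    have h2 : (q : ℤ) ∣ α.re * P.re - d * α.im * P.im := by
      rw [← ZMod.intCast_zmod_eq_zero_iff_dvd]; push_cast
      have : (α.re : ZMod q) = - (α.im * w) := by linear_combination h
      have h' : (P.re : ZMod q) = - (P.im * w) := by linear_combination h0
      rw [this, h', ← hw]; ring
    have hq : P.norm ∣ (q : ℤ) := by
      rw [← Int.natAbs_dvd, hP]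
    have hdvd : (P.norm : ℤ√d) ∣ α * star P := by
      rw [Zsqrtd.intCast_dvd]
      simp only [Zsqrtd.re_mul, Zsqrtd.im_mul, Zsqrtd.re_star, Zsqrtd.im_star]
      constructor
      · refine hq.trans (h2.trans (dvd_of_eq (by ring)))
      · refine hq.trans (h1.trans (dvd_of_eq (by ring)))
    rw [Zsqrtd.norm_eq_mul_conj] at hdvd
    obtain ⟨β, hβ⟩ := hdvd
    refine ⟨β, ?_⟩
    have hs : (P.norm : ℤ√d) * (α - P * β) = 0 := by
      rw [Zsqrtd.norm_eq_mul_conj]; linear_combination P * hβ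
    have hn0 : P.norm ≠ 0 := by
      intro h; rw [h] at hP; exact (Fact.out : q.Prime).ne_zero hP.symm
    exact Zsqrtd.eq_of_smul_eq_smul_left hn0 (by linear_combination hs)

theorem quadraticSymbol_eq_one {P : ℤ√d} (hP : P.norm.natAbs = q) {w : ZMod q} (hw : w ^ 2 = d)
    (h0 : (P.re : ZMod q) + P.im * w = 0) {α : ℤ√d}
    (h : χ[q] ((α.re : ZMod q) + α.im * w) = 1) : quadraticSymbol α P = 1 := by
  have hne : (α.re : ZMod q) + α.im * w ≠ 0 := by
    intro h'; rw [h', quadraticChar_zero] at h; exact zero_ne_one h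
  unfold quadraticSymbol
  rw [if_neg, if_pos]
  · obtain ⟨x, hx⟩ := (quadraticChar_one_iff_isSquare hne).1 h
    refine ⟨(x.val : ℤ√d), ?_⟩
    rw [Zsqrtd.dvd_iff_toZMod hP hw h0, map_sub, map_pow, map_natCast, ZMod.natCast_zmod_val,
      Zsqrtd.toZMod_apply, hx]
    ring
  · rw [Zsqrtd.dvd_iff_toZMod hP hw h0, Zsqrtd.toZMod_apply]; exact hne

end Symbol

/-! ### Integral points on the torsors -/

/-- The equation is homogeneous with `N` of weight `2` and `M`, `e` of weight `1`. Rescaling makes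
`M`, `e` coprime integers, and the new `N` is an integer because its square is. -/
theorem HasNontrivialPoint.exists_int {b₁ b₂ : ℤ} (h : HasNontrivialPoint b₁ b₂) :
    ∃ N M e : ℤ, IsCoprime M e ∧ N ^ 2 = b₁ * M ^ 4 + b₂ * e ^ 4 := by
  obtain ⟨N, M, e, hne, h⟩ := h
  have hMe : ¬ (M = 0 ∧ e = 0) := by
    rintro ⟨rfl, rfl⟩
    apply hne
    refine ⟨?_, rfl, rfl⟩
    simpa using h
  set D : ℤ := M.den * e.den with hD
  have hD0 : (D : ℚ) ≠ 0 := by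
    rw [hD]; push_cast; exact mul_ne_zero (by exact_mod_cast M.den_ne_zero) (by exact_mod_cast e.den_ne_zero)
  set A : ℤ := M.num * e.den with hA
  set B : ℤ := e.num * M.den with hB
  have hMA : M * D = A := by
    rw [hD, hA]; push_cast; rw [← mul_assoc, Rat.mul_den_eq_num]
  have heB : e * D = B := by
    rw [hD, hB]; push_cast; rw [mul_comm (M.den : ℚ), ← mul_assoc, Rat.mul_den_eq_num]
  have hAB : ¬ (A = 0 ∧ B = 0) := by
    rintro ⟨h1, h2⟩
    rw [h1] at hMA; rw [h2] at heB
    exact hMe ⟨by simpa [hD0] using hMA, by simpa [hD0] using heB⟩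
  have hg : 0 < Int.gcd A B := Int.gcd_pos_iff.2 (by tauto)
  obtain ⟨A', B', hcop, hA', hB'⟩ := Int.exists_gcd_one hg
  set g : ℤ := (Int.gcd A B : ℤ)
  have hg0 : (g : ℚ) ≠ 0 := Int.cast_ne_zero.2 (by positivity)
  have key : (N * D ^ 2 / g ^ 2) ^ 2 = ((b₁ * A' ^ 4 + b₂ * B' ^ 4 : ℤ) : ℚ) := by
    have e1 : (A : ℚ) = A' * g := by exact_mod_cast hA'
    have e2 : (B : ℚ) = B' * g := by exact_mod_cast hB'
    rw [e1] at hMA; rw [e2] at heB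
    push_cast
    field_simp
    calc N ^ 2 * (D : ℚ) ^ 4 = b₁ * (M * D) ^ 4 + b₂ * (e * D) ^ 4 := by rw [h]; ring
      _ = _ := by rw [hMA, heB]; ring
  have hsq : IsSquare ((b₁ * A' ^ 4 + b₂ * B' ^ 4 : ℤ) : ℚ) := ⟨_, by rw [← key, sq]⟩
  rw [Rat.isSquare_intCast_iff] at hsq
  obtain ⟨n, hn⟩ := hsq
  exact ⟨n, A', B', Int.isCoprime_iff_gcd_eq_one.2 hcop, by rw [hn, sq]⟩

/-! ### The equation `X² = p Y² + l Z²` -/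

theorem sq_ne_prime {q : ℕ} (hq : q.Prime) (x : ℤ) : x ^ 2 ≠ q := by
  intro h
  have hp := Nat.prime_iff_prime_int.1 hq
  obtain ⟨c, rfl⟩ := hp.dvd_of_dvd_pow (dvd_of_eq h.symm)
  have h1 : (q : ℤ) * (q * c ^ 2 - 1) = 0 := by linear_combination h
  have h0 : (q : ℤ) ≠ 0 := hp.ne_zero
  have h2 : (q : ℤ) * c ^ 2 = 1 := by
    rcases mul_eq_zero.1 h1 with h | h
    · exact absurd h h0
    · linarith
  exact hp.not_isUnit (IsUnit.of_mul_eq_one _ h2)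

theorem not_sq_eq_mul {p l : ℕ} (hp : p.Prime) (hl : l.Prime) (hpl : p ≠ l) (x : ℤ) :
    x ^ 2 ≠ p * l := by
  intro h
  have hp' := Nat.prime_iff_prime_int.1 hp
  obtain ⟨c, rfl⟩ := hp'.dvd_of_dvd_pow (Dvd.intro _ h.symm)
  have h0 : (p : ℤ) ≠ 0 := hp'.ne_zero
  have h2 : (p : ℤ) * c ^ 2 = l := mul_left_cancel₀ h0 (by linear_combination h)
  have h3 : (p : ℤ) ∣ l := Dvd.intro _ h2
  exact hpl ((Nat.prime_dvd_prime_iff_eq hp hl).1 (by exact_mod_cast h3))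

/-- Pigeonhole: the box with sides `⌊√(pl)⌋ + 1`, `⌊√l⌋ + 1`, `⌊√p⌋ + 1` has more than `pl` points,
so two of them agree in `ZMod l × ZMod p`; their difference is the solution. -/
theorem exists_small_of_modEq (p l : ℕ) [NeZero p] [NeZero l] (u v : ℤ) :
    ∃ X Y Z : ℤ, ¬ (X = 0 ∧ Y = 0 ∧ Z = 0) ∧ X ^ 2 ≤ p * l ∧ Y ^ 2 ≤ l ∧ Z ^ 2 ≤ p ∧
      (l : ℤ) ∣ X - u * Y ∧ (p : ℤ) ∣ X - v * Z := by
  classical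
  let S : Finset (ℕ × ℕ × ℕ) := Finset.range (Nat.sqrt (p * l) + 1) ×ˢ
    Finset.range (Nat.sqrt l + 1) ×ˢ Finset.range (Nat.sqrt p + 1)
  let f : ℕ × ℕ × ℕ → ZMod l × ZMod p := fun t =>
    ((t.1 : ZMod l) - u * t.2.1, (t.1 : ZMod p) - v * t.2.2)
  have hcard : (Finset.univ : Finset (ZMod l × ZMod p)).card < S.card := by
    rw [Finset.card_univ, Fintype.card_prod, ZMod.card, ZMod.card]
    simp only [S, Finset.card_product, Finset.card_range]
    have h1 := Nat.lt_succ_sqrt (p * l)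
    have h2 := Nat.lt_succ_sqrt l
    have h3 := Nat.lt_succ_sqrt p
    rw [Nat.succ_eq_add_one] at h1 h2 h3
    have : (l * p) * (l * p) < ((Nat.sqrt (p * l) + 1) * ((Nat.sqrt l + 1) * (Nat.sqrt p + 1))) *
        ((Nat.sqrt (p * l) + 1) * ((Nat.sqrt l + 1) * (Nat.sqrt p + 1))) := by
      calc (l * p) * (l * p) = (p * l) * (l * p) := by ring
        _ < ((Nat.sqrt (p * l) + 1) * (Nat.sqrt (p * l) + 1)) *
            (((Nat.sqrt l + 1) * (Nat.sqrt l + 1)) * ((Nat.sqrt p + 1) * (Nat.sqrt p + 1))) :=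
          Nat.mul_lt_mul_of_lt_of_le h1 (Nat.mul_le_mul h2.le h3.le) (by positivity)
        _ = _ := by ring
    by_contra! hle
    exact absurd (Nat.mul_le_mul hle hle) (by omega)
  obtain ⟨⟨x, y, z⟩, hs, ⟨x', y', z'⟩, ht, hne, hf⟩ :=
    Finset.exists_ne_map_eq_of_card_lt_of_maps_to hcard (f := f) (fun _ _ => Finset.mem_univ _)
  simp only [S, Finset.mem_product, Finset.mem_range] at hs ht
  simp only [f, Prod.mk.injEq] at hf
  have key : ∀ {n a b : ℕ}, a < Nat.sqrt n + 1 → b < Nat.sqrt n + 1 → ((a : ℤ) - b) ^ 2 ≤ n := by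
    intro n a b ha hb
    have h1 : |(a : ℤ) - b| ≤ Nat.sqrt n := by rw [abs_le]; constructor <;> omega
    have h2 : (Nat.sqrt n : ℤ) * Nat.sqrt n ≤ n := by exact_mod_cast Nat.sqrt_le n
    rw [← sq_abs]
    nlinarith [abs_nonneg ((a : ℤ) - b)]
  refine ⟨x - x', y - y', z - z', ?_, ?_, key hs.2.1 ht.2.1, key hs.2.2 ht.2.2, ?_, ?_⟩
  · rintro ⟨h1, h2, h3⟩
    apply hne
    rw [Prod.mk.injEq, Prod.mk.injEq]
    omega
  · exact_mod_cast key hs.1 ht.1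
  · rw [← ZMod.intCast_zmod_eq_zero_iff_dvd]; push_cast
    linear_combination hf.1
  · rw [← ZMod.intCast_zmod_eq_zero_iff_dvd]; push_cast
    linear_combination hf.2

/-- Legendre's theorem for this form. The small solution of the congruences makes `X² - pY² - lZ²` a
multiple of `pl` lying strictly between `-2pl` and `pl`, hence `0` or `-pl`. -/
theorem exists_sq_eq_add {p l : ℕ} (hp : p.Prime) (hl : l.Prime) (hpl : p ≠ l) {u v : ℤ}
    (hu : (l : ℤ) ∣ u ^ 2 - p) (hv : (p : ℤ) ∣ v ^ 2 - l) :
    ∃ X Y Z : ℤ, X ≠ 0 ∧ X ^ 2 = p * Y ^ 2 + l * Z ^ 2 := by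
  have : NeZero p := ⟨hp.ne_zero⟩
  have : NeZero l := ⟨hl.ne_zero⟩
  obtain ⟨X, Y, Z, hne, hX, hY, hZ, h1, h2⟩ := exists_small_of_modEq p l u v
  have hp0 : (0 : ℤ) < p := by exact_mod_cast hp.pos
  have hl0 : (0 : ℤ) < l := by exact_mod_cast hl.pos
  have hX' : X ^ 2 < p * l := lt_of_le_of_ne hX (not_sq_eq_mul hp hl hpl X)
  have hY' : Y ^ 2 < l := lt_of_le_of_ne hY (sq_ne_prime hl Y)
  have hZ' : Z ^ 2 < p := lt_of_le_of_ne hZ (sq_ne_prime hp Z)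
  have d1 : (l : ℤ) ∣ X ^ 2 - p * Y ^ 2 - l * Z ^ 2 := by
    obtain ⟨a, ha⟩ := h1
    obtain ⟨b, hb⟩ := hu
    exact ⟨a * (X + u * Y) + b * Y ^ 2 - Z ^ 2, by linear_combination (X + u * Y) * ha + Y ^ 2 * hb⟩
  have d2 : (p : ℤ) ∣ X ^ 2 - p * Y ^ 2 - l * Z ^ 2 := by
    obtain ⟨a, ha⟩ := h2
    obtain ⟨b, hb⟩ := hv
    exact ⟨a * (X + v * Z) + b * Z ^ 2 - Y ^ 2, by linear_combination (X + v * Z) * ha + Z ^ 2 * hb⟩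
  have hcop : IsCoprime (p : ℤ) l := Nat.isCoprime_iff_coprime.2 ((Nat.coprime_primes hp hl).2 hpl)
  obtain ⟨k, hk⟩ := hcop.mul_dvd d2 d1
  have hpl0 : (0 : ℤ) < p * l := mul_pos hp0 hl0
  have hk1 : k < 1 := by
    by_contra! h
    nlinarith [sq_nonneg Y, sq_nonneg Z, mul_nonneg hp0.le (sq_nonneg Y), mul_nonneg hl0.le (sq_nonneg Z)]
  have hk2 : -2 < k := by
    by_contra! h
    have := mul_lt_mul_of_pos_left hY' hp0
    have := mul_lt_mul_of_pos_left hZ' hl0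
    nlinarith [sq_nonneg X]
  obtain rfl | rfl : k = 0 ∨ k = -1 := by omega
  · refine ⟨X, Y, Z, ?_, by linarith⟩
    rintro rfl
    apply hne
    have h1 : (p : ℤ) * Y ^ 2 = 0 := by
      have := mul_nonneg hp0.le (sq_nonneg Y); have := mul_nonneg hl0.le (sq_nonneg Z); nlinarith
    have h2 : (l : ℤ) * Z ^ 2 = 0 := by nlinarith
    exact ⟨rfl, by simpa [hp.ne_zero] using h1, by simpa [hl.ne_zero] using h2⟩
  -- From `X² + pl = pY² + lZ²`, multiply by `X² + pl` and use `(X² + pl)(pY² + lZ²) = p(XY + lZ)² +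
  -- l(XZ - pY)²`.
  · refine ⟨X ^ 2 + p * l, X * Y + l * Z, X * Z - p * Y, by positivity, ?_⟩
    have e : (X : ℤ) ^ 2 + p * l = p * Y ^ 2 + l * Z ^ 2 := by linarith
    linear_combination (X ^ 2 + (p : ℤ) * l) * e

/-- Take a solution with `X > 0` minimal. A prime dividing two of the unknowns divides the third,
because `p` and `l` are squarefree, and could then be cancelled. -/
theorem exists_primitive_sq_eq_add {p l : ℕ} (hp : p.Prime) (hl : l.Prime) (hpl : p ≠ l) {u v : ℤ}
    (hu : (l : ℤ) ∣ u ^ 2 - p) (hv : (p : ℤ) ∣ v ^ 2 - l) :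
    ∃ X Y Z : ℤ, 0 < X ∧ IsCoprime X Y ∧ IsCoprime X Z ∧ IsCoprime Y Z ∧
      X ^ 2 = p * Y ^ 2 + l * Z ^ 2 := by
  classical
  have hp' := Nat.prime_iff_prime_int.1 hp
  have hl' := Nat.prime_iff_prime_int.1 hl
  have hex : ∃ n : ℕ, 0 < n ∧ ∃ Y Z : ℤ, (n : ℤ) ^ 2 = p * Y ^ 2 + l * Z ^ 2 := by
    obtain ⟨X, Y, Z, h0, h⟩ := exists_sq_eq_add hp hl hpl hu hv
    exact ⟨X.natAbs, Int.natAbs_pos.2 h0, Y, Z, by rw [Int.natCast_natAbs, sq_abs, h]⟩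
  obtain ⟨hn0, Y, Z, h⟩ := Nat.find_spec hex
  have hmin := fun m hm => Nat.find_min hex (m := m) hm
  generalize Nat.find hex = n at hn0 h hmin
  have hall : ∀ q : ℤ, Prime q → q ∣ (n : ℤ) → q ∣ Y → q ∣ Z → False := by
    intro q hq ⟨a, ha⟩ ⟨b, hb⟩ ⟨c, hc⟩
    have hq0 := hq.ne_zero
    have ha0 : a ≠ 0 := by rintro rfl; simp at ha; omega
    refine hmin a.natAbs ?_ ⟨Int.natAbs_pos.2 ha0, b, c, ?_⟩
    · have h1 : n = q.natAbs * a.natAbs := by rw [← Int.natAbs_mul, ← ha, Int.natAbs_natCast]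
      have h2 : 1 < q.natAbs := (Int.prime_iff_natAbs_prime.1 hq).one_lt
      have h3 : 0 < a.natAbs := Int.natAbs_pos.2 ha0
      nlinarith
    · rw [Int.natCast_natAbs, sq_abs]
      rw [ha, hb, hc] at h
      exact mul_left_cancel₀ (pow_ne_zero 2 hq0) (by linear_combination h)
  have hdvd : ∀ {q r s W : ℤ}, Prime q → Prime r → q ^ 2 ∣ r * W ^ 2 → q ∣ W := by
    intro q r _ W hq hr h
    by_contra hW
    have hc : IsCoprime (q ^ 2) (W ^ 2) := ((hq.coprime_iff_not_dvd).2 hW).pow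
    have h1 : q ^ 2 ∣ r := hc.dvd_of_dvd_mul_right h
    obtain ⟨c, hc⟩ := h1
    rcases hr.irreducible.isUnit_or_isUnit (show r = q * (q * c) by rw [hc]; ring) with h | h
    · exact hq.not_isUnit h
    · exact hq.not_isUnit (isUnit_of_mul_isUnit_left h)
  refine ⟨n, Y, Z, by exact_mod_cast hn0, ?_, ?_, ?_, h⟩
  · refine isCoprime_of_prime_dvd (by rintro ⟨h, -⟩; omega) fun q hq h1 h2 => hall q hq h1 h2 ?_
    refine hdvd (s := 0) hq hl' ?_
    obtain ⟨a, ha⟩ := h1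
    obtain ⟨b, hb⟩ := h2
    exact ⟨a ^ 2 - p * b ^ 2, by rw [ha, hb] at h; linear_combination -h⟩
  · refine isCoprime_of_prime_dvd (by rintro ⟨h, -⟩; omega) fun q hq h1 h2 => hall q hq h1 ?_ h2
    refine hdvd (s := 0) hq hp' ?_
    obtain ⟨a, ha⟩ := h1
    obtain ⟨b, hb⟩ := h2
    exact ⟨a ^ 2 - l * b ^ 2, by rw [ha, hb] at h; linear_combination -h⟩
  · refine isCoprime_of_prime_dvd ?_ fun q hq h1 h2 => hall q hq ?_ h1 h2
    · rintro ⟨rfl, rfl⟩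
      have : (n : ℤ) = 0 := by simpa using h
      omega
    · apply hq.dvd_of_dvd_pow (n := 2)
      rw [h]
      exact dvd_add ((dvd_pow h1 two_ne_zero).mul_left _) ((dvd_pow h2 two_ne_zero).mul_left _)

/-! ### Burde's rational biquadratic reciprocity law -/

/-- The square roots of `a` are `±s`, and these have the same character because `-1` is a square
modulo `q`. -/
theorem quarticSymbol_eq_of_sq {q : ℕ} [Fact q.Prime] (hq : q % 4 = 1) {a : ℤ} {s : ZMod q}
    (hs : s ^ 2 = a) (h0 : s ≠ 0) : quarticSymbol a q = χ[q] s := by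
  have ha : (a : ZMod q) ≠ 0 := by rw [← hs]; exact pow_ne_zero 2 h0
  unfold quarticSymbol
  rw [if_neg ha]
  by_cases hsq : IsSquare s
  · rw [(quadraticChar_one_iff_isSquare h0).2 hsq, if_pos]
    obtain ⟨t, rfl⟩ := hsq
    exact ⟨t, by rw [← hs]; ring⟩
  · rw [quadraticChar_neg_one_iff_not_isSquare.2 hsq, if_neg]
    rintro ⟨t, ht⟩
    have h2 : (t ^ 2 - s) * (t ^ 2 + s) = 0 := by linear_combination ht - hs
    rcases mul_eq_zero.1 h2 with h | h
    · exact hsq ⟨t, by linear_combination -h⟩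
    · apply hsq
      rw [← quadraticChar_one_iff_isSquare h0, ← quadraticChar_neg_mod_four hq,
        quadraticChar_one_iff_isSquare (neg_ne_zero.2 h0)]
      exact ⟨t, by linear_combination -h⟩

/-- If an odd `m` divides `l Z² + B²`, then `-l` is a Jacobi square modulo `m`, even when common
factors are present, as long as they are not shared with the cofactor. -/
theorem jacobiSym_neg_eq_one_of_mul_eq {l : ℕ} (m : ℕ) (m' Z B : ℤ)
    (hml : IsCoprime (m : ℤ) l) (h : m * m' = l * Z ^ 2 + B ^ 2)
    (hq : ∀ q : ℤ, Prime q → q ∣ m → q ∣ m' → q ∣ Z → q ∣ B → False) :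
    jacobiSym (-l) m = 1 := by
  induction m using Nat.strong_induction_on generalizing Z B with
  | _ m ih =>
  rcases Nat.eq_zero_or_pos m with rfl | hm0
  · exact jacobiSym.zero_right _
  -- A prime common to `m`, `Z`, `B` does not divide `m'`, so its square divides `m`. Removing that
  -- square leaves the symbol unchanged, and the induction continues with a smaller `m`.
  by_cases hex : ∃ q : ℕ, q.Prime ∧ (q : ℤ) ∣ m ∧ (q : ℤ) ∣ Z ∧ (q : ℤ) ∣ B
  · obtain ⟨q, hqp, h1, ⟨Z', rfl⟩, ⟨B', rfl⟩⟩ := hex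
    have hqi := Nat.prime_iff_prime_int.1 hqp
    have h3 : ¬ (q : ℤ) ∣ m' := fun h' => hq q hqi h1 h' (Dvd.intro _ rfl) (Dvd.intro _ rfl)
    have h4 : (q : ℤ) ^ 2 ∣ m * m' := ⟨l * Z' ^ 2 + B' ^ 2, by rw [h]; ring⟩
    have h5 : (q : ℤ) ^ 2 ∣ m :=
      (((hqi.coprime_iff_not_dvd).2 h3).pow_left).dvd_of_dvd_mul_right h4
    obtain ⟨n, rfl⟩ : q ^ 2 ∣ m := by exact_mod_cast h5
    have hn0 : n ≠ 0 := by rintro rfl; simp at hm0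
    have hq0 : (q : ℤ) ≠ 0 := hqi.ne_zero
    have hql : IsCoprime (q : ℤ) l := hml.of_isCoprime_of_dvd_left h1
    push_cast at hml
    rw [jacobiSym.mul_right' _ (pow_ne_zero 2 hqp.ne_zero) hn0, jacobiSym.pow_right,
      jacobiSym.sq_one, one_mul]
    · refine ih n ?_ Z' B' hml.of_mul_left_right ?_ ?_
      · have := Nat.one_lt_pow two_ne_zero hqp.one_lt
        nlinarith [Nat.pos_of_ne_zero hn0]
      · push_cast at h
        exact mul_left_cancel₀ (pow_ne_zero 2 hq0) (by linear_combination h)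
      · intro r hr g1 g2 g3 g4
        exact hq r hr (by push_cast; exact g1.mul_left _) g2 (g3.mul_left _) (g4.mul_left _)
    · rw [Int.neg_gcd]; exact Int.isCoprime_iff_gcd_eq_one.1 hql.symm
  · have hmB : IsCoprime (m : ℤ) B := by
      refine isCoprime_of_prime_dvd (by rintro ⟨h, -⟩; omega) fun q hqp h1 h2 => hex ?_
      refine ⟨q.natAbs, Int.prime_iff_natAbs_prime.1 hqp, Int.natAbs_dvd.2 h1, Int.natAbs_dvd.2 ?_,
        Int.natAbs_dvd.2 h2⟩
      have h3 : q ∣ l * Z ^ 2 := by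
        rw [← dvd_add_left (dvd_pow h2 two_ne_zero), ← h]
        exact h1.mul_right _
      have h4 : IsCoprime q l := hml.of_isCoprime_of_dvd_left h1
      exact hqp.dvd_of_dvd_pow (h4.dvd_of_dvd_mul_left h3)
    have := jacobiSym_natAbs_eq_one (a := -l) (m := m) (x := B) (y := Z)
      ⟨-m', by linear_combination h⟩ hmB
    rwa [Int.natAbs_natCast] at this

theorem jacobiSym_eq_χ₄_of_mul_eq {l : ℕ} (hl : l % 4 = 1) {m m' Z B : ℤ} (hm : 0 < m)
    (hodd : Odd m) (hml : IsCoprime m l) (h : m * m' = l * Z ^ 2 + B ^ 2)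
    (hq : ∀ q : ℤ, Prime q → q ∣ m → q ∣ m' → q ∣ Z → q ∣ B → False) :
    jacobiSym m l = ZMod.χ₄ m := by
  lift m to ℕ using hm.le
  have h1 := jacobiSym_neg_eq_one_of_mul_eq m m' Z B hml h hq
  have hodd' : Odd m := by exact_mod_cast hodd
  rw [jacobiSym.neg _ hodd'] at h1
  rw [jacobiSym_recip_mod_four hl hodd, Int.natAbs_natCast]
  have h2 := jacobiSym.eq_one_or_neg_one (a := (l : ℤ)) (b := m)
    (Int.isCoprime_iff_gcd_eq_one.1 hml.symm)
  push_cast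
  rcases h2 with h2 | h2 <;> rw [h2] at h1 ⊢ <;> linarith

theorem Int.sq_mod_eight_cases (x : ℤ) :
    (x % 2 = 1 ∧ x ^ 2 % 8 = 1) ∨ (x % 4 = 2 ∧ x ^ 2 % 8 = 4) ∨ (x % 4 = 0 ∧ x ^ 2 % 8 = 0) := by
  have : x % 8 = 0 ∨ x % 8 = 1 ∨ x % 8 = 2 ∨ x % 8 = 3 ∨ x % 8 = 4 ∨ x % 8 = 5 ∨ x % 8 = 6 ∨
    x % 8 = 7 := by omega
  rcases this with h | h | h | h | h | h | h | h <;> simp [sq, Int.mul_emod, h] <;> omega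

theorem IsCoprime.odd_or_odd {x y : ℤ} (h : IsCoprime x y) : x % 2 = 1 ∨ y % 2 = 1 := by
  by_contra! hc
  have := h.isUnit_of_dvd' (x := (2 : ℤ)) (by omega) (by omega)
  rw [Int.isUnit_iff] at this
  omega

theorem Int.mul_mod_eight {p y r : ℤ} (hp : p % 8 = r) : (p * y) % 8 = (r * (y % 8)) % 8 := by
  rw [Int.mul_emod, hp, Int.mul_emod r, Int.emod_emod, ← Int.mul_emod, ← hp]

theorem odd_parts_of_sq_eq_add {p l X Y Z : ℤ} (hp : p % 8 = 5) (hl : l % 8 = 5)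
    (hXY : IsCoprime X Y) (hXZ : IsCoprime X Z) (hYZ : IsCoprime Y Z)
    (h : X ^ 2 = p * Y ^ 2 + l * Z ^ 2) :
    X % 2 = 1 ∧ ((Y % 2 = 1 ∧ Z % 4 = 2) ∨ (Y % 4 = 2 ∧ Z % 2 = 1)) := by
  have h1 := Int.mul_mod_eight (y := Y ^ 2) hp
  have h2 := Int.mul_mod_eight (y := Z ^ 2) hl
  have a1 := hXY.odd_or_odd
  have a2 := hXZ.odd_or_odd
  have a3 := hYZ.odd_or_odd
  rcases Int.sq_mod_eight_cases X with ⟨x1, x2⟩ | ⟨x1, x2⟩ | ⟨x1, x2⟩ <;>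
  rcases Int.sq_mod_eight_cases Y with ⟨y1, y2⟩ | ⟨y1, y2⟩ | ⟨y1, y2⟩ <;>
  rcases Int.sq_mod_eight_cases Z with ⟨z1, z2⟩ | ⟨z1, z2⟩ | ⟨z1, z2⟩ <;>
  rw [y2] at h1 <;> rw [z2] at h2 <;> omega

theorem Int.χ₄_one {m : ℤ} (h : m % 4 = 1) : ZMod.χ₄ m = 1 := ZMod.χ₄_int_one_mod_four h

theorem Int.χ₄_three {m : ℤ} (h : m % 4 = 3) : ZMod.χ₄ m = -1 := ZMod.χ₄_int_three_mod_four h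

section Burde

variable {p l : ℕ} [Fact p.Prime] [Fact l.Prime]

theorem Nat.Prime.int_not_dvd (hpl : p ≠ l) : ¬ (l : ℤ) ∣ p := by
  intro h
  exact hpl ((Nat.prime_dvd_prime_iff_eq Fact.out Fact.out).1 (by exact_mod_cast h)).symm

theorem not_dvd_of_sq_eq_add (hpl : p ≠ l) {X Y Z : ℤ} (hXY : IsCoprime X Y)
    (h : X ^ 2 = p * Y ^ 2 + l * Z ^ 2) : ¬ (l : ℤ) ∣ X ∧ ¬ (l : ℤ) ∣ Y := by
  have hl := Nat.prime_iff_prime_int.1 (Fact.out : l.Prime)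
  have h1 : ¬ (l : ℤ) ∣ X := by
    intro hX
    have h2 : (l : ℤ) ∣ p * Y ^ 2 := by
      rw [← dvd_add_left (Dvd.intro _ rfl), ← h]; exact dvd_pow hX two_ne_zero
    rcases hl.dvd_or_dvd h2 with h3 | h3
    · exact Nat.Prime.int_not_dvd hpl h3
    · exact hl.not_isUnit (hXY.isUnit_of_dvd' hX (hl.dvd_of_dvd_pow h3))
  refine ⟨h1, fun hY => h1 (hl.dvd_of_dvd_pow (n := 2) ?_)⟩
  rw [h]
  exact dvd_add ((dvd_pow hY two_ne_zero).mul_left _) (Dvd.intro _ rfl)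

/-- Modulo `l`, `p` is the square of `X/Y`; modulo `p`, `l` is the square of `X/Z`. The product is
therefore `(X/l)(X/p) · (Y/l)(Z/p)`. The first pair is `(pl/X) = χ₄(X)`, since `-pl` is a square
modulo `X`. The second is `-1`: odd divisors contribute `1`, but exactly one of `Y`, `Z` is twice an
odd number. -/
theorem quarticSymbol_mul_eq_of_sq_eq_add (hp : p % 8 = 5) (hl : l % 8 = 5) (hpl : p ≠ l)
    {X Y Z : ℤ} (hX0 : 0 < X)
    (hXY : IsCoprime X Y) (hXZ : IsCoprime X Z) (hYZ : IsCoprime Y Z)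
    (h : X ^ 2 = p * Y ^ 2 + l * Z ^ 2) :
    quarticSymbol p l * quarticSymbol l p = -ZMod.χ₄ X := by
  obtain ⟨hXo, hpar⟩ := odd_parts_of_sq_eq_add (p := p) (l := l) (by omega) (by omega) hXY hXZ hYZ h
  obtain ⟨hlX, hlY⟩ := not_dvd_of_sq_eq_add hpl hXY h
  obtain ⟨hpX, hpZ⟩ := not_dvd_of_sq_eq_add (p := l) (l := p) (Z := Y) hpl.symm hXZ (by rw [h]; ring)
  have hX1 := intCast_ne_zero_iff.2 hlX
  have hY1 := intCast_ne_zero_iff.2 hlY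
  have hX2 := intCast_ne_zero_iff.2 hpX
  have hZ2 := intCast_ne_zero_iff.2 hpZ
  have e1 : quarticSymbol p l = jacobiSym X l * jacobiSym Y l := by
    rw [quarticSymbol_eq_of_sq (s := (X : ZMod l) / (Y : ZMod l)) (by omega) ?_ (div_ne_zero hX1 hY1)]
    · rw [← quadraticChar_intCast, ← quadraticChar_intCast, ← map_mul]
      exact (quadraticChar_eq_of_sq_mul hY1 (by field_simp)).symm
    · field_simp
      have := congrArg (Int.cast : ℤ → ZMod l) h
      push_cast at this ⊢
      simpa [mul_comm] using this
  have e2 : quarticSymbol l p = jacobiSym X p * jacobiSym Z p := by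
    rw [quarticSymbol_eq_of_sq (s := (X : ZMod p) / (Z : ZMod p)) (by omega) ?_ (div_ne_zero hX2 hZ2)]
    · rw [← quadraticChar_intCast, ← quadraticChar_intCast, ← map_mul]
      exact (quadraticChar_eq_of_sq_mul hZ2 (by field_simp)).symm
    · field_simp
      have := congrArg (Int.cast : ℤ → ZMod p) h
      push_cast at this ⊢
      simpa [mul_comm] using this
  have e3 : jacobiSym X l * jacobiSym X p = ZMod.χ₄ X := by
    have : NeZero p := ⟨(Fact.out : p.Prime).ne_zero⟩
    have : NeZero l := ⟨(Fact.out : l.Prime).ne_zero⟩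
    have hodd : Odd X := Int.odd_iff.2 hXo
    rw [← jacobiSym.mul_right, jacobiSym_recip_mod_four (by simp [Nat.mul_mod, show l % 4 = 1 by omega, show p % 4 = 1 by omega]) hodd]
    have hcp : IsCoprime X p := (Nat.Prime.int_coprime_iff.2 hpX).symm
    have h1 := jacobiSym_natAbs_eq_one (m := X) (a := -((l * p : ℕ) : ℤ)) (x := p * Y) (y := Z)
      ⟨-p * X, by push_cast; linear_combination (p : ℤ) * h⟩ (hcp.mul_right hXY)
    rw [jacobiSym.neg _ (Int.natAbs_odd.2 hodd)] at h1
    have h2 : ((X.natAbs : ℕ) : ZMod 4) = (X : ZMod 4) := by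
      conv_rhs => rw [← Int.natAbs_of_nonneg hX0.le]
      simp
    rw [h2] at h1
    rcases (show X % 4 = 1 ∨ X % 4 = 3 by omega) with h4 | h4
    · rw [Int.χ₄_one h4] at h1 ⊢; linarith
    · rw [Int.χ₄_three h4] at h1 ⊢; linarith
  have e4 : jacobiSym Y l * jacobiSym Z p = -1 := by
    have key : ∀ {q : ℕ}, q % 8 = 5 → ∀ {W c d : ℤ}, (W % 2 = 1 ∨ W % 4 = 2) → IsCoprime X W →
        X ^ 2 = q * c ^ 2 + W ^ 2 * d → jacobiSym W q = if W % 2 = 1 then 1 else -1 := by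
      intro q hq W c d hW hc hh
      split_ifs with ho
      · exact jacobiSym_eq_one_of_dvd (x := X) (y := c) (by omega) (Int.odd_iff.2 ho)
          ⟨-W * d, by rw [hh]; ring⟩ hc.symm
      · obtain ⟨V, rfl⟩ : (2 : ℤ) ∣ W := by omega
        rw [jacobiSym.mul_left, jacobiSym_two_mod_eight' (Or.inr hq),
          jacobiSym_eq_one_of_dvd (x := X) (y := c) (by omega) (Int.odd_iff.2 (by omega))
          ⟨-4 * V * d, by rw [hh]; ring⟩ (hc.symm.of_mul_left_right)]
        rfl
    rw [key hl (c := Z) (d := p) (by omega) hXY (by rw [h]; ring),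
      key hp (c := Y) (d := l) (by omega) hXZ (by rw [h]; ring)]
    rcases hpar with ⟨h1, h2⟩ | ⟨h1, h2⟩
    · rw [if_pos h1, if_neg (by omega)]; rfl
    · rw [if_neg (by omega), if_pos h2]; rfl
  rw [e1, e2]
  linear_combination (jacobiSym Y l * jacobiSym Z p) * e3 + ZMod.χ₄ X * e4

/-- With `π = a + bj` and `X² = pY²` modulo `l`, one has `(X + πY)² = 2Y(X + aY)π`, so the character
of `π` is that of the rational integer `2Y(X + aY)`. The factor `X + aY` is positive, and `(X +
aY)(X - aY) = lZ² + (bY)²` determines its Jacobi symbol through `jacobiSym_eq_χ₄_of_mul_eq`. -/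
theorem quadraticChar_eq_of_sq_eq_add (hp : p % 8 = 5) (hl : l % 8 = 5) (hpl : p ≠ l)
    {X Y Z a b : ℤ} (hX0 : 0 < X)
    (hXY : IsCoprime X Y) (hXZ : IsCoprime X Z) (hYZ : IsCoprime Y Z)
    (h : X ^ 2 = p * Y ^ 2 + l * Z ^ 2) (hab : a ^ 2 + b ^ 2 = p) (ha : a % 2 = 1)
    {j : ZMod l} (hj : j ^ 2 = -1) (hne : ¬ (l : ℤ) ∣ X + a * Y) :
    χ[l] (a + b * j) = -ZMod.χ₄ X := by
  obtain ⟨hXo, hpar⟩ := odd_parts_of_sq_eq_add (p := p) (l := l) (by omega) (by omega) hXY hXZ hYZ h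
  obtain ⟨hlX, hlY⟩ := not_dvd_of_sq_eq_add hpl hXY h
  have h2 : (2 : ZMod l) ≠ 0 := two_ne_zero_of_mod (by omega)
  have hp0 : (p : ZMod l) ≠ 0 := by
    have := intCast_ne_zero_iff.2 (Nat.Prime.int_not_dvd hpl)
    exact_mod_cast this
  have hY0 := intCast_ne_zero_iff.2 hlY
  have hn0 := intCast_ne_zero_iff.2 hne
  have hab' : (a : ZMod l) ^ 2 + b ^ 2 = p := by exact_mod_cast congrArg (Int.cast : ℤ → ZMod l) hab
  have hh : (X : ZMod l) ^ 2 = p * Y ^ 2 := by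
    have := congrArg (Int.cast : ℤ → ZMod l) h
    push_cast at this
    simpa using this
  have hz0 : (a : ZMod l) + b * j ≠ 0 := by
    intro h0
    apply hp0
    rw [← hab']
    linear_combination (a - b * j) * h0 + (b : ZMod l) ^ 2 * hj
  have hcore : χ[l] (a + b * j) = jacobiSym (2 * Y * (X + a * Y)) l := by
    rw [← quadraticChar_intCast]
    push_cast at hn0 ⊢
    have e : ((X : ZMod l) + a * Y + b * Y * j) ^ 2 = (2 * Y * (X + a * Y)) * (a + b * j) := by
      linear_combination hh - Y ^ 2 * hab' + b ^ 2 * Y ^ 2 * hj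
    have hne2 : (2 * Y * (X + a * Y) : ZMod l) * (a + b * j) ≠ 0 := by
      repeat' apply mul_ne_zero
      all_goals assumption
    have hs : ((X : ZMod l) + a * Y + b * Y * j) ≠ 0 := by
      intro h0; rw [h0] at e; exact hne2 (by rw [← e]; ring)
    have h1 := quadraticChar_sq_one' hs
    rw [e, map_mul] at h1
    have h3 := quadraticChar_sq_eq (q := l) hz0
    linear_combination (-χ[l] (a + b * j)) * h1 + χ[l] (2 * Y * (X + a * Y)) * h3
  have hZ0 : Z ≠ 0 := by rintro rfl; omega
  have hl0 : (0 : ℤ) < l := by exact_mod_cast (Fact.out : l.Prime).pos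
  have hlt : |a * Y| < |X| := by
    rw [← sq_lt_sq, h, ← hab]
    have := mul_pos hl0 (pow_pos (abs_pos.2 hZ0) 2)
    rw [sq_abs] at this
    nlinarith [sq_nonneg (b * Y)]
  rw [abs_of_pos hX0, abs_lt] at hlt
  have hpos : 0 < X + a * Y := by linarith
  have hb2 : b % 4 = 2 := by
    rcases Int.sq_mod_eight_cases a with ⟨x1, x2⟩ | ⟨x1, x2⟩ | ⟨x1, x2⟩ <;>
    rcases Int.sq_mod_eight_cases b with ⟨y1, y2⟩ | ⟨y1, y2⟩ | ⟨y1, y2⟩ <;> omega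
  have hbad : ∀ q : ℤ, Prime q → ¬ q ∣ 2 → q ∣ X + a * Y → q ∣ X - a * Y → q ∣ b * Y → False := by
    intro q hq hq2 h1 h3 h4
    have hqX : q ∣ X := by
      have : q ∣ 2 * X := by have := dvd_add h1 h3; rwa [show X + a * Y + (X - a * Y) = 2 * X by ring] at this
      exact (hq.dvd_or_dvd this).resolve_left hq2
    have hqY : ¬ q ∣ Y := fun hqY => hq.not_isUnit (hXY.isUnit_of_dvd' hqX hqY)
    have hqa : q ∣ a := (hq.dvd_or_dvd ((dvd_add_right hqX).1 h1)).resolve_right hqY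
    have hqb : q ∣ b := (hq.dvd_or_dvd h4).resolve_right hqY
    obtain ⟨a', rfl⟩ := hqa
    obtain ⟨b', rfl⟩ := hqb
    have hpp := Nat.prime_iff_prime_int.1 (Fact.out : p.Prime)
    have : (p : ℤ) = q * (q * (a' ^ 2 + b' ^ 2)) := by rw [← hab]; ring
    rcases hpp.irreducible.isUnit_or_isUnit this with hu | hu
    · exact hq.not_isUnit hu
    · exact hq.not_isUnit (isUnit_of_mul_isUnit_left hu)
  have hcopl : ∀ m : ℤ, m ∣ X + a * Y → IsCoprime m l := fun m hm =>
    (Nat.Prime.int_coprime_iff.2 fun hd => hne (hd.trans hm)).symm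
  have hyo : ∀ {W d : ℤ}, W % 2 = 1 → IsCoprime X W → X ^ 2 = l * Z ^ 2 + W ^ 2 * d →
      jacobiSym W l = 1 := fun {W d} ho hc hh => jacobiSym_eq_one_of_dvd (x := X) (y := Z) (by omega)
        (Int.odd_iff.2 ho) ⟨-W * d, by rw [hh]; ring⟩ hc.symm
  have h2odd : ∀ {q m : ℤ}, m % 2 = 1 → Prime q → q ∣ m → ¬ q ∣ 2 := by
    intro q m hm hq hd hq2
    have hc : IsCoprime m 2 := ⟨1, -(m / 2), by omega⟩
    exact hq.not_isUnit (hc.isUnit_of_dvd' hd hq2)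
  rw [hcore, jacobiSym.mul_left, jacobiSym.mul_left, jacobiSym_two_mod_eight' (Or.inr hl)]
  rcases hpar with ⟨hYo, hZe⟩ | ⟨hYe, hZo⟩
  · rw [hyo hYo hXY (d := p) (by rw [h]; ring)]
    obtain ⟨z, rfl⟩ : (2 : ℤ) ∣ Z := by omega
    obtain ⟨b', rfl⟩ : (2 : ℤ) ∣ b := by omega
    have haY : (a * Y) % 2 = 1 := by rw [Int.mul_emod, ha, hYo]; rfl
    obtain ⟨m, hm⟩ : (2 : ℤ) ∣ X + a * Y := by omega
    obtain ⟨n, hn⟩ : (2 : ℤ) ∣ X - a * Y := by omega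
    have hmn : m * n = l * z ^ 2 + (b' * Y) ^ 2 := by
      have : 4 * (m * n) = 4 * (l * z ^ 2 + (b' * Y) ^ 2) := by
        calc 4 * (m * n) = (2 * m) * (2 * n) := by ring
          _ = (X + a * Y) * (X - a * Y) := by rw [hm, hn]
          _ = _ := by linear_combination h - Y ^ 2 * hab
      linarith
    -- Here `z` and `b'Y` are odd, so `mn ≡ 5 + 1`. Exactly one of `m`, `n` is odd and the other is
    -- twice an odd number, which gives the two cases below.
    have hm8 : (m * n) % 8 = 6 := by
      have hlz := Int.mul_mod_eight (p := l) (r := 5) (y := z ^ 2) (by omega)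
      have hbY : (b' * Y) % 2 = 1 := by rw [Int.mul_emod, show b' % 2 = 1 by omega, hYo]; rfl
      rw [hmn]
      rcases Int.sq_mod_eight_cases z with ⟨x1, x2⟩ | ⟨x1, x2⟩ | ⟨x1, x2⟩ <;>
      rcases Int.sq_mod_eight_cases (b' * Y) with ⟨y1, y2⟩ | ⟨y1, y2⟩ | ⟨y1, y2⟩ <;>
      rw [x2] at hlz <;> omega
    have hXmn : X = m + n := by linarith
    have hm0 : 0 < m := by linarith
    rcases (show m % 2 = 1 ∨ m % 2 = 0 by omega) with hmo | hme
    · have hc := jacobiSym_eq_χ₄_of_mul_eq (l := l) (by omega) hm0 (Int.odd_iff.2 hmo)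
        (hcopl m ⟨2, by rw [hm]; ring⟩) hmn (fun q hq g1 g2 _ g4 => hbad q hq (h2odd hmo hq g1)
          (by rw [hm]; exact g1.mul_left _) (by rw [hn]; exact g2.mul_left _)
          (by rw [mul_assoc]; exact g4.mul_left _))
      rw [hm, jacobiSym.mul_left, hc, jacobiSym_two_mod_eight' (Or.inr hl)]
      have hn4 : n % 4 = 2 := by
        have := Int.mul_emod m n 4
        rcases (show m % 4 = 1 ∨ m % 4 = 3 by omega) with g | g <;>
        rcases (show n % 4 = 0 ∨ n % 4 = 1 ∨ n % 4 = 2 ∨ n % 4 = 3 by omega) with k | k | k | k <;>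
        rw [g, k] at this <;> omega
      rcases (show m % 4 = 1 ∨ m % 4 = 3 by omega) with g | g
      · rw [Int.χ₄_one g, Int.χ₄_three (by omega)]; norm_num
      · rw [Int.χ₄_three g, Int.χ₄_one (by omega)]; norm_num
    · obtain ⟨k, rfl⟩ : (2 : ℤ) ∣ m := by omega
      have hkn : (k * n) % 4 = 3 := by rw [mul_assoc] at hm8; omega
      have hko : k % 2 = 1 := by
        have := Int.mul_emod k n 2
        rcases (show k % 2 = 1 ∨ k % 2 = 0 by omega) with g | g
        · exact g
        · rw [g] at this; simp at this; omega
      have hc := jacobiSym_eq_χ₄_of_mul_eq (l := l) (m := k) (m' := 2 * n) (by omega) (by omega)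
        (Int.odd_iff.2 hko)
        (hcopl k ⟨4, by rw [hm]; ring⟩) (by rw [← hmn]; ring)
          (fun q hq g1 g2 _ g4 => hbad q hq (h2odd hko hq g1)
          (by rw [hm, ← mul_assoc]; exact g1.mul_left _) (by rw [hn]; exact g2)
          (by rw [mul_assoc]; exact g4.mul_left _))
      rw [hm, jacobiSym.mul_left, jacobiSym.mul_left, hc, jacobiSym_two_mod_eight' (Or.inr hl)]
      have := Int.mul_emod k n 4
      rcases (show k % 4 = 1 ∨ k % 4 = 3 by omega) with g | g
      · have : n % 4 = 3 := by
          rcases (show n % 4 = 0 ∨ n % 4 = 1 ∨ n % 4 = 2 ∨ n % 4 = 3 by omega) with k | k | k | k <;>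
          rw [g, k] at this <;> omega
        rw [Int.χ₄_one g, Int.χ₄_one (by omega)]; norm_num
      · have : n % 4 = 1 := by
          rcases (show n % 4 = 0 ∨ n % 4 = 1 ∨ n % 4 = 2 ∨ n % 4 = 3 by omega) with k | k | k | k <;>
          rw [g, k] at this <;> omega
        rw [Int.χ₄_three g, Int.χ₄_three (by omega)]; norm_num
  · obtain ⟨y, rfl⟩ : (2 : ℤ) ∣ Y := by omega
    have hyo' : y % 2 = 1 := by omega
    have hay : (a * y) % 2 = 1 := by rw [Int.mul_emod, ha, hyo']; rfl
    have hto : (X + a * (2 * y)) % 2 = 1 := by rw [show a * (2 * y) = 2 * (a * y) by ring]; omega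
    have hc := jacobiSym_eq_χ₄_of_mul_eq (l := l) (m := X + a * (2 * y)) (m' := X - a * (2 * y))
      (Z := Z) (B := b * (2 * y)) (by omega) hpos (Int.odd_iff.2 hto) (hcopl _ dvd_rfl)
      (by linear_combination h - (2 * y) ^ 2 * hab)
      (fun q hq g1 g2 _ g4 => hbad q hq (h2odd hto hq g1) g1 g2 g4)
    rw [hc, jacobiSym.mul_left, jacobiSym_two_mod_eight' (Or.inr hl),
      hyo hyo' (hXY.of_mul_right_right) (d := 4 * p) (by rw [h]; ring)]
    rw [show X + a * (2 * y) = X + 2 * (a * y) by ring]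
    rcases (show X % 4 = 1 ∨ X % 4 = 3 by omega) with g | g
    · rw [Int.χ₄_one g, Int.χ₄_three (by omega)]; norm_num
    · rw [Int.χ₄_three g, Int.χ₄_one (by omega)]; norm_num

theorem legendreSym_exists_sq {q : ℕ} [Fact q.Prime] {a : ℤ} (h : legendreSym q a = 1) :
    ∃ u : ℤ, (q : ℤ) ∣ u ^ 2 - a := by
  have h0 : (a : ZMod q) ≠ 0 := by
    intro h0; rw [(legendreSym.eq_zero_iff q a).2 h0] at h; exact zero_ne_one h
  obtain ⟨x, hx⟩ := (legendreSym.eq_one_iff q h0).1 h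
  refine ⟨x.val, ?_⟩
  rw [← ZMod.intCast_zmod_eq_zero_iff_dvd]
  push_cast
  rw [ZMod.natCast_zmod_val, hx]; ring

/-- Burde's law for primes `≡ 5 (mod 8)`. -/
theorem quarticSymbol_mul_quarticSymbol (hp : p % 8 = 5) (hl : l % 8 = 5) (hpl : p ≠ l)
    (h1 : legendreSym l p = 1) {a b : ℤ} (hab : a ^ 2 + b ^ 2 = p) (ha : a % 2 = 1)
    {j : ZMod l} (hj : j ^ 2 = -1) :
    quarticSymbol p l * quarticSymbol l p = χ[l] (a + b * j) := by
  have h2 : legendreSym p l = 1 := by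
    rw [← h1]
    exact (legendreSym.quadratic_reciprocity_one_mod_four (by omega) (by omega)).symm
  obtain ⟨u, hu⟩ := legendreSym_exists_sq h1
  obtain ⟨v, hv⟩ := legendreSym_exists_sq h2
  obtain ⟨X, Y, Z, hX0, hXY, hXZ, hYZ, h⟩ :=
    exists_primitive_sq_eq_add (Fact.out : p.Prime) (Fact.out : l.Prime) hpl hu hv
  rw [quarticSymbol_mul_eq_of_sq_eq_add hp hl hpl hX0 hXY hXZ hYZ h]
  -- If `X + aY` vanishes modulo `l`, replace `Y` by `-Y`; both cannot vanish since `l ∤ 2X`.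
  by_cases hd : (l : ℤ) ∣ X + a * Y
  · refine (quadraticChar_eq_of_sq_eq_add hp hl hpl hX0 (Y := -Y) hXY.neg_right hXZ hYZ.neg_left
      (by rw [h]; ring) hab ha hj fun h' => ?_).symm
    have h3 : (l : ℤ) ∣ 2 * X := by
      have := dvd_add hd h'
      rwa [show X + a * Y + (X + a * -Y) = 2 * X by ring] at this
    have h4 : ¬ (l : ℤ) ∣ 2 := by
      have := two_ne_zero_of_mod (q := l) (by omega)
      exact intCast_ne_zero_iff.1 (by exact_mod_cast this)
    rcases (Nat.prime_iff_prime_int.1 (Fact.out : l.Prime)).dvd_or_dvd h3 with h5 | h5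
    · exact h4 h5
    · exact (not_dvd_of_sq_eq_add hpl hXY h).1 h5
  · exact (quadraticChar_eq_of_sq_eq_add hp hl hpl hX0 hXY hXZ hYZ h hab ha hj hd).symm

end Burde

/-! ### Composition of sums of two squares -/

/-- This is divisibility of `A + Bi` by a prime above `p`: `p` divides `(aA + bB)(aA - bB)`, and the
factor it divides decides between `a + bi` and its conjugate. The quotient is `c + di`. -/
theorem exists_compose_sq_add_sq {p : ℕ} [Fact p.Prime] {a b A B k : ℤ} (hab : a ^ 2 + b ^ 2 = p)
    (h : A ^ 2 + B ^ 2 = p * k) :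
    ∃ b' c d : ℤ, (b' = b ∨ b' = -b) ∧ A = a * c - b' * d ∧ B = a * d + b' * c ∧
      c ^ 2 + d ^ 2 = k := by
  have hp := Nat.prime_iff_prime_int.1 (Fact.out : p.Prime)
  have hp0 := hp.ne_zero
  have main : ∀ b' : ℤ, (b' = b ∨ b' = -b) → (p : ℤ) ∣ a * A + b' * B →
      ∃ b' c d : ℤ, (b' = b ∨ b' = -b) ∧ A = a * c - b' * d ∧ B = a * d + b' * c ∧
        c ^ 2 + d ^ 2 = k := by
    intro b' hb' hd
    have hab' : a ^ 2 + b' ^ 2 = p := by rcases hb' with rfl | rfl <;> linarith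
    have hd2 : (p : ℤ) ∣ a * B - b' * A := by
      apply hp.dvd_of_dvd_pow (n := 2)
      have : (a * B - b' * A) ^ 2 = p * (p * k) - (a * A + b' * B) ^ 2 := by
        linear_combination (A ^ 2 + B ^ 2) * hab' + p * h
      rw [this]
      exact dvd_sub (Dvd.intro _ rfl) (dvd_pow hd two_ne_zero)
    obtain ⟨c, hc⟩ := hd
    obtain ⟨d, hd⟩ := hd2
    refine ⟨b', c, d, hb', ?_, ?_, ?_⟩
    · exact mul_left_cancel₀ hp0 (by linear_combination a * hc - b' * hd - A * hab')
    · exact mul_left_cancel₀ hp0 (by linear_combination a * hd + b' * hc - B * hab')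
    · refine mul_left_cancel₀ hp0 (mul_left_cancel₀ hp0 ?_)
      linear_combination (-p * c - (a * A + b' * B)) * hc + (-p * d - (a * B - b' * A)) * hd +
        (A ^ 2 + B ^ 2) * hab' + p * h
  have h1 : (p : ℤ) ∣ (a * A + b * B) * (a * A + -b * B) :=
    ⟨a ^ 2 * k - B ^ 2, by linear_combination a ^ 2 * h - B ^ 2 * hab⟩
  rcases hp.dvd_or_dvd h1 with h2 | h2
  · exact main b (Or.inl rfl) h2
  · exact main (-b) (Or.inr rfl) h2

theorem exists_eq_sq_of_sq_add_sq {c d n : ℤ} (h : c ^ 2 + d ^ 2 = n ^ 2) (hcd : IsCoprime c d)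
    (hc : c % 2 = 1) : ∃ u v : ℤ, c = u ^ 2 - v ^ 2 ∧ d = 2 * u * v ∧
      (u % 2 = 0 ∧ v % 2 = 1 ∨ u % 2 = 1 ∧ v % 2 = 0) := by
  have hn0 : n ≠ 0 := by
    rintro rfl
    have : c = 0 := by nlinarith [sq_nonneg c, sq_nonneg d]
    omega
  have ht : PythagoreanTriple c d |n| := by
    unfold PythagoreanTriple; rw [abs_mul_abs_self]; linarith
  obtain ⟨u, v, h1, h2, -, -, h3, -⟩ := ht.coprime_classification'
    (Int.isCoprime_iff_gcd_eq_one.1 hcd) hc (abs_pos.2 hn0)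
  exact ⟨u, v, h1, h2, h3⟩

/-- `D` is `re - im` of `(a + bi)(u + vi)²`. The square is `±1` or `±(5 + 4i)` modulo `8`, and since
`a - b` and `a + b` are odd the two fours cancel. Thus `re - im` modulo `8`, up to sign, survives
multiplication by squares and can separate `π` from its conjugate. -/
theorem sub_mod_eight_of_mul_sq {a b u v : ℤ} (ha : a % 2 = 1) (hb : b % 2 = 0)
    (huv : u % 2 = 0 ∧ v % 2 = 1 ∨ u % 2 = 1 ∧ v % 2 = 0) {D : ℤ}
    (hD : D = (a * (u ^ 2 - v ^ 2) - b * (2 * u * v)) - (a * (2 * u * v) + b * (u ^ 2 - v ^ 2))) :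
    D % 8 = (a - b) % 8 ∨ D % 8 = (b - a) % 8 := by
  have key : ∀ {x y : ℤ}, x % 2 = 1 → y % 2 = 0 →
      ((x ^ 2 - y ^ 2) % 8 = 1 ∧ (2 * x * y) % 8 = 0) ∨
      ((x ^ 2 - y ^ 2) % 8 = 5 ∧ (2 * x * y) % 8 = 4) := by
    intro x y hx hy
    have h1 : x ^ 2 % 8 = 1 := by
      rcases Int.sq_mod_eight_cases x with ⟨x1, x2⟩ | ⟨x1, x2⟩ | ⟨x1, x2⟩ <;> omega
    obtain ⟨z, rfl⟩ : (2 : ℤ) ∣ y := by omega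
    rw [show 2 * x * (2 * z) = 4 * (x * z) by ring, show (2 * z) ^ 2 = 4 * z ^ 2 by ring]
    have h2 := Int.mul_emod x z 2
    rw [hx] at h2
    rcases Int.sq_mod_eight_cases z with ⟨x1, x2⟩ | ⟨x1, x2⟩ | ⟨x1, x2⟩
    · rw [x1] at h2; omega
    · rw [show z % 2 = 0 by omega] at h2; omega
    · rw [show z % 2 = 0 by omega] at h2; omega
  have hD' : D = (u ^ 2 - v ^ 2) * (a - b) - (2 * u * v) * (a + b) := by rw [hD]; ring
  rcases huv with ⟨hu, hv⟩ | ⟨hu, hv⟩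
  · right
    rcases key hv hu with ⟨h1, h2⟩ | ⟨h1, h2⟩
    · have e1 := Int.mul_mod_eight (y := a - b) (show (u ^ 2 - v ^ 2) % 8 = 7 by omega)
      have e2 := Int.mul_mod_eight (y := a + b) (show (2 * u * v) % 8 = 0 by
        rw [← h2]; congr 1; ring)
      omega
    · have e1 := Int.mul_mod_eight (y := a - b) (show (u ^ 2 - v ^ 2) % 8 = 3 by omega)
      have e2 := Int.mul_mod_eight (y := a + b) (show (2 * u * v) % 8 = 4 by
        rw [← h2]; congr 1; ring)
      omega
  · left
    rcases key hu hv with ⟨h1, h2⟩ | ⟨h1, h2⟩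
    · have e1 := Int.mul_mod_eight (y := a - b) h1
      have e2 := Int.mul_mod_eight (y := a + b) h2
      omega
    · have e1 := Int.mul_mod_eight (y := a - b) h1
      have e2 := Int.mul_mod_eight (y := a + b) h2
      omega

section

variable {p l : ℕ} [Fact p.Prime] [Fact l.Prime]

/-- If `A + B i` has norm `p n²`, it is a prime of norm `p` times a square. -/
theorem exists_quadraticChar_eq {a b A B n : ℤ} (hab : a ^ 2 + b ^ 2 = p) (ha : a % 2 = 1)
    (hb : b % 2 = 0) (h : A ^ 2 + B ^ 2 = p * n ^ 2) (hc : IsCoprime A B) (hA : A % 2 = 1) :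
    ∃ b' : ℤ, (b' = b ∨ b' = -b) ∧
      ((A - B) % 8 = (a - b') % 8 ∨ (A - B) % 8 = (b' - a) % 8) ∧
      ∀ j : ZMod l, j ^ 2 = -1 → (A : ZMod l) + B * j ≠ 0 →
        χ[l] (a + b' * j) = χ[l] (A + B * j) := by
  obtain ⟨b', c, d, hb', hA', hB', hcd⟩ := exists_compose_sq_add_sq hab h
  have hb2 : b' % 2 = 0 := by omega
  have hcop : IsCoprime c d := by
    obtain ⟨α, β, hαβ⟩ := hc
    exact ⟨α * a + β * b', β * a - α * b', by rw [← hαβ, hA', hB']; ring⟩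
  have hco : c % 2 = 1 := by
    have h1 := Int.mul_emod a c 2
    have h2 := Int.mul_emod b' d 2
    rw [hb2] at h2
    rcases (show c % 2 = 1 ∨ c % 2 = 0 by omega) with g | g
    · exact g
    · rw [g] at h1; omega
  obtain ⟨u, v, rfl, rfl, huv⟩ := exists_eq_sq_of_sq_add_sq hcd hcop hco
  refine ⟨b', hb', sub_mod_eight_of_mul_sq ha hb2 huv (by rw [hA', hB']), fun j hj hne => ?_⟩
  have e : (A : ZMod l) + B * j = (a + b' * j) * (u + v * j) ^ 2 := by
    rw [hA', hB']; push_cast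
    linear_combination (-(2 * u * v * b' : ZMod l) - a * v ^ 2 - b' * v ^ 2 * j) * hj
  refine (quadraticChar_eq_of_sq_mul ?_ e).symm
  intro h0
  rw [e, h0] at hne
  simp at hne

theorem exists_sq_eq_neg_one (hl : l % 8 = 5) : ∃ j : ZMod l, j ^ 2 = -1 := by
  obtain ⟨j, hj⟩ := ZMod.exists_sq_eq_neg_one_iff.2 (show l % 4 ≠ 3 by omega)
  exact ⟨j, by rw [hj, sq]⟩

theorem exists_odd_sq_add_sq (hp : p % 8 = 5) :
    ∃ a b : ℤ, a ^ 2 + b ^ 2 = p ∧ a % 2 = 1 ∧ b % 2 = 0 := by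
  obtain ⟨a, b, h⟩ := Nat.Prime.sq_add_sq (p := p) (by omega)
  have h' : (a : ℤ) ^ 2 + (b : ℤ) ^ 2 = p := by exact_mod_cast h
  rcases Int.sq_mod_eight_cases a with ⟨x1, x2⟩ | ⟨x1, x2⟩ | ⟨x1, x2⟩ <;>
  rcases Int.sq_mod_eight_cases b with ⟨y1, y2⟩ | ⟨y1, y2⟩ | ⟨y1, y2⟩
  · omega
  · exact ⟨a, b, h', by omega, by omega⟩
  · exact ⟨a, b, h', by omega, by omega⟩
  · exact ⟨b, a, by linarith, by omega, by omega⟩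
  · omega
  · omega
  · exact ⟨b, a, by linarith, by omega, by omega⟩
  · omega
  · omega

theorem quarticSymbol_trichotomy (a : ℤ) (q : ℕ) :
    quarticSymbol a q = 0 ∨ quarticSymbol a q = 1 ∨ quarticSymbol a q = -1 := by
  unfold quarticSymbol; split_ifs <;> simp

theorem quarticSymbol_eq_of_quadraticChar (hp : p % 8 = 5) (hl : l % 8 = 5) (hpl : p ≠ l)
    (h1 : legendreSym l p = 1) {a b : ℤ} (hab : a ^ 2 + b ^ 2 = p) (ha : a % 2 = 1)
    {j : ZMod l} (hj : j ^ 2 = -1) (h : χ[l] (a + b * j) = 1) :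
    quarticSymbol p l = quarticSymbol l p := by
  have := quarticSymbol_mul_quarticSymbol hp hl hpl h1 hab ha hj
  rw [h] at this
  rcases quarticSymbol_trichotomy p l with e | e | e <;>
  rcases quarticSymbol_trichotomy l p with e' | e' | e' <;> rw [e, e'] at this ⊢ <;> omega

theorem quarticSymbol_eq_of_sq_add_sq (hp : p % 8 = 5) (hl : l % 8 = 5) (hpl : p ≠ l)
    (h1 : legendreSym l p = 1) {A B n : ℤ} (h : A ^ 2 + B ^ 2 = p * n ^ 2) (hc : IsCoprime A B)
    (hA : A % 2 = 1) {j : ZMod l} (hj : j ^ 2 = -1) (hχ : χ[l] (A + B * j) = 1) :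
    quarticSymbol p l = quarticSymbol l p := by
  obtain ⟨a, b, hab, ha, hb⟩ := exists_odd_sq_add_sq hp
  obtain ⟨b', hb', -, hall⟩ := exists_quadraticChar_eq (l := l) hab ha hb h hc hA
  refine quarticSymbol_eq_of_quadraticChar hp hl hpl h1 (a := a) (b := b') ?_ ha hj ?_
  · rcases hb' with rfl | rfl <;> linarith
  · rw [hall j hj, hχ]
    intro h0
    rw [h0, quadraticChar_zero] at hχ
    exact zero_ne_one hχ

/-! ### The torsor `𝒯^(φ)(p)` -/

theorem even_of_mul_sq_even {c n k : ℤ} (hc : c % 2 = 1) (h : c * n ^ 2 = 2 * k) : 2 ∣ n := by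
  have : Even (c * n ^ 2) := by rw [h]; exact even_two_mul k
  rw [Int.even_mul, Int.even_pow' two_ne_zero] at this
  rcases this with g | g
  · rw [Int.even_iff] at g; omega
  · exact g.two_dvd

theorem dvd_of_mul_sq_dvd (hpl : p ≠ l) {n k : ℤ} (h : p * n ^ 2 = l * k) : (l : ℤ) ∣ n := by
  have hl := Nat.prime_iff_prime_int.1 (Fact.out : l.Prime)
  rcases hl.dvd_or_dvd (Dvd.intro _ h.symm) with g | g
  · exact absurd g (Nat.Prime.int_not_dvd hpl)
  · exact hl.dvd_of_dvd_pow g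

theorem int_odd_coprime_two {m : ℤ} (h : m % 2 = 1) : IsCoprime m 2 := ⟨1, -(m / 2), by omega⟩

/-- If `l ∣ M`, dividing the equation by `l²` exchanges the roles of `M` and `e`; if the term
without the factor `4` is even, dividing by `4` moves that factor to the other term. -/
theorem exists_normal_point (hp : p % 2 = 1) (hpl : p ≠ l) {M e n : ℤ}
    (hc : IsCoprime M e) (h : p * n ^ 2 = M ^ 4 + 4 * l ^ 2 * e ^ 4) :
    ∃ A B n : ℤ, IsCoprime A B ∧ ¬ (l : ℤ) ∣ A ∧
      ((A % 2 = 1 ∧ p * n ^ 2 = A ^ 4 + 4 * l ^ 2 * B ^ 4) ∨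
        (B % 2 = 1 ∧ p * n ^ 2 = 4 * A ^ 4 + l ^ 2 * B ^ 4)) := by
  have hl' := Nat.prime_iff_prime_int.1 (Fact.out : l.Prime)
  by_cases hd : (l : ℤ) ∣ M
  · have he : ¬ (l : ℤ) ∣ e := fun he => hl'.not_isUnit (hc.isUnit_of_dvd' hd he)
    obtain ⟨M, rfl⟩ := hd
    obtain ⟨n, rfl⟩ := dvd_of_mul_sq_dvd hpl (n := n) (k := l ^ 3 * M ^ 4 + 4 * l * e ^ 4)
      (by rw [h]; ring)
    have h' : p * n ^ 2 = l ^ 2 * M ^ 4 + 4 * e ^ 4 :=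
      mul_left_cancel₀ (pow_ne_zero 2 hl'.ne_zero) (by linear_combination h)
    have hc' := hc.of_mul_left_right
    rcases (show M % 2 = 1 ∨ M % 2 = 0 by omega) with g | g
    · exact ⟨e, M, n, hc'.symm, he, Or.inr ⟨g, by rw [h']; ring⟩⟩
    · have heo : e % 2 = 1 := by have := hc'.odd_or_odd; omega
      obtain ⟨m, rfl⟩ : (2 : ℤ) ∣ M := by omega
      obtain ⟨n, rfl⟩ := even_of_mul_sq_even (c := p) (n := n) (k := 8 * l ^ 2 * m ^ 4 + 2 * e ^ 4)
        (by omega) (by rw [h']; ring)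
      exact ⟨e, m, n, hc'.of_mul_left_right.symm, he, Or.inl ⟨heo, by linarith⟩⟩
  · rcases (show M % 2 = 1 ∨ M % 2 = 0 by omega) with g | g
    · exact ⟨M, e, n, hc, hd, Or.inl ⟨g, h⟩⟩
    · have heo : e % 2 = 1 := by have := hc.odd_or_odd; omega
      obtain ⟨m, rfl⟩ : (2 : ℤ) ∣ M := by omega
      obtain ⟨n, rfl⟩ := even_of_mul_sq_even (c := p) (n := n) (k := 8 * m ^ 4 + 2 * l ^ 2 * e ^ 4)
        (by omega) (by rw [h]; ring)
      exact ⟨m, e, n, hc.of_mul_left_right, fun g' => hd (g'.mul_left _), Or.inr ⟨heo, by linarith⟩⟩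

/-- The element `A² + 2lB²i`, respectively `lB² + 2A²i`, has norm `pn²`. Modulo `l` it becomes `A²`,
respectively `2A²j = ((1 + j)A)²`, a square in either case. -/
theorem quarticSymbol_eq_of_phi_point (hp : p % 8 = 5) (hl : l % 8 = 5) (hpl : p ≠ l)
    (h1 : legendreSym l p = 1) {M e n : ℤ}
    (hc : IsCoprime M e) (h : p * n ^ 2 = M ^ 4 + 4 * l ^ 2 * e ^ 4) :
    quarticSymbol p l = quarticSymbol l p := by
  obtain ⟨A, B, n, hcop, hlA, h | h⟩ := exists_normal_point (by omega) hpl hc h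
  all_goals
    obtain ⟨j, hj⟩ := exists_sq_eq_neg_one hl
    have hA0 := intCast_ne_zero_iff.2 hlA
    have hlc : IsCoprime A l := (Nat.Prime.int_coprime_iff.2 hlA).symm
  · refine quarticSymbol_eq_of_sq_add_sq hp hl hpl h1 (A := A ^ 2) (B := 2 * (l * B ^ 2)) (n := n)
      (by rw [h.2]; ring) ?_ ?_ hj ?_
    · exact ((int_odd_coprime_two h.1).mul_right (hlc.mul_right hcop.pow_right)).pow_left
    · rcases Int.sq_mod_eight_cases A with ⟨x1, x2⟩ | ⟨x1, x2⟩ | ⟨x1, x2⟩ <;> omega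
    · push_cast
      rw [ZMod.natCast_self, zero_mul, mul_zero, zero_mul, add_zero, quadraticChar_sq_one' hA0]
  · refine quarticSymbol_eq_of_sq_add_sq hp hl hpl h1 (A := l * B ^ 2) (B := 2 * A ^ 2) (n := n)
      (by rw [h.2]; ring) ?_ ?_ hj ?_
    · refine IsCoprime.mul_left (IsCoprime.mul_right ?_ hlc.symm.pow_right)
        (IsCoprime.mul_right ?_ hcop.symm.pow_right).pow_left
      · exact int_odd_coprime_two (by omega)
      · exact int_odd_coprime_two h.1
    · have := Int.mul_mod_eight (p := l) (y := B ^ 2) (r := 5) (by omega)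
      rcases Int.sq_mod_eight_cases B with ⟨x1, x2⟩ | ⟨x1, x2⟩ | ⟨x1, x2⟩ <;> omega
    · push_cast
      have h2 : (2 : ZMod l) ≠ 0 := two_ne_zero_of_mod (by omega)
      have hj0 : j ≠ 0 := by rintro rfl; simp at hj
      have e1 : (l : ZMod l) * B ^ 2 + 2 * A ^ 2 * j = ((1 + j) * A) ^ 2 := by
        rw [ZMod.natCast_self]; linear_combination (-A ^ 2 : ZMod l) * hj
      rw [e1, quadraticChar_sq_one']
      refine mul_ne_zero (fun h0 => mul_ne_zero h2 hj0 ?_) hA0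
      linear_combination (1 + j) * h0 - hj

end

/-! ### The torsor `𝒯^(φ)(p l)` -/

theorem exists_factor_of_mul_eq {q : ℕ} [Fact q.Prime] {F G K : ℤ} (h : F * G = q * K) :
    (∃ F', F = q * F' ∧ F' * G = K) ∨ (∃ G', G = q * G' ∧ F * G' = K) := by
  have hq := Nat.prime_iff_prime_int.1 (Fact.out : q.Prime)
  rcases hq.dvd_or_dvd (Dvd.intro _ h.symm) with ⟨F', rfl⟩ | ⟨G', rfl⟩
  · exact Or.inl ⟨F', rfl, mul_left_cancel₀ hq.ne_zero (by linear_combination h)⟩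
  · exact Or.inr ⟨G', rfl, mul_left_cancel₀ hq.ne_zero (by linear_combination h)⟩

theorem exists_sq_of_mul_eq_sq {F G m : ℤ} (hF : 0 < F) (hG : 0 < G) (hc : IsCoprime F G)
    (h : F * G = m ^ 2) : (∃ r, F = r ^ 2) ∧ ∃ s, G = s ^ 2 := by
  constructor
  · obtain ⟨r, hr | hr⟩ := Int.sq_of_isCoprime hc h
    · exact ⟨r, hr⟩
    · nlinarith [sq_nonneg r]
  · obtain ⟨r, hr | hr⟩ := Int.sq_of_isCoprime hc.symm (mul_comm F G ▸ h)
    · exact ⟨r, hr⟩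
    · nlinarith [sq_nonneg r]

section

variable {p l : ℕ} [Fact p.Prime] [Fact l.Prime]

theorem exists_split_of_mul_eq {F G m : ℤ} (hF : 0 < F) (hG : 0 < G) (hc : IsCoprime F G)
    (h : F * G = p * (l * m ^ 2)) : ∃ r s : ℤ,
    (F = p * r ^ 2 ∧ G = l * s ^ 2) ∨ (G = p * r ^ 2 ∧ F = l * s ^ 2) ∨
    (F = p * l * r ^ 2 ∧ G = s ^ 2) ∨ (G = p * l * r ^ 2 ∧ F = s ^ 2) := by
  have hp0 : (0 : ℤ) < p := by exact_mod_cast (Fact.out : p.Prime).pos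
  have hl0 : (0 : ℤ) < l := by exact_mod_cast (Fact.out : l.Prime).pos
  rcases exists_factor_of_mul_eq h with ⟨F, rfl, h'⟩ | ⟨G, rfl, h'⟩ <;>
  rcases exists_factor_of_mul_eq h' with ⟨F, rfl, h''⟩ | ⟨G, rfl, h''⟩
  · obtain ⟨⟨r, rfl⟩, s, rfl⟩ := exists_sq_of_mul_eq_sq (pos_of_mul_pos_right (pos_of_mul_pos_right hF hp0.le) hl0.le) hG
      hc.of_mul_left_right.of_mul_left_right h''
    exact ⟨r, s, by right; right; left; exact ⟨by ring, rfl⟩⟩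
  · obtain ⟨⟨r, rfl⟩, s, rfl⟩ := exists_sq_of_mul_eq_sq (pos_of_mul_pos_right hF hp0.le)
      (pos_of_mul_pos_right hG hl0.le) hc.of_mul_left_right.of_mul_right_right h''
    exact ⟨r, s, Or.inl ⟨rfl, rfl⟩⟩
  · obtain ⟨⟨r, rfl⟩, s, rfl⟩ := exists_sq_of_mul_eq_sq (pos_of_mul_pos_right hF hl0.le)
      (pos_of_mul_pos_right hG hp0.le) hc.of_mul_left_right.of_mul_right_right h''
    exact ⟨s, r, Or.inr (Or.inl ⟨rfl, rfl⟩)⟩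
  · obtain ⟨⟨r, rfl⟩, s, rfl⟩ := exists_sq_of_mul_eq_sq hF (pos_of_mul_pos_right (pos_of_mul_pos_right hG hp0.le) hl0.le)
      hc.of_mul_right_right.of_mul_right_right h''
    exact ⟨s, r, by right; right; right; exact ⟨by ring, rfl⟩⟩

/-- Sophie Germain's identity factors `M⁴ + 4e⁴`. After arranging that `M` is odd, congruences
modulo `8` force `e` even and the factors are coprime. Changing the sign of `e` swaps them, leaving
two distributions of `p` and `l`. -/
theorem exists_phi_mul_split (hp : p % 8 = 5) (hl : l % 8 = 5) {M e n : ℤ} (hc : IsCoprime M e)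
    (h : p * (l * n ^ 2) = M ^ 4 + 4 * e ^ 4) :
    ∃ M e r s : ℤ, IsCoprime M e ∧ M % 2 = 1 ∧
      (((M + e) ^ 2 + e ^ 2 = p * r ^ 2 ∧ (M - e) ^ 2 + e ^ 2 = l * s ^ 2 ∧ e % 4 = 2) ∨
        ((M + e) ^ 2 + e ^ 2 = p * l * r ^ 2 ∧ (M - e) ^ 2 + e ^ 2 = s ^ 2 ∧ e % 4 = 0)) := by
  have hpl1 : ((p : ℤ) * l) % 8 = 1 := by
    have := Int.mul_mod_eight (p := p) (y := l) (r := 5) (by omega); omega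
  wlog hM : M % 2 = 1 generalizing M e n
  · have heo : e % 2 = 1 := by have := hc.odd_or_odd; omega
    obtain ⟨m, rfl⟩ : (2 : ℤ) ∣ M := by omega
    obtain ⟨n, rfl⟩ := even_of_mul_sq_even (c := p * l) (n := n) (k := 8 * m ^ 4 + 2 * e ^ 4)
      (by omega) (by linear_combination h)
    exact this hc.of_mul_left_right.symm (n := n) (by linarith) heo
  have hsq : ∀ {x r : ℤ}, x % 2 = 1 → x ^ 2 % 8 = 1 := by
    intro x _ hx
    rcases Int.sq_mod_eight_cases x with ⟨x1, x2⟩ | ⟨x1, x2⟩ | ⟨x1, x2⟩ <;> omega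
  have he : e % 2 = 0 := by
    have h1 := Int.mul_mod_eight (y := n ^ 2) hpl1
    have h2 : (M ^ 4) % 8 = 1 := by
      rw [show M ^ 4 = (M ^ 2) ^ 2 by ring]
      have := hsq (r := 0) hM
      exact hsq (r := 0) (by omega)
    have h3 : p * l * n ^ 2 = M ^ 4 + 4 * e ^ 4 := by rw [← h]; ring
    rcases (show e % 2 = 0 ∨ e % 2 = 1 by omega) with g | g
    · exact g
    · have h4 : (e ^ 4) % 8 = 1 := by
        rw [show e ^ 4 = (e ^ 2) ^ 2 by ring]
        have := hsq (r := 0) g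
        exact hsq (r := 0) (by omega)
      rcases Int.sq_mod_eight_cases n with ⟨x1, x2⟩ | ⟨x1, x2⟩ | ⟨x1, x2⟩ <;> omega
  have hodd : ∀ {x : ℤ}, x % 2 = 1 → (x ^ 2 + e ^ 2) % 2 = 1 ∧ 0 < x ^ 2 + e ^ 2 := by
    intro x hx
    have h1 := hsq (r := 0) hx
    refine ⟨?_, ?_⟩
    · rcases Int.sq_mod_eight_cases e with ⟨x1, x2⟩ | ⟨x1, x2⟩ | ⟨x1, x2⟩ <;> omega
    · have : x ≠ 0 := by omega
      positivity
  have hF := hodd (x := M + e) (by omega)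
  have hG := hodd (x := M - e) (by omega)
  have hFG : IsCoprime ((M + e) ^ 2 + e ^ 2) ((M - e) ^ 2 + e ^ 2) := by
    refine isCoprime_of_prime_dvd (by omega) fun q hq h1 h2 => ?_
    have hq2 : ¬ q ∣ 2 := fun g => hq.not_isUnit ((int_odd_coprime_two hF.1).isUnit_of_dvd' h1 g)
    have h3 : q ∣ 2 * 2 * (M * e) := by
      have := dvd_sub h1 h2
      rwa [show (M + e) ^ 2 + e ^ 2 - ((M - e) ^ 2 + e ^ 2) = 2 * 2 * (M * e) by ring] at this
    have h4 : q ∣ 2 * (M * M + 2 * (e * e)) := by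
      have := dvd_add h1 h2
      rwa [show (M + e) ^ 2 + e ^ 2 + ((M - e) ^ 2 + e ^ 2) = 2 * (M * M + 2 * (e * e)) by ring]
        at this
    have h4' := (hq.dvd_or_dvd h4).resolve_left hq2
    have h3' := (hq.dvd_or_dvd h3).resolve_left fun g => by
      rcases hq.dvd_or_dvd g with g | g <;> exact hq2 g
    rcases hq.dvd_or_dvd h3' with g | g
    · have h5 := (dvd_add_right (g.mul_right M)).1 h4'
      have h6 := (hq.dvd_or_dvd h5).resolve_left hq2
      exact hq.not_isUnit (hc.isUnit_of_dvd' g (by rcases hq.dvd_or_dvd h6 with g | g <;> exact g))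
    · have h5 := (dvd_add_left ((g.mul_right e).mul_left 2)).1 h4'
      exact hq.not_isUnit (hc.isUnit_of_dvd' (by rcases hq.dvd_or_dvd h5 with g | g <;> exact g) g)
  obtain ⟨r, s, hrs⟩ := exists_split_of_mul_eq (p := p) (l := l) (m := n) hF.2 hG.2 hFG
    (by rw [h]; ring)
  have e1 : ∀ {x r : ℤ}, x % 2 = 1 → x ^ 2 + e ^ 2 = p * r ^ 2 → e % 4 = 2 := by
    intro x r hx g
    have h1 := hsq (r := 0) hx
    have h2 := Int.mul_mod_eight (p := p) (y := r ^ 2) (r := 5) (by omega)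
    rcases Int.sq_mod_eight_cases e with ⟨x1, x2⟩ | ⟨x1, x2⟩ | ⟨x1, x2⟩ <;>
    rcases Int.sq_mod_eight_cases r with ⟨y1, y2⟩ | ⟨y1, y2⟩ | ⟨y1, y2⟩ <;> omega
  have e2 : ∀ {x r : ℤ}, x % 2 = 1 → x ^ 2 + e ^ 2 = r ^ 2 → e % 4 = 0 := by
    intro x r hx g
    have h1 := hsq (r := 0) hx
    rcases Int.sq_mod_eight_cases e with ⟨x1, x2⟩ | ⟨x1, x2⟩ | ⟨x1, x2⟩ <;>
    rcases Int.sq_mod_eight_cases r with ⟨y1, y2⟩ | ⟨y1, y2⟩ | ⟨y1, y2⟩ <;> omega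
  rcases hrs with ⟨h1, h2⟩ | ⟨h1, h2⟩ | ⟨h1, h2⟩ | ⟨h1, h2⟩
  · exact ⟨M, e, r, s, hc, hM, Or.inl ⟨h1, h2, e1 (x := M + e) (by omega) h1⟩⟩
  · have := e1 (x := M - e) (by omega) h1
    exact ⟨M, -e, r, s, hc.neg_right, hM, Or.inl ⟨by linear_combination h1, by linear_combination h2, by omega⟩⟩
  · exact ⟨M, e, r, s, hc, hM, Or.inr ⟨h1, h2, e2 (x := M - e) (by omega) h2⟩⟩
  · have := e2 (x := M + e) (by omega) h2
    exact ⟨M, -e, r, s, hc.neg_right, hM, Or.inr ⟨by linear_combination h1, by linear_combination h2, by omega⟩⟩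

theorem exists_root_of_sq_add_sq {M e k : ℤ} (hc : IsCoprime M e)
    (h : M ^ 2 + e ^ 2 = l * k) :
    (e : ZMod l) ≠ 0 ∧ ∃ j : ZMod l, j ^ 2 = -1 ∧ (M : ZMod l) = j * e := by
  have hl := Nat.prime_iff_prime_int.1 (Fact.out : l.Prime)
  have he : (e : ZMod l) ≠ 0 := by
    rw [intCast_ne_zero_iff]
    intro g
    refine hl.not_isUnit (hc.isUnit_of_dvd' (hl.dvd_of_dvd_pow (n := 2) ?_) g)
    rw [show M ^ 2 = l * k - e ^ 2 by linarith]
    exact dvd_sub (Dvd.intro _ rfl) (dvd_pow g two_ne_zero)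
  have h' := congrArg (Int.cast : ℤ → ZMod l) h
  push_cast at h'
  rw [ZMod.natCast_self, zero_mul] at h'
  refine ⟨he, M / e, ?_, by field_simp⟩
  field_simp
  linear_combination h'

theorem one_add_ne_zero_of_sq {j : ZMod l} (hl : l % 2 = 1) (hj : j ^ 2 = -1) : 1 + j ≠ 0 := by
  intro h
  exact two_ne_zero_of_mod hl (by linear_combination (1 - j) * h + hj)

theorem quadraticChar_one_add_mul (hl : l % 8 = 5) {j : ZMod l} (hj : j ^ 2 = -1) :
    χ[l] (1 + j) * χ[l] (1 - j) = -1 := by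
  rw [← map_mul, show (1 + j) * (1 - j) = 2 by linear_combination -hj,
    quadraticChar_two_mod_eight' (Or.inr hl)]

/-- The situation `(M + e)² + e² = p r²`, `(M - e)² + e² = l s²`. -/
theorem quadraticChar_two_mul_of_split (hl : l % 8 = 5) {M e s : ℤ} (hc : IsCoprime M e)
    (h : (M - e) ^ 2 + e ^ 2 = l * s ^ 2) (he : e % 4 = 2) : χ[l] (2 * e : ZMod l) = 1 := by
  obtain ⟨f, rfl⟩ : (2 : ℤ) ∣ e := by omega
  have hf := jacobiSym_eq_one_of_dvd (N := l) (m := f) (y := s) (x := M - 2 * f) (by omega)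
    (Int.odd_iff.2 (by omega)) ⟨4 * f, by linear_combination -h⟩ (by
      have := hc.of_mul_right_right.symm
      have h2 := this.add_mul_left_right (-2)
      rwa [show M + f * -2 = M - 2 * f by ring] at h2)
  rw [← quadraticChar_intCast] at hf
  rw [← hf]
  exact quadraticChar_eq_of_sq_mul (two_ne_zero_of_mod (by omega)) (by push_cast; ring)

/-- The situation `(M - e)² + e² = s²`, with `M + e ≡ j e` modulo a prime. -/
theorem quadraticChar_of_split (hl : l % 8 = 5) {M e s : ℤ} (hc : IsCoprime M e) (hM : M % 2 = 1)
    (h : (M - e) ^ 2 + e ^ 2 = s ^ 2) (he : e % 4 = 0) (he0 : (e : ZMod l) ≠ 0) {j : ZMod l}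
    (hj : j ^ 2 = -1) (hMe : (M : ZMod l) + e = j * e) :
    χ[l] (e : ZMod l) = -1 ∧ χ[l] (1 + j) = -1 := by
  have h2 : (2 : ZMod l) ≠ 0 := two_ne_zero_of_mod (by omega)
  have hcc : IsCoprime (M - e) e := by
    have h2 := hc.add_mul_left_left (-1)
    rwa [show M + e * -1 = M - e by ring] at h2
  obtain ⟨u, v, h1, h3, -⟩ := exists_eq_sq_of_sq_add_sq h hcc (by omega)
  have h1' := congrArg (Int.cast : ℤ → ZMod l) h1
  have h3' := congrArg (Int.cast : ℤ → ZMod l) h3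
  push_cast at h1' h3'
  have hneg := quadraticChar_neg_mod_four (q := l) (by omega)
  have hs := quadraticChar_sqrt_neg_one hl hj
  -- Since `(M - e) + ei = (u + vi)²`, substituting `∓j` for `i` and `M + e = je` gives two explicit
  -- squares; they determine the characters of `e` and `1 + j`.
  have e1 : (u - v * j : ZMod l) ^ 2 = -(2 * e) := by
    linear_combination (v ^ 2 : ZMod l) * hj - h1' + hMe + j * h3'
  have e2 : (u + v * j : ZMod l) ^ 2 = 2 * e * (j * (1 + j)) := by
    linear_combination (v ^ 2 - 2 * e : ZMod l) * hj - h1' + hMe - j * h3'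
  have hj0 : j ≠ 0 := by rintro rfl; simp at hj
  have h1j := one_add_ne_zero_of_sq (by omega) hj
  have key : ∀ {x y : ZMod l}, x ^ 2 = y → y ≠ 0 → χ[l] y = 1 := by
    intro x y hx hy
    rw [← hx]; apply quadraticChar_sq_one'
    rintro rfl; exact hy (by rw [← hx]; ring)
  have f1 := key e1 (neg_ne_zero.2 (mul_ne_zero h2 he0))
  have f2 := key e2 (mul_ne_zero (mul_ne_zero h2 he0) (mul_ne_zero hj0 h1j))
  rw [hneg] at f1
  rw [map_mul, f1, map_mul, hs] at f2
  rw [map_mul, quadraticChar_two_mod_eight' (Or.inr hl)] at f1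
  constructor <;> linarith

/-- The situation `(M + e)² + e² = p l r²`, `(M - e)² + e² = s²`. -/
theorem exists_compose_of_split (hp : p % 8 = 5) (hl : l % 8 = 5) (hpl : p ≠ l) {M e r s a b : ℤ}
    (hc : IsCoprime M e) (hM : M % 2 = 1) (h1 : (M + e) ^ 2 + e ^ 2 = p * l * r ^ 2)
    (h2 : (M - e) ^ 2 + e ^ 2 = s ^ 2) (he : e % 4 = 0) (hab : a ^ 2 + b ^ 2 = p) (hb : b % 2 = 0) :
    ∃ b' : ℤ, (b' = b ∨ b' = -b) ∧
      (∃ j : ZMod l, j ^ 2 = -1 ∧ χ[l] (a + b' * j) = 1 ∧ χ[l] (1 + j) = -1) ∧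
      (∀ j : ZMod p, j ^ 2 = -1 → (a : ZMod p) - b' * j = 0 → χ[p] (1 + j) = -1) := by
  obtain ⟨b', c, d, hb', hA, hB, hcd⟩ := exists_compose_sq_add_sq hab
    (h1.trans (mul_assoc (p : ℤ) l (r ^ 2)))
  have hab' : a ^ 2 + b' ^ 2 = p := by rcases hb' with rfl | rfl <;> linarith
  have hb2 : b' % 2 = 0 := by omega
  have hMc : IsCoprime (M + e) e := by
    have h2 := hc.add_mul_left_left 1
    rwa [mul_one] at h2
  have hcop : IsCoprime c d := by
    obtain ⟨α, β, hαβ⟩ := hMc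
    exact ⟨α * a + β * b', β * a - α * b', by
      linear_combination hαβ - α * hA - β * hB⟩
  have hco : c % 2 = 1 := by
    have h1 := Int.mul_emod a c 2
    have h2 := Int.mul_emod b' d 2
    rw [hb2] at h2
    rcases (show c % 2 = 1 ∨ c % 2 = 0 by omega) with g | g
    · exact g
    · rw [g] at h1; omega
  refine ⟨b', hb', ?_, ?_⟩
  · obtain ⟨he0, j, hj, hje⟩ := exists_root_of_sq_add_sq (l := l) (k := p * r ^ 2) hMc
      (by rw [h1]; ring)
    have hje' : (M : ZMod l) + e = j * e := by rw [← hje]; push_cast; ring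
    obtain ⟨f1, f2⟩ := quadraticChar_of_split hl hc hM h2 he he0 hj hje'
    refine ⟨j, hj, ?_, f2⟩
    have hA' := congrArg (Int.cast : ℤ → ZMod l) hA
    have hB' := congrArg (Int.cast : ℤ → ZMod l) hB
    have hab'' := congrArg (Int.cast : ℤ → ZMod l) hab'
    push_cast at hA' hB' hab''
    have hp0 : (p : ZMod l) ≠ 0 := by
      have := intCast_ne_zero_iff.2 (Nat.Prime.int_not_dvd hpl)
      exact_mod_cast this
    have hne : (a : ZMod l) - b' * j ≠ 0 := by
      intro h0; apply hp0; rw [← hab'']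
      linear_combination (a + b' * j) * h0 + (b' : ZMod l) ^ 2 * hj
    have hcdj : (c : ZMod l) - d * j = 0 := by
      have : ((a : ZMod l) - b' * j) * (c - d * j) = 0 := by
        linear_combination -hA' + j * hB' + hje' + b' * d * hj
      exact (mul_eq_zero.1 this).resolve_left hne
    -- Here `(a + b'j)(c + dj) = (M + e) + ej = 2je` and `c = dj`, so `c + dj = 2c`.
    have hprod : ((a : ZMod l) + b' * j) * c = j * e := by
      have h2 : (2 : ZMod l) ≠ 0 := two_ne_zero_of_mod (by omega)
      apply mul_left_cancel₀ h2
      linear_combination (a + b' * j : ZMod l) * hcdj - hA' - j * hB' + hje' + b' * d * hj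
    have hχc := jacobiSym_eq_one_of_dvd (N := l) (m := c) (y := r) (x := d) (by omega)
      (Int.odd_iff.2 hco) ⟨c, by linear_combination -hcd⟩ hcop
    rw [← quadraticChar_intCast] at hχc
    have := congrArg (χ[l]) hprod
    rw [map_mul, map_mul, hχc, f1, quadraticChar_sqrt_neg_one hl hj] at this
    linarith
  · intro j hj h0
    obtain ⟨he0, -⟩ := exists_root_of_sq_add_sq (l := p) (k := l * r ^ 2) hMc
      (by rw [h1]; ring)
    have hA' := congrArg (Int.cast : ℤ → ZMod p) hA
    have hB' := congrArg (Int.cast : ℤ → ZMod p) hB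
    push_cast at hA' hB'
    refine (quadraticChar_of_split hp hc hM h2 he he0 hj ?_).2
    linear_combination hA' - j * hB' + (c - d * j) * h0 - b' * d * hj

theorem quarticSymbol_eq_of_phi_mul_point (hp : p % 8 = 5) (hl : l % 8 = 5) (hpl : p ≠ l)
    (hs : legendreSym l p = 1) {M e n : ℤ} (hc : IsCoprime M e)
    (h : p * (l * n ^ 2) = M ^ 4 + 4 * e ^ 4) : quarticSymbol p l = quarticSymbol l p := by
  obtain ⟨M, e, r, s, hc, hM, ⟨h1, h2, he⟩ | ⟨h1, h2, he⟩⟩ := exists_phi_mul_split hp hl hc h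
  · obtain ⟨he0, j, hj, hje⟩ := exists_root_of_sq_add_sq (l := l) (k := s ^ 2) (by
      have h2 := hc.add_mul_left_left (-1)
      rwa [show M + e * -1 = M - e by ring] at h2) h2
    -- The root `-j` is the useful one: with `M - e = je`, the element `(M + e) - ej` reduces to
    -- `2e`.
    refine quarticSymbol_eq_of_sq_add_sq hp hl hpl hs h1 (by
      have h2 := hc.add_mul_left_left 1
      rwa [mul_one] at h2) (by omega) (j := -j) (by rw [neg_sq, hj]) ?_
    rw [← quadraticChar_two_mul_of_split hl hc h2 he]
    congr 1
    push_cast at hje ⊢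
    linear_combination hje
  · obtain ⟨a, b, hab, ha, hb⟩ := exists_odd_sq_add_sq hp
    obtain ⟨b', hb', ⟨j, hj, hχ, -⟩, -⟩ := exists_compose_of_split hp hl hpl hc hM h1 h2 he hab hb
    refine quarticSymbol_eq_of_quadraticChar hp hl hpl hs (a := a) (b := b') ?_ ha hj hχ
    rcases hb' with rfl | rfl <;> linarith

end

/-! ### Normalized representations as sums of two squares -/

section

variable {p l : ℕ} [Fact p.Prime] [Fact l.Prime]

theorem isCoprime_of_sq_add_sq_eq_prime {c d : ℤ} (h : c ^ 2 + d ^ 2 = l) : IsCoprime c d := by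
  have hl := Nat.prime_iff_prime_int.1 (Fact.out : l.Prime)
  refine isCoprime_of_prime_dvd ?_ fun q hq h1 h2 => ?_
  · rintro ⟨rfl, rfl⟩
    exact hl.ne_zero (by rw [← h]; ring)
  · obtain ⟨c', rfl⟩ := h1
    obtain ⟨d', rfl⟩ := h2
    have : (l : ℤ) = q * (q * (c' ^ 2 + d' ^ 2)) := by rw [← h]; ring
    rcases hl.irreducible.isUnit_or_isUnit this with hu | hu
    · exact hq.not_isUnit hu
    · exact hq.not_isUnit (isUnit_of_mul_isUnit_left hu)

theorem exists_normalized (hl : l % 8 = 5) :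
    ∃ c d : ℤ, c ^ 2 + d ^ 2 = l ∧ (c - d) % 8 = 1 ∧ d % 4 = 2 := by
  obtain ⟨c, d, h, hc, hd⟩ := exists_odd_sq_add_sq hl
  have hd4 : d % 4 = 2 := by
    rcases Int.sq_mod_eight_cases c with ⟨x1, x2⟩ | ⟨x1, x2⟩ | ⟨x1, x2⟩ <;>
    rcases Int.sq_mod_eight_cases d with ⟨y1, y2⟩ | ⟨y1, y2⟩ | ⟨y1, y2⟩ <;> omega
  rcases (show (c - d) % 8 = 1 ∨ (c - d) % 8 = 3 ∨ (c - d) % 8 = 5 ∨ (c - d) % 8 = 7 by omega)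
    with g | g | g | g
  · exact ⟨c, d, h, g, hd4⟩
  · exact ⟨-c, d, by linarith, by omega, hd4⟩
  · exact ⟨c, -d, by linarith, by omega, by omega⟩
  · exact ⟨-c, -d, by linarith, by omega, by omega⟩

theorem dvd_im_ne_zero {c d : ℤ} (h : c ^ 2 + d ^ 2 = l) : (d : ZMod l) ≠ 0 :=
  (exists_root_of_sq_add_sq (k := 1) (isCoprime_of_sq_add_sq_eq_prime h) (by rw [h, mul_one])).1

theorem quadraticChar_im (hl : l % 8 = 5) {c d : ℤ} (h : c ^ 2 + d ^ 2 = l) (hd : d % 4 = 2) :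
    χ[l] (d : ZMod l) = -1 := by
  have hc := isCoprime_of_sq_add_sq_eq_prime h
  obtain ⟨f, rfl⟩ : (2 : ℤ) ∣ d := by omega
  have hf := jacobiSym_eq_one_of_dvd (N := l) (m := f) (y := 1) (x := c) (by omega)
    (Int.odd_iff.2 (by omega)) ⟨4 * f, by linear_combination -h⟩ hc.of_mul_right_right.symm
  rw [quadraticChar_intCast, jacobiSym.mul_left, hf, jacobiSym_two_mod_eight' (Or.inr hl), mul_one]

theorem sq_eq_neg_one_of_root {c d : ℤ} (h : c ^ 2 + d ^ 2 = l) {j : ZMod l}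
    (hj : (c : ZMod l) + d * j = 0) : j ^ 2 = -1 := by
  have hd := dvd_im_ne_zero h
  have h' := congrArg (Int.cast : ℤ → ZMod l) h
  push_cast at h'
  rw [ZMod.natCast_self] at h'
  apply mul_left_cancel₀ (pow_ne_zero 2 hd)
  linear_combination h' - (c - d * j) * hj

/-- At this root `(1 + j)d = -(c - d)`. From `2l = (c + d)² + (c - d)²` the number `2l` is a square
modulo `c - d`, and so is `l` in the Jacobi sense because `c - d ≡ 1 (mod 8)`. So `c - d` has
character `1`, while `d`, twice an odd divisor of `l - c²`, has character `-1`. -/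
theorem quadraticChar_one_add_of_normalized (hl : l % 8 = 5) {c d : ℤ} (h : c ^ 2 + d ^ 2 = l)
    (hn : (c - d) % 8 = 1) (hd : d % 4 = 2) {j : ZMod l} (hj : (c : ZMod l) + d * j = 0) :
    χ[l] (1 + j) = -1 := by
  have hc := isCoprime_of_sq_add_sq_eq_prime h
  have h1 : jacobiSym (c - d) l = 1 := by
    have hodd : Odd (c - d) := Int.odd_iff.2 (by omega)
    rw [jacobiSym_recip_mod_four (by omega) hodd]
    have hcop : IsCoprime (c - d) (c + d) := by
      refine isCoprime_of_prime_dvd (by omega) fun q hq g1 g2 => ?_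
      have hq2 : ¬ q ∣ 2 := fun g =>
        hq.not_isUnit ((int_odd_coprime_two (m := c - d) (by omega)).isUnit_of_dvd' g1 g)
      have g3 : q ∣ 2 * c := by have := dvd_add g1 g2; rwa [show c - d + (c + d) = 2 * c by ring] at this
      have g4 : q ∣ 2 * d := by have := dvd_sub g2 g1; rwa [show c + d - (c - d) = 2 * d by ring] at this
      exact hq.not_isUnit (hc.isUnit_of_dvd' ((hq.dvd_or_dvd g3).resolve_left hq2)
        ((hq.dvd_or_dvd g4).resolve_left hq2))
    have h2 := jacobiSym_natAbs_eq_one (m := c - d) (a := 2 * l) (y := 1) (x := c + d)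
      ⟨c - d, by linear_combination -2 * h⟩ hcop
    rwa [jacobiSym.mul_left, jacobiSym_two_mod_eight (by omega), one_mul] at h2
  have h3 := quadraticChar_im hl h hd
  rw [← quadraticChar_intCast] at h1
  have e : (1 + j) * d = -((c - d : ℤ) : ZMod l) := by push_cast; linear_combination hj
  have := congrArg (χ[l]) e
  rw [quadraticChar_neg_mod_four (by omega), h1, map_mul, h3] at this
  linarith

theorem quadraticChar_one_add_of_normalized' (hl : l % 8 = 5) {c d : ℤ} (h : c ^ 2 + d ^ 2 = l)
    (hn : (c - d) % 8 = 1) (hd : d % 4 = 2) {j : ZMod l} (hj : (c : ZMod l) - d * j = 0) :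
    χ[l] (1 + j) = 1 := by
  have h1 := quadraticChar_one_add_of_normalized hl h hn hd (j := -j) (by linear_combination hj)
  have hj2 := sq_eq_neg_one_of_root h (j := -j) (by linear_combination hj)
  have h2 := quadraticChar_one_add_mul hl (j := j) (by linear_combination hj2)
  rw [← sub_eq_add_neg] at h1
  rw [h1] at h2
  linarith

theorem root_cases {c d : ℤ} (h : c ^ 2 + d ^ 2 = l) {j : ZMod l} (hj : j ^ 2 = -1) :
    (c : ZMod l) + d * j = 0 ∨ (c : ZMod l) - d * j = 0 := by
  have h' := congrArg (Int.cast : ℤ → ZMod l) h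
  push_cast at h'
  rw [ZMod.natCast_self] at h'
  rw [← mul_eq_zero]
  linear_combination h' - (d : ZMod l) ^ 2 * hj

theorem quadraticChar_conj {p : ℕ} {a b : ℤ} (h : a ^ 2 + b ^ 2 = p)
    (hs : legendreSym l p = -1) {j : ZMod l} (hj : j ^ 2 = -1) :
    χ[l] (a + b * j) * χ[l] (a - b * j) = -1 := by
  have h' := congrArg (Int.cast : ℤ → ZMod l) h
  rw [← map_mul, ← hs]
  unfold legendreSym
  congr 1
  push_cast at h' ⊢
  linear_combination h' - (b : ZMod l) ^ 2 * hj

/-- Reciprocity for `(1 + i) π` and `λ`, where `π` and `λ` are normalized. -/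
theorem quadraticChar_normalized_recip (hp : p % 8 = 5) (hl : l % 8 = 5) (hpl : p ≠ l)
    (hs : legendreSym l p = -1) {a b c d : ℤ}
    (hab : a ^ 2 + b ^ 2 = p) (hn : (a - b) % 8 = 1) (hb : b % 4 = 2)
    (hcd : c ^ 2 + d ^ 2 = l) (hn' : (c - d) % 8 = 1) (hd : d % 4 = 2)
    (h : ∀ j : ZMod p, j ^ 2 = -1 → χ[p] ((1 + j) * (c + d * j)) = 1) {j : ZMod l}
    (hj : j ^ 2 = -1) : χ[l] ((1 + j) * (a + b * j)) = 1 := by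
  have hpl1 : (p * l) % 8 = 1 := by
    rw [Nat.mul_mod, hp, hl]
  have hcab := isCoprime_of_sq_add_sq_eq_prime hab
  have hccd := isCoprime_of_sq_add_sq_eq_prime hcd
  -- Up to sign, `ad - bc` is the imaginary part of `π` times the conjugate of `λ`. It divides `pl -
  -- (ac + bd)²` and `pl ≡ 1 (mod 8)`. Its residues modulo `p` and `l` carry the two symbols to be
  -- compared.
  have hD : jacobiSym (a * d - b * c) p * jacobiSym (a * d - b * c) l = 1 := by
    have : NeZero p := ⟨(Fact.out : p.Prime).ne_zero⟩
    have : NeZero l := ⟨(Fact.out : l.Prime).ne_zero⟩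
    rw [← jacobiSym.mul_right]
    refine jacobiSym_eq_one_of_dvd' (y := 1) (x := a * c + b * d) hpl1 ?_
      ⟨a * d - b * c, by push_cast; rw [← hab, ← hcd]; ring⟩ ?_
    · intro h0
      apply not_sq_eq_mul (Fact.out : p.Prime) (Fact.out : l.Prime) hpl (a * c + b * d)
      rw [← hab, ← hcd]; linear_combination -(a * d - b * c) * h0
    · obtain ⟨α, β, h1⟩ := hccd
      obtain ⟨γ, δ, h2⟩ := hcab
      obtain ⟨x, y, h3⟩ : IsCoprime (p : ℤ) l :=
        Nat.isCoprime_iff_coprime.2 ((Nat.coprime_primes Fact.out Fact.out).2 hpl)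
      refine ⟨x * (-α * b + β * a) + y * (γ * d - δ * c), x * (α * a + β * b) + y * (γ * c + δ * d), ?_⟩
      rw [← h3]
      linear_combination x * (α * c + β * d) * hab + y * (γ * a + δ * b) * hcd + x * p * h1 + y * l * h2
  have hb0 := dvd_im_ne_zero hab
  have hd0 := dvd_im_ne_zero hcd
  have hDp : jacobiSym (a * d - b * c) p = 1 := by
    have h0 : (a : ZMod p) + b * (-a / b) = 0 := by field_simp; ring
    have h1 := h _ (sq_eq_neg_one_of_root hab h0)
    rw [map_mul, quadraticChar_one_add_of_normalized hp hab hn hb h0] at h1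
    have e : ((c : ZMod p) + d * (-a / b)) * b = -((a * d - b * c : ℤ) : ZMod p) := by
      push_cast; field_simp; ring
    have := congrArg (χ[p]) e
    rw [map_mul, quadraticChar_im hp hab hb, quadraticChar_neg_mod_four (by omega),
      quadraticChar_intCast] at this
    linarith
  have hDl : jacobiSym (a * d - b * c) l = 1 := by rw [hDp] at hD; linarith
  have key : ∀ j : ZMod l, (c : ZMod l) + d * j = 0 → χ[l] (a + b * j) = -1 := by
    intro j h0
    have e : ((a : ZMod l) + b * j) * d = ((a * d - b * c : ℤ) : ZMod l) := by
      push_cast; linear_combination b * h0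
    have := congrArg (χ[l]) e
    rw [map_mul, quadraticChar_im hl hcd hd, quadraticChar_intCast, hDl] at this
    linarith
  rw [map_mul]
  rcases root_cases hcd hj with h0 | h0
  · rw [quadraticChar_one_add_of_normalized hl hcd hn' hd h0, key j h0]; norm_num
  · rw [quadraticChar_one_add_of_normalized' hl hcd hn' hd h0]
    have h1 := key (-j) (by linear_combination h0)
    have h2 := quadraticChar_conj hab hs hj
    rw [mul_neg, ← sub_eq_add_neg] at h1
    rw [h1] at h2
    linarith

/-! ### The torsor `𝒯^(φ)(2 p)` -/

/-- Both `M` and `e` are odd, so `M² + le²i` is divisible by `1 + i`. The quotient `x + yi` has norm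
`pn²`, and `(1 + j)(x + yj)` reduces to `M²` modulo `l`. -/
theorem quadraticChar_of_phi_two_mul_aux (hl : l % 8 = 5) {M e n a b : ℤ}
    (hc : IsCoprime M e) (hlM : ¬ (l : ℤ) ∣ M) (h : 2 * p * n ^ 2 = M ^ 4 + l ^ 2 * e ^ 4)
    (hab : a ^ 2 + b ^ 2 = p) (hn : (a - b) % 8 = 1) (hb : b % 4 = 2)
    {j : ZMod l} (hj : j ^ 2 = -1) : χ[l] ((1 + j) * (a + b * j)) = 1 := by
  have hM2 := Int.sq_mod_eight_cases M
  have he2 := Int.sq_mod_eight_cases e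
  have hle := Int.mul_mod_eight (p := l) (y := e ^ 2) (r := 5) (by omega)
  have hpar : (M ^ 2 - l * e ^ 2) % 2 = 0 := by
    have h1 : Even (M ^ 4 + l ^ 2 * e ^ 4) := by rw [← h, mul_assoc]; exact even_two_mul _
    have h2 : Even ((M ^ 2 - l * e ^ 2) ^ 2) := by
      rw [show (M ^ 2 - l * e ^ 2) ^ 2 = (M ^ 4 + l ^ 2 * e ^ 4) - 2 * (l * M ^ 2 * e ^ 2) by ring]
      exact h1.sub (even_two_mul _)
    rw [Int.even_pow' two_ne_zero] at h2
    exact Int.even_iff.1 h2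
  have hodd : M ^ 2 % 8 = 1 ∧ e ^ 2 % 8 = 1 := by
    have := hc.odd_or_odd
    rcases hM2 with ⟨x1, x2⟩ | ⟨x1, x2⟩ | ⟨x1, x2⟩ <;>
    rcases he2 with ⟨y1, y2⟩ | ⟨y1, y2⟩ | ⟨y1, y2⟩ <;> rw [y2] at hle <;> omega
  rw [hodd.2] at hle
  obtain ⟨x, hx⟩ : (2 : ℤ) ∣ M ^ 2 + l * e ^ 2 := by omega
  obtain ⟨y, hy⟩ : (2 : ℤ) ∣ l * e ^ 2 - M ^ 2 := by omega
  have hxyM : x - y = M ^ 2 := by linarith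
  have hxye : x + y = l * e ^ 2 := by linarith
  have hcop : IsCoprime x y := by
    have h1 : IsCoprime (x - y) (x + y) := by
      rw [hxyM, hxye]
      exact (((Nat.Prime.int_coprime_iff.2 hlM).symm).mul_right hc.pow_right).pow_left
    obtain ⟨α, β, hαβ⟩ := h1
    exact ⟨α + β, β - α, by linear_combination hαβ⟩
  obtain ⟨b', hb', hmod, hall⟩ := exists_quadraticChar_eq (l := l) (n := n) hab
    (by omega) (by omega) (A := x) (B := y) (by
      have : 2 * (x ^ 2 + y ^ 2) = 2 * (p * n ^ 2) := by
        calc 2 * (x ^ 2 + y ^ 2) = (x - y) ^ 2 + (x + y) ^ 2 := by ring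
          _ = _ := by rw [hxyM, hxye]; linear_combination -h
      linarith) hcop (by omega)
  -- Here `x - y = M² ≡ 1 (mod 8)`, whereas the conjugate would give `±(a + b) ≡ ±5`.
  have hbb : b' = b := by
    rw [hxyM] at hmod
    omega
  subst hbb
  have hM0 := intCast_ne_zero_iff.2 hlM
  have e1 : (1 + j) * ((x : ZMod l) + y * j) = (M : ZMod l) ^ 2 := by
    have h1 := congrArg (Int.cast : ℤ → ZMod l) hxyM
    have h2 := congrArg (Int.cast : ℤ → ZMod l) hxye
    push_cast at h1 h2
    rw [ZMod.natCast_self] at h2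
    linear_combination h1 + j * h2 + y * hj
  rw [map_mul, hall j hj, ← map_mul, e1, quadraticChar_sq_one' hM0]
  intro h0
  rw [h0, mul_zero] at e1
  exact pow_ne_zero 2 hM0 e1.symm

theorem quadraticChar_of_phi_two_mul (hl : l % 8 = 5) (hpl : p ≠ l) {M e n a b : ℤ}
    (hc : IsCoprime M e) (h : 2 * p * n ^ 2 = M ^ 4 + l ^ 2 * e ^ 4)
    (hab : a ^ 2 + b ^ 2 = p) (hn : (a - b) % 8 = 1) (hb : b % 4 = 2)
    {j : ZMod l} (hj : j ^ 2 = -1) : χ[l] ((1 + j) * (a + b * j)) = 1 := by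
  have hl' := Nat.prime_iff_prime_int.1 (Fact.out : l.Prime)
  by_cases hd : (l : ℤ) ∣ M
  · have he : ¬ (l : ℤ) ∣ e := fun he => hl'.not_isUnit (hc.isUnit_of_dvd' hd he)
    obtain ⟨M, rfl⟩ := hd
    have h2 : (l : ℤ) ∣ 2 * n := dvd_of_mul_sq_dvd hpl (n := 2 * n)
      (k := 2 * (l ^ 3 * M ^ 4 + l * e ^ 4)) (by linear_combination 2 * h)
    have hl2 : ¬ (l : ℤ) ∣ 2 := by
      have := two_ne_zero_of_mod (q := l) (by omega)
      exact intCast_ne_zero_iff.1 (by exact_mod_cast this)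
    obtain ⟨n, rfl⟩ := (hl'.dvd_or_dvd h2).resolve_left hl2
    exact quadraticChar_of_phi_two_mul_aux hl hc.of_mul_left_right.symm he (n := n)
      (mul_left_cancel₀ (pow_ne_zero 2 hl'.ne_zero) (by linear_combination h)) hab hn hb hj
  · exact quadraticChar_of_phi_two_mul_aux hl hc hd h hab hn hb hj

theorem quadraticChar_of_phi_mul (hp : p % 8 = 5) (hl : l % 8 = 5) (hpl : p ≠ l)
    (hs : legendreSym l p = -1) {M e n a b : ℤ} (hc : IsCoprime M e)
    (h : p * (l * n ^ 2) = M ^ 4 + 4 * e ^ 4)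
    (hab : a ^ 2 + b ^ 2 = p) (hn : (a - b) % 8 = 1) (hb : b % 4 = 2)
    {j : ZMod l} (hj : j ^ 2 = -1) : χ[l] ((1 + j) * (a + b * j)) = 1 := by
  obtain ⟨M, e, r, s, hc, hM, ⟨h1, h2, he⟩ | ⟨h1, h2, he⟩⟩ := exists_phi_mul_split hp hl hc h
  · have hc1 : IsCoprime (M + e) e := by
      have h2 := hc.add_mul_left_left 1
      rwa [mul_one] at h2
    obtain ⟨he0, k, hk, hke⟩ := exists_root_of_sq_add_sq (l := l) (k := s ^ 2) (by
      have h2 := hc.add_mul_left_left (-1)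
      rwa [show M + e * -1 = M - e by ring] at h2) h2
    have h2e := quadraticChar_two_mul_of_split hl hc h2 he
    have h20 : (2 : ZMod l) ≠ 0 := two_ne_zero_of_mod (by omega)
    push_cast at hke
    have hk1 : χ[l] (1 + k) = -1 := by
      -- With `M - e = ke`, `(M + e)² + e² = ((k + 2)² + 1)e² = 4(1 + k)e²`.
      have e1 : (p : ZMod l) * r ^ 2 = (1 + k) * (2 * e) ^ 2 := by
        have := congrArg (Int.cast : ℤ → ZMod l) h1
        push_cast at this
        rw [← this]
        linear_combination (M + 3 * e + k * e) * hke + (e : ZMod l) ^ 2 * hk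
      have hr : (r : ZMod l) ≠ 0 := by
        intro h0
        rw [h0] at e1
        exact mul_ne_zero (one_add_ne_zero_of_sq (by omega) hk)
          (pow_ne_zero 2 (mul_ne_zero h20 he0)) (by rw [← e1]; ring)
      have h3 := congrArg (χ[l]) e1
      rw [map_mul, map_mul, quadraticChar_sq_one' hr,
        quadraticChar_sq_one' (mul_ne_zero h20 he0), mul_one, mul_one] at h3
      rw [← h3, ← hs]
      unfold legendreSym
      push_cast
      rfl
    have hk2 : χ[l] (1 - k) = 1 := by
      have := quadraticChar_one_add_mul hl hk; rw [hk1] at this; linarith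
    -- From `M = (1 + k)e` modulo `l` one gets `(M/l) = 1`, and `2ls² ≡ (2e)² (mod M)` gives
    -- `(2l/|M|) = 1`. Hence `(2/|M|) = 1`. As `M` is `re - im` of `(M + e) + ei`, this selects the
    -- conjugate.
    have hM8 : M % 8 = 1 ∨ M % 8 = 7 := by
      have hMo : Odd M := Int.odd_iff.2 hM
      have g1 : jacobiSym M l = 1 := by
        rw [map_mul, quadraticChar_two_mod_eight' (Or.inr hl)] at h2e
        rw [← quadraticChar_intCast, show (M : ZMod l) = (1 + k) * e by linear_combination hke,
          map_mul, hk1]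
        linarith
      rw [jacobiSym_recip_mod_four (by omega) hMo] at g1
      have hcM : IsCoprime M (2 * e) := (int_odd_coprime_two hM).mul_right hc
      have g2 := jacobiSym_natAbs_eq_one (m := M) (a := 2 * l) (y := s) (x := 2 * e)
        ⟨2 * M - 4 * e, by linear_combination -2 * h2⟩ hcM
      rw [jacobiSym.mul_left, g1, mul_one] at g2
      by_contra! hcon
      rw [jacobiSym_two_mod_eight' (by omega)] at g2
      norm_num at g2
    obtain ⟨b', hb', hmod, hall⟩ := exists_quadraticChar_eq (l := l) hab
      (by omega) (by omega) h1 hc1 (by omega)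
    have hbb : b' = b := by
      rw [show M + e - e = M by ring] at hmod
      omega
    subst hbb
    have hjk : (j - k) * (j + k) = 0 := by linear_combination hj - hk
    rw [map_mul]
    have hk0 := one_add_ne_zero_of_sq (l := l) (by omega) hk
    have e1 : ((M + e : ℤ) : ZMod l) + e * k = 2 * e * (1 + k) := by
      push_cast; linear_combination hke
    have e2 : ((M + e : ℤ) : ZMod l) + e * -k = 2 * e := by
      push_cast; linear_combination hke
    rcases mul_eq_zero.1 hjk with g | g
    · obtain rfl : j = k := by linear_combination g
      rw [hall j hj (by rw [e1]; exact mul_ne_zero (mul_ne_zero h20 he0) hk0), e1, map_mul, h2e, hk1]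
      norm_num
    · obtain rfl : j = -k := by linear_combination g
      rw [hall (-k) hj (by rw [e2]; exact mul_ne_zero h20 he0), e2, h2e, ← sub_eq_add_neg, hk2]
      norm_num
  · obtain ⟨b', hb', ⟨k, hk, hχ, hk1⟩, hroot⟩ :=
      exists_compose_of_split hp hl hpl hc hM h1 h2 he hab (by omega)
    -- The choice `b' = b` is impossible: at the root of `a - bj` modulo `p` the normalization gives
    -- character `1` for `1 + j`, but the split gives `-1`.
    have hbb : b' = -b := by
      rcases hb' with rfl | hb'
      · exfalso
        have hb0 := dvd_im_ne_zero hab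
        have h0 : (a : ZMod p) - b' * (a / b') = 0 := by field_simp; ring
        have g1 := quadraticChar_one_add_of_normalized' hp hab hn hb h0
        have g2 := hroot _ (by
          have := sq_eq_neg_one_of_root hab (j := -(a / b' : ZMod p)) (by linear_combination h0)
          rwa [neg_sq] at this) h0
        rw [g1] at g2
        norm_num at g2
      · exact hb'
    subst hbb
    push_cast at hχ
    rw [neg_mul, ← sub_eq_add_neg] at hχ
    have h3 := quadraticChar_conj hab hs hk
    have h4 := quadraticChar_one_add_mul hl hk
    have hjk : (j - k) * (j + k) = 0 := by linear_combination hj - hk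
    rw [map_mul]
    rcases mul_eq_zero.1 hjk with g | g
    · obtain rfl : j = k := by linear_combination g
      rw [hχ] at h3
      rw [hk1, show χ[l] (a + b * j) = -1 by linarith]; norm_num
    · obtain rfl : j = -k := by linear_combination g
      rw [hk1] at h4
      rw [mul_neg, ← sub_eq_add_neg, ← sub_eq_add_neg, hχ]; linarith

end

/-! ### The norm form of `ℤ[√2]` -/

theorem Int.odd_sq_mod_eight {x : ℤ} (h : x % 2 = 1) : x ^ 2 % 8 = 1 := by
  rcases Int.sq_mod_eight_cases x with ⟨x1, x2⟩ | ⟨x1, x2⟩ | ⟨x1, x2⟩ <;> omega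

theorem exists_of_mul_eq_two_mul_sq {f g d : ℤ} (hf : 0 ≤ f) (hg : 0 ≤ g) (hc : IsCoprime f g)
    (h : f * g = 2 * d ^ 2) (he : 2 ∣ f) : ∃ r s : ℤ, f + g = r ^ 2 + 2 * s ^ 2 ∧ d = r * s := by
  obtain ⟨f, rfl⟩ := he
  have h' : f * g = d ^ 2 := by linarith
  have hc' := hc.of_mul_left_right
  have key : ∀ {u v : ℤ}, 0 ≤ u → IsCoprime u v → u * v = d ^ 2 → ∃ s, u = s ^ 2 := by
    intro u v hu huv e
    obtain ⟨s, hs | hs⟩ := Int.sq_of_isCoprime huv e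
    · exact ⟨s, hs⟩
    · exact ⟨s, by nlinarith [sq_nonneg s]⟩
  obtain ⟨s, rfl⟩ := key (by linarith) hc' h'
  obtain ⟨r, rfl⟩ := key hg hc'.symm (by rw [← h']; ring)
  rcases sq_eq_sq_iff_eq_or_eq_neg.1 (show d ^ 2 = (r * s) ^ 2 by rw [← h']; ring) with g | g
  · exact ⟨r, s, by ring, g⟩
  · exact ⟨r, -s, by ring, by rw [g]; ring⟩

/-- The conclusion says `c + d√2 = (r + s√2)²`. The numbers `(c ± z)/2` are coprime with product
`2(d/2)²`, so one is a square and the other twice a square. -/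
theorem exists_eq_sq_add_two_sq_of_pos {c d z : ℤ} (h : c ^ 2 - 2 * d ^ 2 = z ^ 2)
    (hcd : IsCoprime c d) (hc : c % 2 = 1) (hc0 : 0 < c) :
    ∃ r s : ℤ, c = r ^ 2 + 2 * s ^ 2 ∧ d = 2 * r * s := by
  wlog hz : 0 ≤ z generalizing z
  · exact this (z := -z) (by rw [h]; ring) (by linarith)
  have hc8 := Int.odd_sq_mod_eight hc
  have hz2 : z % 2 = 1 := by
    rcases Int.sq_mod_eight_cases z with ⟨x1, x2⟩ | ⟨x1, x2⟩ | ⟨x1, x2⟩ <;> omega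
  have hz8 := Int.odd_sq_mod_eight hz2
  obtain ⟨d, rfl⟩ : (2 : ℤ) ∣ d := by
    rcases Int.sq_mod_eight_cases d with ⟨x1, x2⟩ | ⟨x1, x2⟩ | ⟨x1, x2⟩ <;> omega
  obtain ⟨f, hf⟩ : (2 : ℤ) ∣ c + z := by omega
  obtain ⟨g, hg⟩ : (2 : ℤ) ∣ c - z := by omega
  obtain rfl : c = f + g := by linarith
  obtain rfl : z = f - g := by linarith
  have hfg : f * g = 2 * d ^ 2 := by linarith
  have hf0 : 0 < f := by linarith
  have hg0 : 0 ≤ g := by nlinarith [sq_nonneg d]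
  have hcop : IsCoprime f g := by
    refine isCoprime_of_prime_dvd (by omega) fun q hq g1 g2 => ?_
    have hq2 : ¬ q ∣ 2 := fun g =>
      hq.not_isUnit ((int_odd_coprime_two hc).isUnit_of_dvd' (dvd_add g1 g2) g)
    have h3 : q ∣ 2 * d ^ 2 := by rw [← hfg]; exact g1.mul_right _
    have h4 := hq.dvd_of_dvd_pow ((hq.dvd_or_dvd h3).resolve_left hq2)
    exact hq.not_isUnit (hcd.isUnit_of_dvd' (dvd_add g1 g2) (h4.mul_left _))
  rcases Int.prime_two.dvd_or_dvd (Dvd.intro _ hfg.symm) with h2 | h2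
  · obtain ⟨r, s, h3, h4⟩ := exists_of_mul_eq_two_mul_sq hf0.le hg0 hcop hfg h2
    exact ⟨r, s, h3, by rw [h4]; ring⟩
  · obtain ⟨r, s, h3, h4⟩ := exists_of_mul_eq_two_mul_sq hg0 hf0.le hcop.symm (by rw [← hfg]; ring) h2
    exact ⟨r, s, by rw [← h3]; ring, by rw [h4]; ring⟩

theorem exists_eq_sq_add_two_sq {c d z : ℤ} (h : c ^ 2 - 2 * d ^ 2 = z ^ 2)
    (hcd : IsCoprime c d) (hc : c % 2 = 1) :
    ∃ r s : ℤ, (c = r ^ 2 + 2 * s ^ 2 ∨ c = -(r ^ 2 + 2 * s ^ 2)) ∧ d = 2 * r * s := by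
  rcases lt_or_gt_of_ne (show c ≠ 0 by omega) with h0 | h0
  · obtain ⟨r, s, h1, h2⟩ := exists_eq_sq_add_two_sq_of_pos (c := -c) (d := d) (z := z)
      (by rw [← h]; ring) hcd.neg_left (by omega) (by linarith)
    exact ⟨r, s, Or.inr (by linarith), h2⟩
  · obtain ⟨r, s, h1, h2⟩ := exists_eq_sq_add_two_sq_of_pos h hcd hc h0
    exact ⟨r, s, Or.inl h1, h2⟩

section

variable {l : ℕ} [Fact l.Prime]

/-- The analogue in `ℤ[√2]`: `x + y√2` is divisible by `a + b√2` or its conjugate, and `c + d√2` is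
the quotient; its norm is `-k` because the divisor has norm `-l`. -/
theorem exists_compose_sq_sub_two_sq (hl : l % 2 = 1) {a b x y k : ℤ} (hab : a ^ 2 - 2 * b ^ 2 = -l)
    (h : x ^ 2 - 2 * y ^ 2 = l * k) :
    ∃ b' c d : ℤ, (b' = b ∨ b' = -b) ∧ x = a * c + 2 * b' * d ∧ y = a * d + b' * c ∧
      c ^ 2 - 2 * d ^ 2 = -k := by
  have hp := Nat.prime_iff_prime_int.1 (Fact.out : l.Prime)
  have hp0 := hp.ne_zero
  have hl2 : ¬ (l : ℤ) ∣ 2 := by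
    have := two_ne_zero_of_mod (q := l) hl
    exact intCast_ne_zero_iff.1 (by exact_mod_cast this)
  have main : ∀ b' : ℤ, (b' = b ∨ b' = -b) → (l : ℤ) ∣ a * x - 2 * b' * y →
      ∃ b' c d : ℤ, (b' = b ∨ b' = -b) ∧ x = a * c + 2 * b' * d ∧ y = a * d + b' * c ∧
      c ^ 2 - 2 * d ^ 2 = -k := by
    intro b' hb' hd
    have hab' : a ^ 2 - 2 * b' ^ 2 = -l := by rcases hb' with rfl | rfl <;> linarith
    have hd2 : (l : ℤ) ∣ a * y - b' * x := by
      have h2 : (l : ℤ) ∣ 2 * (a * y - b' * x) ^ 2 := by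
        have : 2 * (a * y - b' * x) ^ 2 = l * (l * k) + (a * x - 2 * b' * y) ^ 2 := by
          linear_combination -(x ^ 2 - 2 * y ^ 2) * hab' + l * h
        rw [this]
        exact dvd_add (Dvd.intro _ rfl) (dvd_pow hd two_ne_zero)
      exact hp.dvd_of_dvd_pow ((hp.dvd_or_dvd h2).resolve_left hl2)
    obtain ⟨c, hc⟩ := hd
    obtain ⟨d, hd⟩ := hd2
    refine ⟨b', -c, -d, hb', ?_, ?_, ?_⟩
    · exact mul_left_cancel₀ hp0 (by linear_combination -a * hc - 2 * b' * hd + x * hab')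
    · exact mul_left_cancel₀ hp0 (by linear_combination -a * hd - b' * hc + y * hab')
    · refine mul_left_cancel₀ hp0 (mul_left_cancel₀ hp0 ?_)
      linear_combination (-l * c - (a * x - 2 * b' * y)) * hc +
        2 * (l * d + (a * y - b' * x)) * hd + (x ^ 2 - 2 * y ^ 2) * hab' - l * h
  have h1 : (l : ℤ) ∣ (a * x - 2 * b * y) * (a * x - 2 * -b * y) :=
    ⟨a ^ 2 * k - 2 * y ^ 2, by linear_combination a ^ 2 * h + 2 * y ^ 2 * hab⟩
  rcases hp.dvd_or_dvd h1 with h2 | h2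
  · exact main b (Or.inl rfl) h2
  · exact main (-b) (Or.inr rfl) h2

theorem exists_root_of_sq_sub_two_sq {x y k : ℤ} (hc : IsCoprime x y)
    (h : x ^ 2 - 2 * y ^ 2 = l * k) :
    (y : ZMod l) ≠ 0 ∧ ∃ w : ZMod l, w ^ 2 = 2 ∧ (x : ZMod l) + y * w = 0 := by
  have hl := Nat.prime_iff_prime_int.1 (Fact.out : l.Prime)
  have hy : (y : ZMod l) ≠ 0 := by
    rw [intCast_ne_zero_iff]
    intro g
    refine hl.not_isUnit (hc.isUnit_of_dvd' (hl.dvd_of_dvd_pow (n := 2) ?_) g)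
    rw [show x ^ 2 = l * k + 2 * y ^ 2 by linarith]
    exact dvd_add (Dvd.intro _ rfl) ((dvd_pow g two_ne_zero).mul_left _)
  have h' := congrArg (Int.cast : ℤ → ZMod l) h
  push_cast at h'
  rw [ZMod.natCast_self, zero_mul] at h'
  refine ⟨hy, -x / y, ?_, by field_simp; ring⟩
  field_simp
  linear_combination h'

theorem jacobiSym_eq_sign {N : ℕ} (hN : N % 8 = 7) {m x y : ℤ}
    (h : m ∣ N * y ^ 2 + x ^ 2) (hc : IsCoprime m x) : jacobiSym m N = m.sign := by
  rcases lt_trichotomy m 0 with h0 | rfl | h0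
  · have := jacobiSym_eq_sign_of_dvd hN (m := -m) (by linarith) ((neg_dvd).2 h) hc.neg_left
    rw [jacobiSym_neg_of_mod_four' (by omega)] at this
    rw [Int.sign_eq_neg_one_of_neg h0]
    linarith
  · rw [jacobiSym.zero_left (by omega)]; rfl
  · rw [jacobiSym_eq_sign_of_dvd hN h0 h hc, Int.sign_eq_one_of_pos h0]

/-- The symbol of the unit `1 - √2` modulo a primary element of negative norm is its sign. -/
theorem quadraticChar_one_sub_mul_sign (hl : l % 8 = 7) {X Y z : ℤ} (hc : IsCoprime X Y)
    (h : X ^ 2 - 2 * Y ^ 2 = -l * z ^ 2) (hXY : (X + Y) % 4 = 1) {w : ZMod l}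
    (hw : (X : ZMod l) + Y * w = 0) :
    χ[l] (Y : ZMod l) = Y.sign ∧ χ[l] (1 - w) * Y.sign = 1 := by
  -- Modulo `l`, `Y(1 - w) = X + Y`. The symbol of `Y` is its sign since `Y ∣ lz² + X²`; that of `X
  -- + Y` is `1` since it is `1` modulo `4` and divides `lz² - Y²`.
  have h1 := jacobiSym_eq_sign hl (m := Y) (x := X) (y := z) ⟨2 * Y, by linear_combination h⟩ hc.symm
  have h2 := jacobiSym_eq_one_of_dvd_of_mod (N := l) (m := X + Y) (x := Y) (y := z) (by omega) hXY
    ⟨Y - X, by linear_combination h⟩ (by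
      have := hc.add_mul_left_left 1
      rwa [mul_one] at this)
  rw [← quadraticChar_intCast] at h1 h2
  refine ⟨h1, ?_⟩
  rw [← h1, ← map_mul, ← h2]
  congr 1
  push_cast
  linear_combination -hw

end

/-! ### Primary elements of `ℤ[√2]` and quadratic systems -/

theorem add_mod_four_of_mul {a b c d x y : ℤ} (ha : a % 2 = 1) (hb : b % 2 = 0)
    (hab : (a + b) % 4 = 1) (hc : c % 2 = 1) (hd : d % 2 = 0)
    (hx : x = a * c + 2 * b * d) (hy : y = a * d + b * c) (hxy : (x + y) % 4 = 1) :
    (c + d) % 4 = 1 := by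
  obtain ⟨β, rfl⟩ : (2 : ℤ) ∣ b := by omega
  obtain ⟨δ, rfl⟩ : (2 : ℤ) ∣ d := by omega
  obtain ⟨γ, rfl⟩ : ∃ γ, c = 2 * γ + 1 := ⟨c / 2, by omega⟩
  by_contra hne
  obtain ⟨k, hk⟩ : ∃ k, 2 * γ + 1 + 2 * δ = 4 * k - 1 := ⟨(γ + δ + 1) / 2, by omega⟩
  have : x + y = 4 * (a * k + 2 * (β * δ) + β * γ) - a + 2 * β := by
    rw [hx, hy]; linear_combination a * hk
  generalize a * k + 2 * (β * δ) + β * γ = t at this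
  omega

section

variable {p l : ℕ} [Fact p.Prime] [Fact l.Prime]

theorem odd_of_compose {a b c d x y : ℤ} (ha : a % 2 = 1) (hb : b % 2 = 0) (hx : x % 2 = 1)
    (hy : y % 2 = 0) (h1 : x = a * c + 2 * b * d) (h2 : y = a * d + b * c) :
    c % 2 = 1 ∧ d % 2 = 0 := by
  obtain ⟨β, rfl⟩ : (2 : ℤ) ∣ b := by omega
  obtain ⟨α, rfl⟩ : ∃ α, a = 2 * α + 1 := ⟨a / 2, by omega⟩
  constructor
  · have : x = 2 * (α * c + 2 * β * d) + c := by rw [h1]; ring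
    omega
  · have : y = 2 * (α * d + β * c) + d := by rw [h2]; ring
    omega

theorem coprime_of_compose {a b c d x y : ℤ} (h1 : x = a * c + 2 * b * d) (h2 : y = a * d + b * c)
    (hc : IsCoprime x y) : IsCoprime c d := by
  obtain ⟨α, β, h⟩ := hc
  exact ⟨α * a + β * b, α * (2 * b) + β * a, by rw [← h, h1, h2]; ring⟩

theorem quadraticChar_natCast_of_legendreSym (hp : p % 8 = 7) (hl : l % 8 = 7)
    (hs : legendreSym l p = 1) : χ[l] (p : ZMod l) = 1 ∧ χ[p] (l : ZMod p) = -1 := by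
  have h1 : jacobiSym p l = 1 := by rw [← jacobiSym.legendreSym.to_jacobiSym]; exact hs
  have h2 : jacobiSym l p = -1 := by
    rw [jacobiSym.quadratic_reciprocity_three_mod_four (by omega) (by omega), h1]
  rw [← quadraticChar_intCast] at h1 h2
  exact ⟨by exact_mod_cast h1, by exact_mod_cast h2⟩

/-- It suffices to know the symbol for one choice of the conjugates. -/
theorem quadraticChar_eq_one_of_conj (hp : p % 8 = 7) (hl : l % 8 = 7)
    (hs : legendreSym l p = 1) {a b b' : ℤ} (hab : a ^ 2 - 2 * b ^ 2 = -l)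
    -- The two conjugates have the same symbol: their product is `-l`, which is a residue modulo
    -- `p`.
    (hb' : b' = b ∨ b' = -b) {w : ZMod p} (hw : w ^ 2 = 2) (h : χ[p] (a + b' * w) = 1)
    {v : ZMod p} (hv : v ^ 2 = 2) : χ[p] (a + b * v) = 1 := by
  have hl1 := (quadraticChar_natCast_of_legendreSym hp hl hs).2
  have hab' := congrArg (Int.cast : ℤ → ZMod p) hab
  push_cast at hab'
  have hprod : χ[p] (a + b * w) * χ[p] (a - b * w) = 1 := by
    rw [← map_mul, show ((a : ZMod p) + b * w) * (a - b * w) = -l by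
      linear_combination hab' - (b : ZMod p) ^ 2 * hw, quadraticChar_neg_mod_four' (by omega), hl1]
    norm_num
  have hboth : χ[p] (a + b * w) = 1 ∧ χ[p] (a - b * w) = 1 := by
    rcases hb' with rfl | rfl
    · rw [h] at hprod; exact ⟨h, by linarith⟩
    · push_cast at h
      rw [neg_mul, ← sub_eq_add_neg] at h
      rw [h] at hprod; exact ⟨by linarith, h⟩
  have hvw : (v - w) * (v + w) = 0 := by linear_combination hv - hw
  rcases mul_eq_zero.1 hvw with g | g
  · obtain rfl : v = w := by linear_combination g
    exact hboth.1
  · obtain rfl : v = -w := by linear_combination g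
    rw [mul_neg, ← sub_eq_add_neg]; exact hboth.2

/-- Every primary element of norm `-l z²` may replace one of norm `-l`. -/
theorem quadraticChar_eq_one_of_primary (hp : p % 8 = 7) (hl : l % 8 = 7)
    (hs : legendreSym l p = 1) {a b : ℤ} (hab : a ^ 2 - 2 * b ^ 2 = -l) (ha : a % 2 = 1)
    (hb : b % 2 = 0) (hab4 : (a + b) % 4 = 1) {x y z : ℤ} (hc : IsCoprime x y)
    (h : x ^ 2 - 2 * y ^ 2 = -l * z ^ 2) (hy : y % 2 = 0) (hxy : (x + y) % 4 = 1)
    {w : ZMod p} (hw : w ^ 2 = 2) (hχ : χ[p] (x + y * w) = 1)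
    {v : ZMod p} (hv : v ^ 2 = 2) : χ[p] (a + b * v) = 1 := by
  obtain ⟨b', c, d, hb', hx', hy', hcd⟩ := exists_compose_sq_sub_two_sq (by omega) hab
    (k := -z ^ 2) (by rw [h]; ring)
  have hb2 : b' % 2 = 0 := by omega
  have hab4' : (a + b') % 4 = 1 := by omega
  have hcop := coprime_of_compose hx' hy' hc
  obtain ⟨hc2, hd2⟩ := odd_of_compose ha hb2 (by omega) hy hx' hy'
  have hcd4 := add_mod_four_of_mul ha hb2 hab4' hc2 hd2 hx' hy' hxy
  obtain ⟨r, s, hcr, hds⟩ := exists_eq_sq_add_two_sq (c := c) (d := d) (z := z)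
    (by rw [hcd]; ring) hcop hc2
  have hcr' : c = r ^ 2 + 2 * s ^ 2 := by
    -- The quotient of two primary elements is primary, while minus a square is not; so the cofactor
    -- is a genuine square.
    refine hcr.resolve_right fun hcr => ?_
    have hr : r % 2 = 1 := by
      rcases Int.sq_mod_eight_cases r with ⟨x1, x2⟩ | ⟨x1, x2⟩ | ⟨x1, x2⟩ <;> omega
    obtain ⟨ρ, hρ⟩ : ∃ ρ, r = 2 * ρ + 1 := ⟨r / 2, by omega⟩
    obtain ⟨k, hk⟩ : ∃ k, s ^ 2 - s = 2 * k := by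
      obtain ⟨k, hk⟩ := Int.even_mul_pred_self s; exact ⟨k, by linarith⟩
    have : c + d = -1 - 4 * (ρ ^ 2 + ρ + k - ρ * s) := by
      rw [hcr, hds, hρ]; linear_combination -2 * hk
    generalize ρ ^ 2 + ρ + k - ρ * s = t at this
    omega
  refine quadraticChar_eq_one_of_conj hp hl hs hab hb' hw ?_ hv
  have e : (x : ZMod p) + y * w = (a + b' * w) * (r + s * w) ^ 2 := by
    rw [hx', hy', hds, hcr']; push_cast
    linear_combination (-(4 * b' * r * s) - a * s ^ 2 - b' * s ^ 2 * w + 2 * b' * r * s : ZMod p) * hw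
  rw [← hχ]
  refine (quadraticChar_eq_of_sq_mul ?_ e).symm
  intro h0
  rw [e, h0] at hχ
  simp at hχ

theorem one_sub_ne_zero {w : ZMod p} (hw : w ^ 2 = 2) : 1 - w ≠ 0 := by
  intro h0
  have : (1 : ZMod p) = 0 := by linear_combination -(1 + w) * h0 - hw
  exact one_ne_zero this

/-- The pair of equations `x² - 2y² = l z²`, `x² - y² = p v²`. -/
theorem quadraticChar_of_pair_one (hp : p % 8 = 7) (hl : l % 8 = 7)
    (hs : legendreSym l p = 1) {a b : ℤ} (hab : a ^ 2 - 2 * b ^ 2 = -l) (ha : a % 2 = 1)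
    (hb : b % 2 = 0) (hab4 : (a + b) % 4 = 1) {x y z v : ℤ} (hc : IsCoprime x y)
    (h1 : x ^ 2 - 2 * y ^ 2 = l * z ^ 2) (h2 : x ^ 2 - y ^ 2 = p * v ^ 2) (hx : x % 2 = 1)
    (hy : y % 2 = 1) {w : ZMod p} (hw : w ^ 2 = 2) : χ[p] (a + b * w) = 1 := by
  wlog hy4 : y % 4 = 1 generalizing y
  · exact this (y := -y) hc.neg_right (by rw [← h1]; ring) (by rw [← h2]; ring) (by omega) (by omega)
  -- These are the coordinates of `(x + y√2)(1 + √2)`, of norm `-lz²`. It is primary once `y ≡ 1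
  -- (mod 4)`, and modulo `p`, where `x = ±y`, it becomes `y(1 + w)²` or `y`.
  have hc' : IsCoprime (x + 2 * y) (x + y) := by
    obtain ⟨α, β, h⟩ := hc
    exact ⟨β - α, 2 * α - β, by rw [← h]; ring⟩
  refine quadraticChar_eq_one_of_primary hp hl hs hab ha hb hab4 hc' (z := z)
    (by linear_combination -h1) (by omega) (by omega) hw ?_ hw
  have hχy := jacobiSym_eq_one_of_dvd_of_mod (N := p) (m := y) (x := x) (y := v) (by omega) hy4
    ⟨-y, by linear_combination -h2⟩ hc.symm
  rw [← quadraticChar_intCast] at hχy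
  have hcast := congrArg (Int.cast : ℤ → ZMod p) h2
  push_cast at hcast
  rw [ZMod.natCast_self, zero_mul] at hcast
  have hxy : ((x : ZMod p) - y) * (x + y) = 0 := by linear_combination hcast
  have h1w : 1 + w ≠ 0 := by
    intro h0
    exact one_sub_ne_zero (w := -w) (by rw [neg_sq, hw]) (by linear_combination h0)
  rw [← hχy]
  push_cast
  rcases mul_eq_zero.1 hxy with g | g
  · exact quadraticChar_eq_of_sq_mul h1w (by linear_combination (1 + w) * g - (y : ZMod p) * hw)
  · congr 1
    linear_combination (1 + w) * g

/-- The pair of equations `y² - 2x² = -p z²`, `x² - y² = l v²`. -/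
theorem quadraticChar_of_pair_two (hp : p % 8 = 7) (hl : l % 8 = 7)
    (hs : legendreSym l p = 1) {a b : ℤ} (hab : a ^ 2 - 2 * b ^ 2 = -l)
    (hb : b % 2 = 0) (hab4 : (a + b) % 4 = 1) {x y z v : ℤ} (hc : IsCoprime x y)
    (h1 : y ^ 2 - 2 * x ^ 2 = -p * z ^ 2) (h2 : x ^ 2 - y ^ 2 = l * v ^ 2) (hx : x % 4 = 0)
    (hy : y % 2 = 1) {w : ZMod p} (hw : w ^ 2 = 2) : χ[p] (a + b * w) = 1 := by
  wlog hy4 : y % 4 = 1 generalizing y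
  · exact this (y := -y) hc.neg_right (by rw [← h1]; ring) (by rw [← h2]; ring) (by omega) (by omega)
  wlog hx0 : 0 ≤ x generalizing x
  · exact this (x := -x) (by omega) hc.neg_left (by rw [← h1]; ring) (by rw [← h2]; ring) (by linarith)
  have hl' := Nat.prime_iff_prime_int.1 (Fact.out : l.Prime)
  have hl0 : (0 : ℤ) < l := by exact_mod_cast (Fact.out : l.Prime).pos
  have hlt : |y| < |x| := by
    rw [← sq_lt_sq]
    have h3 := mul_nonneg hl0.le (sq_nonneg v)
    refine lt_of_le_of_ne (by linarith) fun h4 => ?_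
    rcases sq_eq_sq_iff_eq_or_eq_neg.1 h4 with h | h <;> omega
  rw [abs_of_nonneg hx0, abs_lt] at hlt
  have hxpos : 0 < x := by linarith
  -- If `l` divided `x + y` instead, the coprime factor `x - y` would be a square, but it is `3`
  -- modulo `4`.
  have hdvd : (l : ℤ) ∣ x - y := by
    rcases exists_factor_of_mul_eq (q := l) (F := x - y) (G := x + y) (K := v ^ 2)
      (by rw [← h2]; ring) with ⟨s, hs', -⟩ | ⟨s, hs', hsv⟩
    · exact Dvd.intro _ hs'.symm
    · exfalso
      have hcop : IsCoprime (x - y) (x + y) := by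
        have h3 : IsCoprime (x - y) 2 := int_odd_coprime_two (by omega)
        have h4 : IsCoprime (x - y) y := by
          have := hc.add_mul_left_left (-1)
          rwa [show x + y * -1 = x - y by ring] at this
        have := (h3.mul_right h4).add_mul_left_right 1
        rwa [show 2 * y + (x - y) * 1 = x + y by ring] at this
      rw [hs'] at hcop
      obtain ⟨⟨r, hr⟩, -⟩ := exists_sq_of_mul_eq_sq (by linarith)
        (pos_of_mul_pos_right (by rw [← hs']; linarith) hl0.le) hcop.of_mul_right_right hsv
      rcases Int.sq_mod_eight_cases r with ⟨x1, x2⟩ | ⟨x1, x2⟩ | ⟨x1, x2⟩ <;> omega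
  have hcab : IsCoprime a b := by
    refine isCoprime_of_prime_dvd (by omega) fun q hq g1 g2 => ?_
    obtain ⟨a', rfl⟩ := g1
    obtain ⟨b', rfl⟩ := g2
    have : (l : ℤ) = q * (q * (2 * b' ^ 2 - a' ^ 2)) := by linear_combination hab
    rcases hl'.irreducible.isUnit_or_isUnit this with hu | hu
    · exact hq.not_isUnit hu
    · exact hq.not_isUnit (isUnit_of_mul_isUnit_left hu)
  -- Put `D = ax - by`. The product of `a + b√2` and `y - x√2` has norm `plz²`, so `(ay - 2bx)² -
  -- 2D² = plz²` and `(D/pl) = 1`. Computing `(D/l)` here yields `(D/p)`, which is the wanted symbol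
  -- times the character of `x`.
  have hDl : jacobiSym (a * x - b * y) l = 1 := by
    obtain ⟨-, u, hu, hau⟩ := exists_root_of_sq_sub_two_sq (l := l) (k := -1) hcab
      (by rw [hab]; ring)
    obtain ⟨g1, g2⟩ := quadraticChar_one_sub_mul_sign hl (z := 1) hcab (by rw [hab]; ring) hab4 hau
    have g3 : χ[l] (1 + u) * χ[l] (1 - u) = -1 := by
      rw [← map_mul, show (1 + u) * (1 - u) = -1 by linear_combination -hu,
        quadraticChar_neg_mod_four' (by omega), map_one]
    have g4 := jacobiSym_eq_one_of_dvd_of_mod (N := l) (m := y) (x := x) (y := v) (by omega) hy4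
      ⟨-y, by linear_combination -h2⟩ hc.symm
    rw [← quadraticChar_intCast] at g4 ⊢
    have hxy : (x : ZMod l) = y := by
      have := (ZMod.intCast_zmod_eq_zero_iff_dvd (x - y) l).2 hdvd
      push_cast at this
      linear_combination this
    have e : ((a * x - b * y : ℤ) : ZMod l) = -(b * (y * (1 + u))) := by
      push_cast; linear_combination a * hxy + y * hau
    rw [e, quadraticChar_neg_mod_four' (by omega), map_mul, map_mul, g1, g4]
    rcases Int.mul_eq_one_iff_eq_one_or_neg_one.1 g2 with ⟨e1, e2⟩ | ⟨e1, e2⟩ <;>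
      rw [e1] at g3 <;> rw [e2] <;> linarith
  have hlD : ¬ (l : ℤ) ∣ a * x - b * y := by
    intro hd
    rw [← quadraticChar_intCast, (ZMod.intCast_zmod_eq_zero_iff_dvd _ l).2 hd,
      quadraticChar_zero] at hDl
    exact zero_ne_one hDl
  have hDp : jacobiSym (a * x - b * y) p = 1 := by
    have : NeZero p := ⟨(Fact.out : p.Prime).ne_zero⟩
    have : NeZero l := ⟨(Fact.out : l.Prime).ne_zero⟩
    have hD := jacobiSym_eq_one_of_dvd' (N := p * l) (m := a * x - b * y) (y := z)
      (x := a * y - 2 * b * x) (by rw [Nat.mul_mod, hp, hl]) (fun h0 => hlD (h0 ▸ dvd_zero _))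
      ⟨-2 * (a * x - b * y), by
        push_cast; linear_combination (p * z ^ 2) * hab - (a ^ 2 - 2 * b ^ 2) * h1⟩ (by
        have h3 : IsCoprime (a * x - b * y) l := (Nat.Prime.int_coprime_iff.2 hlD).symm
        refine isCoprime_of_prime_dvd (fun g => hlD (g.1 ▸ dvd_zero _)) fun q hq g1 g2 => ?_
        have e1 : q ∣ l * y := by
          rw [show (l : ℤ) * y = -(a * (a * y - 2 * b * x) + 2 * b * (a * x - b * y)) by
            linear_combination y * hab]
          exact (dvd_neg).2 (dvd_add (g2.mul_left _) (g1.mul_left _))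
        have e2 : q ∣ l * x := by
          rw [show (l : ℤ) * x = -(b * (a * y - 2 * b * x) + a * (a * x - b * y)) by
            linear_combination x * hab]
          exact (dvd_neg).2 (dvd_add (g2.mul_left _) (g1.mul_left _))
        have hql := h3.of_isCoprime_of_dvd_left g1
        exact hq.not_isUnit (hc.isUnit_of_dvd' (hql.dvd_of_dvd_mul_left e2)
          (hql.dvd_of_dvd_mul_left e1)))
    rw [jacobiSym.mul_right, hDl, mul_one] at hD
    exact hD
  obtain ⟨-, u, hu, hyu⟩ := exists_root_of_sq_sub_two_sq (l := p) (k := -z ^ 2) hc.symm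
    (by rw [h1]; ring)
  refine quadraticChar_eq_one_of_conj hp hl hs hab (Or.inl rfl) hu ?_ hw
  have hχx := jacobiSym_eq_sign_of_dvd hp (m := x) (x := y) (y := z) hxpos
    ⟨2 * x, by linear_combination h1⟩ hc
  rw [← quadraticChar_intCast] at hχx hDp
  rw [← hDp, show ((a * x - b * y : ℤ) : ZMod p) = (a + b * u) * x by
    push_cast; linear_combination -b * hyu, map_mul, hχx, mul_one]

end

section

variable {p l : ℕ} [Fact p.Prime] [Fact l.Prime]

/-! ### The torsors `𝒯^(ψ)(p)` and `𝒯^(ψ)(l)` -/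

theorem isCoprime_of_sub_add {F G u v : ℤ} (h1 : F + G = u) (h2 : F - G = v) (h : IsCoprime u v) :
    IsCoprime F G := by
  obtain ⟨α, β, h⟩ := h
  exact ⟨α + β, α - β, by rw [← h, ← h1, ← h2]; ring⟩

theorem isCoprime_of_sub_add_two {F G u v : ℤ} (h1 : F + G = 2 * u) (h2 : F - G = 2 * v)
    (h : IsCoprime u v) (hF : F % 2 = 1) : IsCoprime F G := by
  have h3 : IsCoprime F 2 := int_odd_coprime_two hF
  have h4 : IsCoprime (u + v) u := by
    have := h.symm.add_mul_left_left 1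
    rwa [show v + u * 1 = u + v by ring] at this
  have h5 : F = u + v := by linarith
  rw [← h5] at h4
  have := (h3.mul_right h4).add_mul_left_right (-1)
  rwa [show 2 * u + F * -1 = G by linarith] at this

/-- `l ∣ M` would make `-p` a residue modulo `l`. Otherwise `(M² + le²)(M² - le²) = pn²` has coprime
factors, after halving when `M` is odd, and residues modulo powers of `2` force `p` into the first.
`M` even gives the second system, `M` odd the first. -/
theorem quadraticChar_of_psi_left (hp : p % 8 = 7) (hl : l % 8 = 7) (hpl : p ≠ l)
    (hs : legendreSym l p = 1) {a b : ℤ} (hab : a ^ 2 - 2 * b ^ 2 = -l) (ha : a % 2 = 1)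
    (hb : b % 2 = 0) (hab4 : (a + b) % 4 = 1) {M e n : ℤ} (hc : IsCoprime M e)
    (h : p * n ^ 2 = M ^ 4 - l ^ 2 * e ^ 4)
    {w : ZMod p} (hw : w ^ 2 = 2) : χ[p] (a + b * w) = 1 := by
  have hl' := Nat.prime_iff_prime_int.1 (Fact.out : l.Prime)
  have hp0 : (0 : ℤ) < p := by exact_mod_cast (Fact.out : p.Prime).pos
  have hlM : ¬ (l : ℤ) ∣ M := by
    intro hd
    have he : ¬ (l : ℤ) ∣ e := fun he => hl'.not_isUnit (hc.isUnit_of_dvd' hd he)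
    obtain ⟨M, rfl⟩ := hd
    obtain ⟨n, rfl⟩ := dvd_of_mul_sq_dvd hpl (n := n) (k := l ^ 3 * M ^ 4 - l * e ^ 4)
      (by rw [h]; ring)
    have h' : p * n ^ 2 = l ^ 2 * M ^ 4 - e ^ 4 :=
      mul_left_cancel₀ (pow_ne_zero 2 hl'.ne_zero) (by linear_combination h)
    have h1 := congrArg (Int.cast : ℤ → ZMod l) h'
    push_cast at h1
    rw [ZMod.natCast_self] at h1
    have he0 := intCast_ne_zero_iff.2 he
    have h2 : (p : ZMod l) * n ^ 2 = -((e : ZMod l) ^ 2) ^ 2 := by linear_combination h1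
    have hn0 : (n : ZMod l) ≠ 0 := by
      intro h0; rw [h0] at h2
      exact pow_ne_zero 2 (pow_ne_zero 2 he0) (by linear_combination h2)
    have h3 := congrArg (χ[l]) h2
    rw [map_mul, quadraticChar_sq_one' hn0, quadraticChar_neg_mod_four' (by omega),
      quadraticChar_sq_one' (pow_ne_zero 2 he0),
      (quadraticChar_natCast_of_legendreSym hp hl hs).1] at h3
    norm_num at h3
  have hcle : IsCoprime (M ^ 2) (l * e ^ 2) :=
    ((Nat.Prime.int_coprime_iff.2 hlM).symm.mul_right hc.pow_right).pow_left
  have hprod : (M ^ 2 + l * e ^ 2) * (M ^ 2 - l * e ^ 2) = p * n ^ 2 := by rw [h]; ring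
  have hle := Int.mul_mod_eight (p := l) (y := e ^ 2) (r := 7) (by omega)
  have hM8 := Int.sq_mod_eight_cases M
  have he8 := Int.sq_mod_eight_cases e
  have hl0 : (0 : ℤ) < l := by exact_mod_cast (Fact.out : l.Prime).pos
  have hF0 : 0 ≤ M ^ 2 + l * e ^ 2 := by positivity
  have hpn : 0 ≤ p * n ^ 2 := by positivity
  have hodd := hc.odd_or_odd
  rcases (show M % 2 = 0 ∨ M % 2 = 1 by omega) with hM | hM
  · have he := hodd.resolve_left (by omega)
    rw [Int.odd_sq_mod_eight he] at hle
    have hF : 0 < M ^ 2 + l * e ^ 2 := by omega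
    have hG : 0 < M ^ 2 - l * e ^ 2 := by
      have : M ^ 2 - l * e ^ 2 ≠ 0 := by omega
      exact lt_of_le_of_ne (nonneg_of_mul_nonneg_right (hprod ▸ hpn) hF) this.symm
    have hcop : IsCoprime (M ^ 2 + l * e ^ 2) (M ^ 2 - l * e ^ 2) :=
      isCoprime_of_sub_add_two (by ring) (by ring) hcle (by omega)
    rcases exists_factor_of_mul_eq hprod with ⟨F', hF', h1⟩ | ⟨G', hG', h1⟩
    · rw [hF'] at hcop hF
      obtain ⟨⟨r, rfl⟩, s, hs'⟩ := exists_sq_of_mul_eq_sq (pos_of_mul_pos_right hF hp0.le) hG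
        hcop.of_mul_left_right h1
      have hpr := Int.mul_mod_eight (p := p) (y := r ^ 2) (r := 7) (by omega)
      have hr8 := Int.sq_mod_eight_cases r
      have hs8 := Int.sq_mod_eight_cases s
      refine quadraticChar_of_pair_two hp hl hs hab hb hab4 (x := M) (y := s) (z := r) (v := e) ?_
        (by linear_combination -hs' - hF') (by linear_combination hs') ?_ ?_ hw
      · rw [← IsCoprime.pow_right_iff (m := 2) (by norm_num), ← IsCoprime.pow_left_iff (m := 2) (by norm_num), ← hs']
        have := hcle.neg_right.add_mul_left_right 1
        rwa [show -(l * e ^ 2) + M ^ 2 * 1 = M ^ 2 - l * e ^ 2 by ring] at this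
      · omega
      · omega
    · rw [hG'] at hcop hG
      obtain ⟨⟨r, hr⟩, -⟩ := exists_sq_of_mul_eq_sq hF (pos_of_mul_pos_right hG hp0.le)
        hcop.of_mul_right_right h1
      have hr8 := Int.sq_mod_eight_cases r
      omega
  · have hM1 := Int.odd_sq_mod_eight hM
    have hn8 := Int.sq_mod_eight_cases n
    have hpn8 := Int.mul_mod_eight (p := p) (y := n ^ 2) (r := 7) (by omega)
    have he : e % 2 = 1 := by
      rcases (show e % 2 = 0 ∨ e % 2 = 1 by omega) with he | he
      · exfalso
        have h4 : (M ^ 4) % 8 = 1 := by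
          rw [show M ^ 4 = (M ^ 2) ^ 2 by ring]; exact Int.odd_sq_mod_eight (by omega)
        obtain ⟨f, rfl⟩ : (2 : ℤ) ∣ e := by omega
        rw [show M ^ 4 - (l : ℤ) ^ 2 * (2 * f) ^ 4 = M ^ 4 - 16 * (l ^ 2 * f ^ 4) by ring] at h
        omega
      · exact he
    rw [Int.odd_sq_mod_eight he] at hle
    obtain ⟨F, hF⟩ : (2 : ℤ) ∣ M ^ 2 + l * e ^ 2 := by omega
    obtain ⟨G, hG⟩ : (2 : ℤ) ∣ M ^ 2 - l * e ^ 2 := by omega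
    obtain ⟨n, rfl⟩ := even_of_mul_sq_even (c := p) (n := n) (k := 2 * (F * G)) (by omega)
      (by rw [← hprod, hF, hG]; ring)
    have hFG : F * G = p * n ^ 2 := by rw [hF, hG] at hprod; linarith
    have hF' : 0 < F := by
      have h0 : M ≠ 0 := by omega
      have : 0 < M ^ 2 + l * e ^ 2 := by positivity
      linarith
    have hG' : 0 < G := by
      have : G ≠ 0 := by omega
      have h2 : 0 ≤ F * G := by rw [hFG]; positivity
      exact lt_of_le_of_ne (nonneg_of_mul_nonneg_right h2 hF') this.symm
    have hcop : IsCoprime F G := isCoprime_of_sub_add (by linarith) (by linarith) hcle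
    rcases exists_factor_of_mul_eq hFG with ⟨F, rfl, h1⟩ | ⟨G, rfl, h1⟩
    · obtain ⟨⟨r, rfl⟩, s, rfl⟩ := exists_sq_of_mul_eq_sq (pos_of_mul_pos_right hF' hp0.le) hG'
        hcop.of_mul_left_right h1
      have hs8 := Int.sq_mod_eight_cases s
      refine quadraticChar_of_pair_one hp hl hs hab ha hb hab4 (x := M) (y := s) (z := e) (v := r) ?_
        (by linear_combination hG) (by linarith) hM (by omega) hw
      rw [← IsCoprime.pow_right_iff (m := 2) (by norm_num), ← IsCoprime.pow_left_iff (m := 2) (by norm_num)]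
      have h5 := hcop.of_mul_left_right.symm
      have h6 := hcop.symm.add_mul_left_right 1
      rwa [show p * r ^ 2 + s ^ 2 * 1 = M ^ 2 by linarith, isCoprime_comm] at h6
    · obtain ⟨-, s, rfl⟩ := exists_sq_of_mul_eq_sq hF' (pos_of_mul_pos_right hG' hp0.le)
        hcop.of_mul_right_right h1
      have hs8 := Int.sq_mod_eight_cases s
      have := Int.mul_mod_eight (p := p) (y := s ^ 2) (r := 7) (by omega)
      omega

/-- As `l` is a nonresidue modulo `p`, `p` must divide `M`. After dividing by `p²`, factor `(pM² +
e²)(pM² - e²) = ln²`; here `l` falls into the second factor. -/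
theorem quadraticChar_of_psi_right (hp : p % 8 = 7) (hl : l % 8 = 7) (hpl : p ≠ l)
    (hs : legendreSym l p = 1) {a b : ℤ} (hab : a ^ 2 - 2 * b ^ 2 = -l) (ha : a % 2 = 1)
    (hb : b % 2 = 0) (hab4 : (a + b) % 4 = 1) {M e n : ℤ} (hc : IsCoprime M e)
    (h : l * n ^ 2 = M ^ 4 - p ^ 2 * e ^ 4)
    {w : ZMod p} (hw : w ^ 2 = 2) : χ[p] (a + b * w) = 1 := by
  have hp' := Nat.prime_iff_prime_int.1 (Fact.out : p.Prime)
  have hl0 : (0 : ℤ) < l := by exact_mod_cast (Fact.out : l.Prime).pos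
  have hp0 : (0 : ℤ) < p := by exact_mod_cast (Fact.out : p.Prime).pos
  have hpM : (p : ℤ) ∣ M := by
    by_contra hd
    have h1 := congrArg (Int.cast : ℤ → ZMod p) h
    push_cast at h1
    rw [ZMod.natCast_self] at h1
    have hM0 := intCast_ne_zero_iff.2 hd
    have h2 : (l : ZMod p) * n ^ 2 = ((M : ZMod p) ^ 2) ^ 2 := by linear_combination h1
    have hn0 : (n : ZMod p) ≠ 0 := by
      intro h0; rw [h0] at h2
      exact pow_ne_zero 2 (pow_ne_zero 2 hM0) (by linear_combination -h2)
    have h3 := congrArg (χ[p]) h2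
    rw [map_mul, quadraticChar_sq_one' hn0, quadraticChar_sq_one' (pow_ne_zero 2 hM0),
      (quadraticChar_natCast_of_legendreSym hp hl hs).2] at h3
    norm_num at h3
  have hpe : ¬ (p : ℤ) ∣ e := fun he => hp'.not_isUnit (hc.isUnit_of_dvd' hpM he)
  obtain ⟨M, rfl⟩ := hpM
  obtain ⟨n, rfl⟩ := dvd_of_mul_sq_dvd hpl.symm (n := n) (k := p ^ 3 * M ^ 4 - p * e ^ 4)
    (by rw [h]; ring)
  replace h : l * n ^ 2 = p ^ 2 * M ^ 4 - e ^ 4 :=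
    mul_left_cancel₀ (pow_ne_zero 2 hp'.ne_zero) (by linear_combination h)
  replace hc := hc.of_mul_left_right
  have hcpe : IsCoprime (p * M ^ 2) (e ^ 2) :=
    ((Nat.Prime.int_coprime_iff.2 hpe).mul_left hc.pow_left).pow_right
  have hprod : (p * M ^ 2 + e ^ 2) * (p * M ^ 2 - e ^ 2) = l * n ^ 2 := by rw [h]; ring
  have hpM := Int.mul_mod_eight (p := p) (y := M ^ 2) (r := 7) (by omega)
  have hM8 := Int.sq_mod_eight_cases M
  have hF0 : 0 ≤ p * M ^ 2 + e ^ 2 := by positivity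
  have hln : 0 ≤ l * n ^ 2 := by positivity
  have hodd := hc.odd_or_odd
  have he : e % 2 = 1 := by
    rcases (show e % 2 = 0 ∨ e % 2 = 1 by omega) with he | he
    · exfalso
      have hM := hodd.resolve_right (by omega)
      have h4 : ((p * M ^ 2) ^ 2) % 8 = 1 := Int.odd_sq_mod_eight (by omega)
      obtain ⟨f, rfl⟩ : (2 : ℤ) ∣ e := by omega
      rw [show (p : ℤ) ^ 2 * M ^ 4 - (2 * f) ^ 4 = (p * M ^ 2) ^ 2 - 16 * f ^ 4 by ring] at h
      have hn8 := Int.sq_mod_eight_cases n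
      have hln8 := Int.mul_mod_eight (p := l) (y := n ^ 2) (r := 7) (by omega)
      omega
    · exact he
  have he8 := Int.odd_sq_mod_eight he
  rcases (show M % 2 = 0 ∨ M % 2 = 1 by omega) with hM | hM
  · have hF : 0 < p * M ^ 2 + e ^ 2 := by omega
    have hG : 0 < p * M ^ 2 - e ^ 2 := by
      have : p * M ^ 2 - e ^ 2 ≠ 0 := by omega
      exact lt_of_le_of_ne (nonneg_of_mul_nonneg_right (hprod ▸ hln) hF) this.symm
    have hcop : IsCoprime (p * M ^ 2 + e ^ 2) (p * M ^ 2 - e ^ 2) :=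
      isCoprime_of_sub_add_two (by ring) (by ring) hcpe (by omega)
    rcases exists_factor_of_mul_eq hprod with ⟨F', hF', h1⟩ | ⟨G', hG', h1⟩
    · rw [hF'] at hcop hF
      obtain ⟨⟨r, rfl⟩, -⟩ := exists_sq_of_mul_eq_sq (pos_of_mul_pos_right hF hl0.le) hG
        hcop.of_mul_left_right h1
      have hr8 := Int.sq_mod_eight_cases r
      have := Int.mul_mod_eight (p := l) (y := r ^ 2) (r := 7) (by omega)
      omega
    · rw [hG'] at hcop hG
      obtain ⟨⟨r, hr⟩, s, rfl⟩ := exists_sq_of_mul_eq_sq hF (pos_of_mul_pos_right hG hl0.le)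
        hcop.of_mul_right_right h1
      have hr8 := Int.sq_mod_eight_cases r
      refine quadraticChar_of_pair_one hp hl hs hab ha hb hab4 (x := r) (y := e) (z := s) (v := M) ?_
        (by linear_combination hG' - hr) (by linear_combination -hr) (by omega) he hw
      rw [← IsCoprime.pow_right_iff (m := 2) (by norm_num), ← IsCoprime.pow_left_iff (m := 2) (by norm_num), ← hr]
      have := hcpe.add_mul_left_left 1
      rwa [mul_one] at this
  · rw [Int.odd_sq_mod_eight hM] at hpM
    obtain ⟨F, hF⟩ : (2 : ℤ) ∣ p * M ^ 2 + e ^ 2 := by omega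
    obtain ⟨G, hG⟩ : (2 : ℤ) ∣ p * M ^ 2 - e ^ 2 := by omega
    obtain ⟨n, rfl⟩ := even_of_mul_sq_even (c := l) (n := n) (k := 2 * (F * G)) (by omega)
      (by rw [← hprod, hF, hG]; ring)
    have hFG : F * G = l * n ^ 2 := by rw [hF, hG] at hprod; linarith
    have hF' : 0 < F := by
      have h0 : e ≠ 0 := by omega
      have : 0 < p * M ^ 2 + e ^ 2 := by positivity
      linarith
    have hG' : 0 < G := by
      have : G ≠ 0 := by omega
      have h2 : 0 ≤ F * G := by rw [hFG]; positivity
      exact lt_of_le_of_ne (nonneg_of_mul_nonneg_right h2 hF') this.symm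
    have hcop : IsCoprime F G := isCoprime_of_sub_add (by linarith) (by linarith) hcpe
    rcases exists_factor_of_mul_eq hFG with ⟨F, rfl, h1⟩ | ⟨G, rfl, h1⟩
    · obtain ⟨-, s, rfl⟩ := exists_sq_of_mul_eq_sq (pos_of_mul_pos_right hF' hl0.le) hG'
        hcop.of_mul_left_right h1
      have hs8 := Int.sq_mod_eight_cases s
      omega
    · obtain ⟨⟨r, rfl⟩, s, rfl⟩ := exists_sq_of_mul_eq_sq hF' (pos_of_mul_pos_right hG' hl0.le)
        hcop.of_mul_right_right h1
      have hr8 := Int.sq_mod_eight_cases r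
      have hs8 := Int.sq_mod_eight_cases s
      have := Int.mul_mod_eight (p := l) (y := s ^ 2) (r := 7) (by omega)
      refine quadraticChar_of_pair_two hp hl hs hab hb hab4 (x := r) (y := e) (z := M) (v := s) ?_
        (by linear_combination hF) (by linarith) (by omega) he hw
      rw [← IsCoprime.pow_right_iff (m := 2) (by norm_num), ← IsCoprime.pow_left_iff (m := 2) (by norm_num)]
      have h6 := hcop.neg_right.add_mul_left_right 1
      rwa [show -(l * s ^ 2) + r ^ 2 * 1 = e ^ 2 by linarith] at h6

/-! ### The torsor `𝒯^(φ)(2)` -/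

/-- With `P = (U + V)/2`, `Q = (U - V)/2` one has `P² + Q² = n²`. In the Pythagorean parameters `m`,
`k`, both `P ± Q` are forms `m² - k² ± 2mk` up to sign, that is, norms from `ℤ[√2]` after completing
the square. -/
theorem exists_pair_of_two_mul_sq {U V n : ℤ} (h : 2 * n ^ 2 = U ^ 2 + V ^ 2) (hc : IsCoprime U V) :
    ∃ x y : ℤ, IsCoprime x y ∧ x % 2 = 1 ∧ y % 2 = 0 ∧
      (U = (x + 2 * y) ^ 2 - 2 * y ^ 2 ∨ U = -((x + 2 * y) ^ 2 - 2 * y ^ 2)) ∧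
      (V = x ^ 2 - 2 * y ^ 2 ∨ V = -(x ^ 2 - 2 * y ^ 2)) := by
  have hodd : U % 2 = 1 ∧ V % 2 = 1 := by
    have := hc.odd_or_odd
    rcases Int.sq_mod_eight_cases U with ⟨x1, x2⟩ | ⟨x1, x2⟩ | ⟨x1, x2⟩ <;>
    rcases Int.sq_mod_eight_cases V with ⟨y1, y2⟩ | ⟨y1, y2⟩ | ⟨y1, y2⟩ <;> omega
  obtain ⟨P, hP⟩ : (2 : ℤ) ∣ U + V := by omega
  obtain ⟨Q, hQ⟩ : (2 : ℤ) ∣ U - V := by omega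
  obtain rfl : U = P + Q := by linarith
  obtain rfl : V = P - Q := by linarith
  have hPQ : IsCoprime P Q := by
    obtain ⟨α, β, h⟩ := hc
    exact ⟨α + β, α - β, by rw [← h]; ring⟩
  have hsq : P ^ 2 + Q ^ 2 = n ^ 2 := by linarith
  have main : ∃ m k : ℤ, (m % 2 = 0 ∧ k % 2 = 1 ∨ m % 2 = 1 ∧ k % 2 = 0) ∧ IsCoprime m k ∧
      P + Q = m ^ 2 - k ^ 2 + 2 * m * k ∧
      (P - Q = m ^ 2 - k ^ 2 - 2 * m * k ∨ P - Q = -(m ^ 2 - k ^ 2 - 2 * m * k)) := by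
    have hcop : ∀ {m k : ℤ}, IsCoprime (m ^ 2 - k ^ 2) (2 * m * k) → IsCoprime m k := by
      rintro m k ⟨α, β, h⟩
      exact ⟨α * m + 2 * β * k, -(α * k), by rw [← h]; ring⟩
    rcases (show P % 2 = 1 ∨ P % 2 = 0 by omega) with hp | hp
    · obtain ⟨m, k, rfl, rfl, hmk⟩ := exists_eq_sq_of_sq_add_sq hsq hPQ hp
      exact ⟨m, k, hmk, hcop hPQ, rfl, Or.inl rfl⟩
    · obtain ⟨m, k, rfl, rfl, hmk⟩ := exists_eq_sq_of_sq_add_sq (c := Q) (d := P) (n := n)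
        (by rw [← hsq]; ring) hPQ.symm (by omega)
      exact ⟨m, k, hmk, hcop hPQ.symm, by ring, Or.inr (by ring)⟩
  obtain ⟨m, k, hmk | hmk, hcop, h1, h2⟩ := main
  · refine ⟨-(m + k), m, ?_, by omega, by omega, Or.inr (by rw [h1]; ring), ?_⟩
    · have := (hcop.symm.add_mul_left_left 1).neg_left
      rwa [show k + m * 1 = m + k by ring] at this
    · rcases h2 with h2 | h2
      · exact Or.inr (by rw [h2]; ring)
      · exact Or.inl (by rw [h2]; ring)
  · refine ⟨m - k, k, ?_, by omega, by omega, Or.inl (by rw [h1]; ring), ?_⟩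
    · have := hcop.add_mul_left_left (-1)
      rwa [show m + k * -1 = m - k by ring] at this
    · rcases h2 with h2 | h2
      · exact Or.inl (by rw [h2]; ring)
      · exact Or.inr (by rw [h2]; ring)

theorem sq_sub_two_sq_mod_eight {x y : ℤ} (hx : x % 2 = 1) (hy : y % 2 = 0) :
    (x ^ 2 - 2 * y ^ 2) % 8 = 1 := by
  have := Int.odd_sq_mod_eight hx
  rcases Int.sq_mod_eight_cases y with ⟨x1, x2⟩ | ⟨x1, x2⟩ | ⟨x1, x2⟩ <;> omega

/-- Here `M² = (x + 2y)² - 2y²`, so `(x + 2y) + y√2` is `±(r + s√2)²`, and `x + y√2` of norm `ple²`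
is a conjugate of `Λ` times a primary `c + d√2` of norm `-pe²`. Modulo `p`, explicit squares in `r`,
`s` show that `1 - u` and `y` are residues, hence so is `d`, and `y = (a - b'u)d`. -/
theorem quadraticChar_of_phi_two_coprime (hp : p % 8 = 7) (hl : l % 8 = 7)
    (hs : legendreSym l p = 1) {a b : ℤ} (hab : a ^ 2 - 2 * b ^ 2 = -l) (ha : a % 2 = 1)
    (hb : b % 2 = 0) {M e n : ℤ} (hab4 : (a + b) % 4 = 1)
    (hc : IsCoprime (M ^ 2) (p * l * e ^ 2)) (h : 2 * n ^ 2 = M ^ 4 + p ^ 2 * l ^ 2 * e ^ 4)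
    {w : ZMod p} (hw : w ^ 2 = 2) : χ[p] (a + b * w) = 1 := by
  obtain ⟨x, y, hxy, hx, hy, hU, hV⟩ := exists_pair_of_two_mul_sq (n := n)
    (by rw [h]; ring) hc
  have hpl1 : ((p : ℤ) * l) % 8 = 1 := by
    have := Int.mul_mod_eight (p := p) (y := l) (r := 7) (by omega); omega
  have hple := Int.mul_mod_eight (y := e ^ 2) hpl1
  have hN1 := sq_sub_two_sq_mod_eight hx hy
  have hN2 := sq_sub_two_sq_mod_eight (x := x + 2 * y) (by omega) hy
  have hM8 := Int.sq_mod_eight_cases M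
  have he8 := Int.sq_mod_eight_cases e
  replace hU := hU.resolve_right (by omega)
  replace hV := hV.resolve_right (by omega)
  have hcX : IsCoprime (x + 2 * y) y := by
    have := hxy.add_mul_left_left 2
    rwa [show x + y * 2 = x + 2 * y by ring] at this
  obtain ⟨r, s, hxr, hys⟩ := exists_eq_sq_add_two_sq hU.symm hcX (by omega)
  wlog hxr' : x + 2 * y = r ^ 2 + 2 * s ^ 2 generalizing x y s
  · replace hxr := hxr.resolve_left hxr'
    exact this (-x) (-y) hxy.neg_left.neg_right (by omega) (by omega) (by rw [← hN1]; congr 1; ring)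
      (by rw [← hN2]; congr 1; ring) (by rw [hU]; ring) (by rw [hV]; ring)
      (by have := hcX.neg_left.neg_right; rwa [show -(x + 2 * y) = -x + 2 * -y by ring] at this)
      (-s) (Or.inl (by linear_combination -hxr)) (by rw [hys]; ring) (by linear_combination -hxr)
  clear hxr
  have hr : r % 2 = 1 := by
    rcases Int.sq_mod_eight_cases r with ⟨x1, x2⟩ | ⟨x1, x2⟩ | ⟨x1, x2⟩ <;> omega
  have hxy4 : (x + y) % 4 = 1 := by
    obtain ⟨ρ, rfl⟩ : ∃ ρ, r = 2 * ρ + 1 := ⟨r / 2, by omega⟩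
    obtain ⟨k, hk⟩ : ∃ k, s ^ 2 - s = 2 * k := by
      obtain ⟨k, hk⟩ := Int.even_mul_pred_self s; exact ⟨k, by linarith⟩
    have : x + y = 1 + 4 * (ρ ^ 2 + ρ + k - ρ * s) := by
      linear_combination hxr' - hys + 2 * hk
    omega
  obtain ⟨b', c, d, hb', hx', hy', hcd⟩ := exists_compose_sq_sub_two_sq (by omega) hab
    (k := p * e ^ 2) (by rw [← hV]; ring)
  have hb2 : b' % 2 = 0 := by omega
  have hcop := coprime_of_compose hx' hy' hxy
  obtain ⟨hc2, hd2⟩ := odd_of_compose ha hb2 hx hy hx' hy'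
  have hcd4 := add_mod_four_of_mul ha hb2 (by omega) hc2 hd2 hx' hy' hxy4
  obtain ⟨hd0, u, hu, hcu⟩ := exists_root_of_sq_sub_two_sq (l := p) (k := -e ^ 2) hcop
    (by rw [hcd]; ring)
  obtain ⟨g1, g2⟩ := quadraticChar_one_sub_mul_sign hp hcop (z := e) (by rw [hcd]; ring) hcd4 hcu
  have h2 : (2 : ZMod p) ≠ 0 := two_ne_zero_of_mod (by omega)
  have hx1 := congrArg (Int.cast : ℤ → ZMod p) hx'
  have hy1 := congrArg (Int.cast : ℤ → ZMod p) hy'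
  have hx2 := congrArg (Int.cast : ℤ → ZMod p) hxr'
  have hy2 := congrArg (Int.cast : ℤ → ZMod p) hys
  push_cast at hx1 hy1 hx2 hy2
  have hxyu : (x : ZMod p) + y * u = 0 := by
    linear_combination hx1 + u * hy1 + (a + b' * u) * hcu - b' * d * hu
  have hy0 : (y : ZMod p) ≠ 0 := (exists_root_of_sq_sub_two_sq (l := p) (k := l * e ^ 2) hxy
    (by rw [← hV]; ring)).1
  have hs0 : (s : ZMod p) ≠ 0 := by
    intro h0; rw [h0, mul_zero] at hy2; exact hy0 hy2
  have e1 : ((r : ZMod p) - (2 - u) * s) ^ 2 = (1 - u) * (2 * s) ^ 2 := by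
    linear_combination hxyu - hx2 + (2 - u) * hy2 + (s : ZMod p) ^ 2 * hu
  have e2 : ((r : ZMod p) + u * s) ^ 2 = 2 * y := by
    linear_combination hxyu - hx2 - u * hy2 + (s : ZMod p) ^ 2 * hu
  have key : ∀ {t v : ZMod p}, t ^ 2 = v → v ≠ 0 → χ[p] v = 1 := by
    intro t v ht hv
    rw [← ht]; apply quadraticChar_sq_one'
    rintro rfl; exact hv (by rw [← ht]; ring)
  have f1 := key e1 (mul_ne_zero (one_sub_ne_zero hu) (pow_ne_zero 2 (mul_ne_zero h2 hs0)))
  have f2 := key e2 (mul_ne_zero h2 hy0)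
  rw [map_mul, quadraticChar_sq_one' (mul_ne_zero h2 hs0), mul_one] at f1
  rw [map_mul, quadraticChar_two_mod_eight (Or.inr hp), one_mul] at f2
  rw [f1, one_mul] at g2
  have e3 : (y : ZMod p) = (a + (-b' : ℤ) * u) * d := by
    have hu0 : (2 : ZMod p) * u ≠ 0 := mul_ne_zero h2 (by rintro rfl; apply h2; rw [← hu]; ring)
    apply mul_left_cancel₀ hu0
    push_cast
    linear_combination hxyu - hx1 + u * hy1 - (a - b' * u) * hcu + b' * d * hu
  refine quadraticChar_eq_one_of_conj hp hl hs hab (b' := -b') (by omega) hu ?_ hw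
  rw [e3, map_mul, g1, g2, mul_one] at f2
  exact f2

/-- Modulo `8` both norms carry a minus sign, so `(x + 2y) + y√2` has norm `-lM²` and can stand in
for `Λ`. At a root of `x + yu` modulo `p` it equals `2y`, whose character is `1` once `y > 0`; that
positivity comes from working modulo `l`. -/
theorem quadraticChar_of_phi_two_mixed (hp : p % 8 = 7) (hl : l % 8 = 7)
    (hs : legendreSym l p = 1) {a b : ℤ} (hab : a ^ 2 - 2 * b ^ 2 = -l) (ha : a % 2 = 1)
    (hb : b % 2 = 0) {M e n : ℤ} (hab4 : (a + b) % 4 = 1)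
    (hc : IsCoprime (l * M ^ 2) (p * e ^ 2)) (h : 2 * n ^ 2 = l ^ 2 * M ^ 4 + p ^ 2 * e ^ 4)
    {w : ZMod p} (hw : w ^ 2 = 2) : χ[p] (a + b * w) = 1 := by
  obtain ⟨x, y, hxy, hx, hy, hU, hV⟩ := exists_pair_of_two_mul_sq (n := n)
    (by rw [h]; ring) hc
  have hlM := Int.mul_mod_eight (p := l) (y := M ^ 2) (r := 7) (by omega)
  have hpe := Int.mul_mod_eight (p := p) (y := e ^ 2) (r := 7) (by omega)
  have hN1 := sq_sub_two_sq_mod_eight hx hy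
  have hN2 := sq_sub_two_sq_mod_eight (x := x + 2 * y) (by omega) hy
  have hM8 := Int.sq_mod_eight_cases M
  have he8 := Int.sq_mod_eight_cases e
  replace hU := hU.resolve_left (by omega)
  replace hV := hV.resolve_left (by omega)
  clear hN1 hN2
  wlog hxy4 : (x + y) % 4 = 1 generalizing x y
  · exact this (-x) (-y) hxy.neg_left.neg_right (by omega) (by omega)
      (by rw [hU]; ring) (by rw [hV]; ring) (by omega)
  have hcX : IsCoprime (x + 2 * y) y := by
    have := hxy.add_mul_left_left 2
    rwa [show x + y * 2 = x + 2 * y by ring] at this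
  have hy0 : 0 < y := by
    obtain ⟨hy0, u, hu, hcu⟩ := exists_root_of_sq_sub_two_sq (l := l) (k := -M ^ 2) hcX
      (by linear_combination hU)
    obtain ⟨-, g2⟩ := quadraticChar_one_sub_mul_sign hl hcX (z := M) (by linear_combination hU)
      (by omega) hcu
    have hV' := congrArg (Int.cast : ℤ → ZMod l) hV
    push_cast at hV' hcu
    have h2 : (2 : ZMod l) ≠ 0 := two_ne_zero_of_mod (by omega)
    have e1 : (p : ZMod l) * e ^ 2 * (1 - u) = (2 * y) ^ 2 := by
      linear_combination (1 - u) * hV' - (1 - u) * (x - (2 + u) * y) * hcu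
        + (u + 3) * y ^ 2 * hu
    have hne : (p : ZMod l) * e ^ 2 * (1 - u) ≠ 0 := by
      rw [e1]; exact pow_ne_zero 2 (mul_ne_zero h2 hy0)
    have he0 : (e : ZMod l) ≠ 0 := by
      rintro h0; rw [h0] at hne; apply hne; ring
    have g3 := congrArg (χ[l]) e1
    rw [map_mul, map_mul, (quadraticChar_natCast_of_legendreSym hp hl hs).1,
      quadraticChar_sq_one' he0, quadraticChar_sq_one' (mul_ne_zero h2 hy0)] at g3
    rw [show χ[l] (1 - u) = 1 by linarith, one_mul] at g2
    exact Int.sign_eq_one_iff_pos.1 g2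
  obtain ⟨-, u, hu, hcu⟩ := exists_root_of_sq_sub_two_sq (l := p) (k := -e ^ 2) hxy
    (by linear_combination hV)
  refine quadraticChar_eq_one_of_primary hp hl hs hab ha hb hab4 hcX (z := M)
    (by linear_combination hU) hy (by omega) hu ?_ hw
  have hχ := jacobiSym_eq_sign_of_dvd hp (m := y) (x := x) (y := e) hy0
    ⟨2 * y, by linear_combination hV⟩ hxy.symm
  rw [← quadraticChar_intCast] at hχ
  rw [show ((x + 2 * y : ℤ) : ZMod p) + y * u = 2 * y by push_cast; linear_combination hcu, map_mul,
    hχ, quadraticChar_two_mod_eight (Or.inr hp), mul_one]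

/-- The four cases record which of `p`, `l` divide `M`. Cancelling their squares moves the
corresponding factors from the `e` term to the `M` term. -/
theorem quadraticChar_of_phi_two (hp : p % 8 = 7) (hl : l % 8 = 7) (hpl : p ≠ l)
    (hs : legendreSym l p = 1) {a b : ℤ} (hab : a ^ 2 - 2 * b ^ 2 = -l) (ha : a % 2 = 1)
    (hb : b % 2 = 0) {M e n : ℤ} (hab4 : (a + b) % 4 = 1)
    (hc : IsCoprime M e) (h : 2 * n ^ 2 = M ^ 4 + p ^ 2 * l ^ 2 * e ^ 4)
    {w : ZMod p} (hw : w ^ 2 = 2) : χ[p] (a + b * w) = 1 := by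
  have hp' := Nat.prime_iff_prime_int.1 (Fact.out : p.Prime)
  have hl' := Nat.prime_iff_prime_int.1 (Fact.out : l.Prime)
  have hpl' : IsCoprime (p : ℤ) l :=
    Nat.isCoprime_iff_coprime.2 ((Nat.coprime_primes Fact.out Fact.out).2 hpl)
  have hnd : ∀ {q : ℕ} [Fact q.Prime], q % 8 = 7 → ∀ {k : ℤ}, 2 * n ^ 2 = q * k → (q : ℤ) ∣ n := by
    intro q _ hq k hk
    have hq' := Nat.prime_iff_prime_int.1 (Fact.out : q.Prime)
    rcases hq'.dvd_or_dvd (Dvd.intro _ hk.symm) with g | g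
    · exact absurd (by exact_mod_cast (ZMod.intCast_zmod_eq_zero_iff_dvd 2 q).2 g)
        (two_ne_zero_of_mod (q := q) (by omega))
    · exact hq'.dvd_of_dvd_pow g
  by_cases hpM : (p : ℤ) ∣ M <;> by_cases hlM : (l : ℤ) ∣ M
  · obtain ⟨M, rfl⟩ := hpl'.mul_dvd hpM hlM
    obtain ⟨n, rfl⟩ := hpl'.mul_dvd
      (hnd hp (k := p ^ 3 * l ^ 4 * M ^ 4 + p * l ^ 2 * e ^ 4) (by rw [h]; ring))
      (hnd hl (k := p ^ 4 * l ^ 3 * M ^ 4 + p ^ 2 * l * e ^ 4) (by rw [h]; ring))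
    refine quadraticChar_of_phi_two_coprime hp hl hs hab ha hb hab4 (M := e) (e := M) (n := n)
      ?_ ?_ hw
    · exact (hc.symm.of_mul_right_left.mul_right hc.symm.of_mul_right_right.pow_right).pow_left
    · exact mul_left_cancel₀ (pow_ne_zero 2 (mul_ne_zero hp'.ne_zero hl'.ne_zero))
        (by linear_combination h)
  · obtain ⟨M, rfl⟩ := hpM
    obtain ⟨n, rfl⟩ := hnd hp (k := p ^ 3 * M ^ 4 + p * l ^ 2 * e ^ 4) (by rw [h]; ring)
    refine quadraticChar_of_phi_two_mixed hp hl hs hab ha hb hab4 (M := e) (e := M) (n := n)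
      ?_ ?_ hw
    · refine IsCoprime.mul_left (IsCoprime.mul_right hpl'.symm ?_)
        (hc.symm.of_mul_right_left.mul_right hc.symm.of_mul_right_right.pow_right).pow_left
      exact (Nat.Prime.int_coprime_iff.2 fun g => hlM (g.mul_left _)).pow_right
    · exact mul_left_cancel₀ (pow_ne_zero 2 hp'.ne_zero) (by linear_combination h)
  · obtain ⟨M, rfl⟩ := hlM
    obtain ⟨n, rfl⟩ := hnd hl (k := l ^ 3 * M ^ 4 + p ^ 2 * l * e ^ 4) (by rw [h]; ring)
    refine quadraticChar_of_phi_two_mixed hp hl hs hab ha hb hab4 (M := M) (e := e) (n := n)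
      ?_ ?_ hw
    · refine IsCoprime.mul_left (IsCoprime.mul_right hpl'.symm hc.of_mul_left_left.pow_right)
        (IsCoprime.mul_right ?_ hc.of_mul_left_right.pow_right).pow_left
      exact (Nat.Prime.int_coprime_iff.2 fun g => hpM (g.mul_left _)).symm
    · exact mul_left_cancel₀ (pow_ne_zero 2 hl'.ne_zero) (by linear_combination h)
  · refine quadraticChar_of_phi_two_coprime hp hl hs hab ha hb hab4 (M := M) (e := e) (n := n)
      ?_ h hw
    exact (((Nat.Prime.int_coprime_iff.2 hpM).symm.mul_right
      (Nat.Prime.int_coprime_iff.2 hlM).symm).mul_right hc.pow_right).pow_left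

end

/-! ### Conclusion -/

theorem HasNontrivialPoint.exists_int_of_squarefree {b : ℕ} {c : ℤ} (hb : Squarefree b)
    (h : HasNontrivialPoint b (b * c)) :
    ∃ n M e : ℤ, IsCoprime M e ∧ b * n ^ 2 = M ^ 4 + c * e ^ 4 := by
  obtain ⟨N, M, e, hc, h⟩ := HasNontrivialPoint.exists_int (b₁ := b) (b₂ := b * c)
    (by push_cast; exact h)
  obtain ⟨n, rfl⟩ := ((Int.squarefree_natCast.2 hb).dvd_pow_iff_dvd two_ne_zero).1
    (show (b : ℤ) ∣ N ^ 2 from ⟨M ^ 4 + c * e ^ 4, by rw [h]; ring⟩)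
  exact ⟨n, M, e, hc, mul_left_cancel₀ (Nat.cast_ne_zero.2 hb.ne_zero) (by linear_combination h)⟩

theorem PhiTorsorHasPoint.exists_int {k : ℤ} (hk : Odd k) {b : ℕ} {c : ℤ} (hb : Squarefree b)
    (hbc : b ^ 2 * c = 4 * k ^ 2) (h : PhiTorsorHasPoint k b) :
    ∃ n M e : ℤ, IsCoprime M e ∧ b * n ^ 2 = M ^ 4 + c * e ^ 4 := by
  obtain ⟨b₂, hb₂, h⟩ := h
  rw [if_pos hk] at hb₂
  have hbc' : (b : ℚ) ^ 2 * c = 4 * (k : ℚ) ^ 2 := by exact_mod_cast hbc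
  obtain rfl : b₂ = b * c :=
    mul_left_cancel₀ (Nat.cast_ne_zero.2 hb.ne_zero) (by linear_combination hb₂ - hbc')
  exact h.exists_int_of_squarefree hb

theorem PsiTorsorHasPoint.exists_int {k : ℤ} {b : ℕ} {c : ℤ} (hb : Squarefree b)
    (hbc : b ^ 2 * c = -k ^ 2) (h : PsiTorsorHasPoint k b) :
    ∃ n M e : ℤ, IsCoprime M e ∧ b * n ^ 2 = M ^ 4 + c * e ^ 4 := by
  obtain ⟨b₂, hb₂, h⟩ := h
  have hbc' : (b : ℚ) ^ 2 * c = -(k : ℚ) ^ 2 := by exact_mod_cast hbc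
  obtain rfl : b₂ = b * c :=
    mul_left_cancel₀ (Nat.cast_ne_zero.2 hb.ne_zero) (by linear_combination hb₂ - hbc')
  exact h.exists_int_of_squarefree hb

theorem IsNormalizedGaussian.mod_eq {π : GaussianInt} (h : IsNormalizedGaussian π) :
    (π.re - π.im) % 8 = 1 ∧ π.im % 4 = 2 := by
  obtain ⟨β, hβ⟩ := h
  have h1 := congrArg Zsqrtd.re hβ
  have h2 := congrArg Zsqrtd.im hβ
  simp only [Zsqrtd.re_sub, Zsqrtd.im_sub, Zsqrtd.re_mul, Zsqrtd.im_mul] at h1 h2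
  omega

theorem IsPrimaryElement.mod_eq {Λ : ℤ√2} (h : IsPrimaryElement Λ) (hn : Λ.norm % 2 = 1) :
    Λ.re % 2 = 1 ∧ Λ.im % 2 = 0 ∧ (Λ.re + Λ.im) % 4 = 1 := by
  obtain ⟨x, β, hβ⟩ := h
  have h1 := congrArg Zsqrtd.re hβ
  have h2 := congrArg Zsqrtd.im hβ
  simp only [sq, Zsqrtd.re_sub, Zsqrtd.im_sub, Zsqrtd.re_mul, Zsqrtd.im_mul, Zsqrtd.re_ofNat,
    Zsqrtd.im_ofNat] at h1 h2
  rw [Zsqrtd.norm_def, mul_assoc] at hn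
  have ha : Λ.re % 2 = 1 := by
    rcases Int.emod_two_eq_zero_or_one Λ.re with h0 | h0
    · obtain ⟨t, ht⟩ : (2 : ℤ) ∣ Λ.re := Int.dvd_of_emod_eq_zero h0
      rw [ht, mul_assoc] at hn
      omega
    · exact h0
  have hr : x.re % 2 = 1 := by
    rcases Int.emod_two_eq_zero_or_one x.re with h0 | h0
    · obtain ⟨t, ht⟩ : (2 : ℤ) ∣ x.re := Int.dvd_of_emod_eq_zero h0
      rw [ht] at h1
      have : Λ.re = 2 * (2 * β.re + 2 * t * t + x.im * x.im) := by linear_combination h1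
      omega
    · exact h0
  obtain ⟨r, hr'⟩ : ∃ r, x.re = 2 * r + 1 := ⟨x.re / 2, by omega⟩
  rcases Int.even_or_odd' x.im with ⟨s, hs | hs⟩
  all_goals
    rw [hr', hs] at h1 h2
    ring_nf at h1 h2
    omega

theorem quadraticSymbol_eq_one_of_norm {l : ℕ} [Fact l.Prime] {π ϖ : GaussianInt}
    (hϖ : ϖ.norm = l)
    (h : ∀ j : ZMod l, j ^ 2 = -1 → χ[l] ((1 + j) * (π.re + π.im * j)) = 1) :
    quadraticSymbol ((⟨1, 1⟩ : GaussianInt) * π) ϖ = 1 := by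
  have hϖ' : ϖ.norm.natAbs = l := by rw [hϖ, Int.natAbs_natCast]
  obtain ⟨w, hw, h0⟩ := Zsqrtd.exists_root hϖ'
  refine quadraticSymbol_eq_one hϖ' hw h0 ?_
  refine Eq.trans (congrArg _ ?_) (h w (by rw [hw]; push_cast; ring))
  simp only [Zsqrtd.re_mul, Zsqrtd.im_mul]
  push_cast at hw ⊢
  linear_combination -(π.im : ZMod l) * hw

theorem proposition6 (p l : ℕ) [Fact p.Prime] [Fact l.Prime] (hpl : p ≠ l)
    (hmod : p ≡ l [MOD 8])
    (hp : p ≡ 3 [MOD 8] ∨ p ≡ 5 [MOD 8] ∨ p ≡ 7 [MOD 8]) :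
    -- `p ≡ l ≡ 5 (mod 8)`, `(p/l) = +1`
    (p ≡ 5 [MOD 8] → legendreSym l p = 1 →
      (PhiTorsorHasPoint (p * l) p ∨ PhiTorsorHasPoint (p * l) l ∨
        PhiTorsorHasPoint (p * l) (p * l)) →
      quarticSymbol p l = quarticSymbol l p) ∧
    -- `p ≡ l ≡ 5 (mod 8)`, `(p/l) = -1`
    (p ≡ 5 [MOD 8] → legendreSym l p = -1 →
      (PhiTorsorHasPoint (p * l) (2 * p) ∨ PhiTorsorHasPoint (p * l) (2 * l) ∨
        PhiTorsorHasPoint (p * l) (p * l)) →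
      ∀ π ϖ : GaussianInt, π.norm = p → ϖ.norm = l → IsNormalizedGaussian π →
        quadraticSymbol ((⟨1, 1⟩ : GaussianInt) * π) ϖ = 1) ∧
    -- `p ≡ l ≡ 7 (mod 8)`, `(p/l) = +1`
    (p ≡ 7 [MOD 8] → legendreSym l p = 1 →
      (PhiTorsorHasPoint (p * l) 2 ∨ PsiTorsorHasPoint (p * l) p ∨
        PsiTorsorHasPoint (p * l) l) →
      ∀ Λ P : ℤ√2, Λ.norm = -l → IsPrimaryElement Λ → (P.norm = p ∨ P.norm = -p) →
        quadraticSymbol Λ P = 1) := by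
  have hp8 : p % 8 = l % 8 := hmod
  have hp2 : p % 2 = 1 := by unfold Nat.ModEq at hp; omega
  have hk : Odd ((p : ℤ) * l) := by
    rw [Int.odd_mul, Int.odd_coe_nat, Int.odd_coe_nat, Nat.odd_iff, Nat.odd_iff]; omega
  have hps : Squarefree p := (Fact.out : p.Prime).prime.squarefree
  have hls : Squarefree l := (Fact.out : l.Prime).prime.squarefree
  have h2s : Squarefree 2 := Nat.prime_two.prime.squarefree
  have hpls : Squarefree (p * l) :=
    (Nat.squarefree_mul ((Nat.coprime_primes Fact.out Fact.out).2 hpl)).2 ⟨hps, hls⟩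
  have hsq : ∀ {q : ℕ}, q % 2 = 1 → Squarefree q → Squarefree (2 * q) := fun hq hqs =>
    (Nat.squarefree_mul (Nat.coprime_two_left.2 (Nat.odd_iff.2 hq))).2 ⟨h2s, hqs⟩
  refine ⟨fun h5 hs h => ?_, fun h5 hs h π ϖ hπ hϖ hn => ?_, fun h7 hs h Λ P hΛ hprim hP => ?_⟩
  · have hp5 : p % 8 = 5 := h5
    have hl5 : l % 8 = 5 := by omega
    rcases h with h | h | h
    · obtain ⟨n, M, e, hc, h⟩ := h.exists_int hk (c := 4 * l ^ 2) hps (by ring)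
      exact quarticSymbol_eq_of_phi_point hp5 hl5 hpl hs hc h
    · obtain ⟨n, M, e, hc, h⟩ := h.exists_int hk (c := 4 * p ^ 2) hls (by ring)
      refine (quarticSymbol_eq_of_phi_point hl5 hp5 hpl.symm ?_ hc h).symm
      rw [← hs, legendreSym.quadratic_reciprocity_one_mod_four (by omega) (by omega)]
    · obtain ⟨n, M, e, hc, h⟩ := PhiTorsorHasPoint.exists_int (b := p * l) hk (c := 4) hpls
        (by push_cast; ring) (by push_cast; exact h)
      exact quarticSymbol_eq_of_phi_mul_point hp5 hl5 hpl hs hc (n := n)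
        (by push_cast at h; linear_combination h)
  · have hp5 : p % 8 = 5 := h5
    have hl5 : l % 8 = 5 := by omega
    obtain ⟨hn1, hn2⟩ := hn.mod_eq
    have hab : π.re ^ 2 + π.im ^ 2 = p := by rw [← hπ, Zsqrtd.norm_def]; ring
    refine quadraticSymbol_eq_one_of_norm hϖ fun j hj => ?_
    rcases h with h | h | h
    · obtain ⟨n, M, e, hc, h⟩ := PhiTorsorHasPoint.exists_int (b := 2 * p) hk (c := l ^ 2)
        (hsq hp2 hps) (by push_cast; ring) (by push_cast; exact h)
      exact quadraticChar_of_phi_two_mul hl5 hpl hc (by exact_mod_cast h) hab hn1 hn2 hj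
    · obtain ⟨n, M, e, hc, h⟩ := PhiTorsorHasPoint.exists_int (b := 2 * l) hk (c := p ^ 2)
        (hsq (by omega) hls) (by push_cast; ring) (by push_cast; exact h)
      -- The argument for `2p` with the primes exchanged gives the symbol of `(1 + i)λ` modulo `π`;
      -- reciprocity for normalized primes turns it around.
      obtain ⟨c, d, hcd, hn', hd⟩ := exists_normalized hl5
      exact quadraticChar_normalized_recip hp5 hl5 hpl hs hab hn1 hn2 hcd hn' hd
        (fun i hi => quadraticChar_of_phi_two_mul hp5 hpl.symm hc (by exact_mod_cast h)
          hcd hn' hd hi) hj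
    · obtain ⟨n, M, e, hc, h⟩ := PhiTorsorHasPoint.exists_int (b := p * l) hk (c := 4) hpls
        (by push_cast; ring) (by push_cast; exact h)
      exact quadraticChar_of_phi_mul hp5 hl5 hpl hs hc (n := n)
        (by push_cast at h; linear_combination h) hab hn1 hn2 hj
  · have hp7 : p % 8 = 7 := h7
    have hl7 : l % 8 = 7 := by omega
    obtain ⟨ha, hb, hab4⟩ := hprim.mod_eq (by omega)
    have hab : Λ.re ^ 2 - 2 * Λ.im ^ 2 = -l := by rw [← hΛ, Zsqrtd.norm_def]; ring
    have hP' : P.norm.natAbs = p := by omega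
    obtain ⟨w, hw, h0⟩ := Zsqrtd.exists_root hP'
    refine quadraticSymbol_eq_one hP' hw h0 ?_
    replace hw : w ^ 2 = 2 := by rw [hw]; norm_num
    rcases h with h | h | h
    · obtain ⟨n, M, e, hc, h⟩ := PhiTorsorHasPoint.exists_int (b := 2) hk (c := p ^ 2 * l ^ 2) h2s
        (by push_cast; ring) (by push_cast; exact h)
      exact quadraticChar_of_phi_two hp7 hl7 hpl hs hab ha hb hab4 hc (by exact_mod_cast h) hw
    · obtain ⟨n, M, e, hc, h⟩ := h.exists_int (c := -l ^ 2) hps (by ring)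
      exact quadraticChar_of_psi_left hp7 hl7 hpl hs hab ha hb hab4 hc (n := n)
        (by linear_combination h) hw
    · obtain ⟨n, M, e, hc, h⟩ := h.exists_int (c := -p ^ 2) hls (by ring)
      exact quadraticChar_of_psi_right hp7 hl7 hpl hs hab ha hb hab4 hc (n := n)
        (by linear_combination h) hw
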